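/- **Setting.** A planar piecewise smooth vector field $Z=(X,Y)$ is given by $X$ on $\Sigma^+=\{y\ge 0\}$ and $Y$ on $\Sigma^-=\{y\le 0\}$, with switching line $\Sigma=\{y=0\}$. Its local trajectories (Filippov's convention) are orbits of $X$ inside $\Sigma^+$, orbits of $Y$ inside $\Sigma^-$, orbits of the sliding field $Z^T=\frac{(Yf)X-(Xf)Y}{Yf-Xf}$ (with $f(x,y)=y$), defined where $Xf\cdot Yf<0$ and extended continuously to the closure of that set, and the rest at singular tangencies (points of $\Sigma$ that are invisible folds of both $X$ and $Y$). A *trajectory* on an open interval $J=(\alpha,\omega)$ is a concatenation of local trajectories on intervals $[t_i,t_{i+1}]$, $i\in\mathbb Z$, with $t_i\to\omega$ as $i\to\infty$ and $t_i\to\alpha$ as $i\to-\infty$; it is *maximal* if no trajectory on a larger open interval extends it, and a *global trajectory* if $J=\mathbb R$. Write $\sigma$ for the shift $(\sigma a)_j=a_{j+1}$. Spaces of sequences carry the metric $d(a,b)=\sum_{j\in\mathbb Z}|a_j-b_j|/2^{|j|}$; a subshift is a closed set $S$ with $\sigma(S)=S$. **Time-one maps.** Let $P_k(x)=-\left(x+\frac{k-1}2\right)\left(x-\frac{k-1}2\right)\prod_{i=1}^{k-1}\left(x-\left(i-\frac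 k2\right)\right)^2$ for $k\ge2$, $P_\infty(x)=\frac{1-\cos 2\pi x}{\pi}$, and let $\Lambda_k$ be the union of the graphs of $P_k$ and $-P_k$ over $[\frac{1-k}2,\frac{k-1}2]$ (over $\mathbb R$ if $k=\infty$). The points $(p_j,0)$, with $p_j=j-\frac k2$, $1\le j\le k-1$ (with $p_j=j$, $j\in\mathbb Z$, if $k=\infty$), cut $\Lambda_k$ into arcs. For $k<\infty$, $I_0$ and $I_{2k-3}$ are the leftmost and the rightmost loop, and for $1\le j\le k-2$ the sets $I_{2j-1}$, $I_{2j}$ are the upper and the lower open arc from $p_j$ to $p_{j+1}$; for $k=\infty$, $I_{2j}$ and $I_{2j+1}$ are the upper and the lower open arc over $(j,j+1)$. Let $\Omega_k$ be the set of global trajectories $\gamma$ of $Z_k$ with $\gamma(0)\in\Lambda_k$. The itinerary $s(\gamma)=(s_j)_{j\in\mathbb Z}$ of $\gamma\in\Omega_k$ is given by $\gamma(j)\in I_{s_j}$ or, if $\gamma(j)$ is one of the points $(p_l,0)$, by $\gamma(j+\frac12)\in I_{s_j}$. Let $\overline\Omega_k$ be $\Omega_k$ modulo having the same itinerary, with the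 metric $\rho(\bar\gamma_1,\bar\gamma_2)=\sum_{i\in\mathbb Z}2^{-|i|}d_H(\gamma_1^*([i,i+1]),\gamma_2^*([i,i+1]))$, where $d_H$ is the Hausdorff distance and $\gamma^*$ is the unique element of the class $\bar\gamma$ with $\gamma^*(0)\in\{(p_l,0)\}$. The time-one map $T_1(\gamma)=\gamma(\cdot+1)$ maps $\Omega_k$ into itself and induces a homeomorphism $\overline T_1$ of $\overline\Omega_k$. All these objects are well defined, and the following holds. (i) For $Z_2=\left(\left(1,\frac x2-4x^3\right),\left(-1,\frac x2-4x^3\right)\right)$, the set $\Lambda_2$ is compact and invariant, and $s$ induces a homeomorphism from $\overline\Omega_2$ onto $\{0,1\}^{\mathbb Z}$ that conjugates $\overline T_1$ to the full shift $\sigma$. (ii) For every $k\ge3$ and $Z_k=\left((1,P_k'(x)),(-1,P_k'(x))\right)$, the set $\Lambda_k$ is compact and invariant, and $s$ induces a homeomorphism from $\overline\Omega_k$ onto a subshift of $\{0,\dots,2k-3\}^{\mathbb Z}$, in which each of the $2(k-1)$ symbols occurs, that conjugates $\overline T_1$ to $\sigma$. (iii) For $Z_\infty=\left((1,2\sin2\pi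 x),(-1,2\sin2\pi x)\right)$, the set $\Lambda_\infty$ is invariant, and $s$ induces a homeomorphism that conjugates $\overline T_1$ on $\overline\Omega_\infty$ to $\sigma$ on a subshift of $\Theta_\infty=\{a\in\mathbb Z^{\mathbb Z}:|a_{j+1}-a_j|\le2\ \forall j\}$, namely the set of all sequences $a$ such that, for every $j$, $a_{j+1}\in\{a_j+1,a_j+2\}$ if $a_j$ is even and $a_{j+1}\in\{a_j-1,a_j-2\}$ if $a_j$ is odd. (iv) Let $Z=\left((1,-2x),(-2,-4x^3+2x)\right)$, $\Lambda=\{-1\le x\le1,\ \frac{x^4}2-\frac{x^2}2\le y\le1-x^2\}$ and $K=\{0\}\times(0,1]$. The set $\Lambda$ is compact and invariant under maximal trajectories. Let $\Omega$ be the set of maximal trajectories $\gamma:J\to\Lambda$ with $0\in J$. The times at which $\gamma\in\Omega$ meets $K$ form a strictly increasing sequence $(t_j)_{j\in\mathbb Z}$ with $t_0\le0<t_1$. Let $s_j(\gamma)$ be the $y$-coordinate of $\gamma(t_j)$, let $\mathcal T(\gamma)=\gamma(\cdot+\eta)$, with $\eta$ the first positive time at which $\gamma$ meets $K$, be the return map,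 and let $\overline\Omega$ be $\Omega$ modulo having the same $s$, with the metric $\rho=\sum_{i\in\mathbb Z}2^{-|i|}d_i$, where $d_i$ is the Hausdorff distance between the loops $\gamma^*([t_i,t_{i+1}])$ of the unique representatives $\gamma^*$ with $\gamma^*(0)\in K$. Then $\mathcal T$ induces a homeomorphism of $\overline\Omega$, and $s$ induces a homeomorphism from $\overline\Omega$ onto $(0,1]^{\mathbb Z}$ that conjugates it to $\sigma:(0,1]^{\mathbb Z}\to(0,1]^{\mathbb Z}$. Moreover, $\gamma\in\Omega$ is a global trajectory (is defined on $\mathbb R$) if and only if $\sum_{j\ge0}\sqrt{s_j(\gamma)}=\sum_{j\ge0}\sqrt{s_{-j}(\gamma)}=\infty$. -/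

import Mathlib

open Set Filter Topology

noncomputable section

/-! ### Metrics, conjugacies, shifts -/

/-- `d` is a metric on `α`. -/
def IsMetricFn {α : Type*} (d : α → α → ℝ) : Prop :=
  (∀ x y, 0 ≤ d x y) ∧ (∀ x y, d x y = 0 ↔ x = y) ∧ (∀ x y, d x y = d y x) ∧
    ∀ x y z, d x z ≤ d x y + d y z

/-- The topology whose open sets contain a `d`-ball around each of their points (the metric topology
when `d` is a metric). -/
@[reducible] def distTopology {α : Type*} (d : α → α → ℝ) : TopologicalSpace α where
  IsOpen U := ∀ x ∈ U, ∃ ε > 0, ∀ y, d x y < ε → y ∈ U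
  isOpen_univ := fun _ _ => ⟨1, one_pos, fun _ _ => mem_univ _⟩
  isOpen_inter := by
    rintro U V hU hV x ⟨hxU, hxV⟩
    obtain ⟨ε, hε, h⟩ := hU x hxU
    obtain ⟨δ, hδ, h'⟩ := hV x hxV
    exact ⟨min ε δ, lt_min hε hδ, fun y hy =>
      ⟨h y (lt_of_lt_of_le hy (min_le_left _ _)), h' y (lt_of_lt_of_le hy (min_le_right _ _))⟩⟩
  isOpen_sUnion := by
    rintro 𝒰 h𝒰 x ⟨U, hU, hxU⟩
    obtain ⟨ε, hε, h⟩ := h𝒰 U hU x hxU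
    exact ⟨ε, hε, fun y hy => ⟨U, hU, h y hy⟩⟩

/-- `h` is a homeomorphism from `(α, d)` onto `(β, d')`. -/
def IsHomeoFn {α β : Type*} (d : α → α → ℝ) (d' : β → β → ℝ) (h : α → β) : Prop :=
  @IsHomeomorph α β (distTopology d) (distTopology d') h

/-- The shift of bi-infinite sequences. -/
def shift {E : Type*} (a : ℤ → E) : ℤ → E := fun j => a (j + 1)

/-- The terms of the series defining the distance of two bi-infinite sequences. -/
def seqTerm {E : Type*} [Dist E] (a b : ℤ → E) (j : ℤ) : ℝ := dist (a j) (b j) / 2 ^ j.natAbs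

/-- `d(a, b) = ∑_{j ∈ ℤ} |a_j - b_j| / 2^|j|`. -/
def seqDist {E : Type*} [Dist E] (a b : ℤ → E) : ℝ := ∑' j : ℤ, seqTerm a b j

/-- The distance `seqDist` on a set of sequences. -/
def seqDistOn {E : Type*} [Dist E] (S : Set (ℤ → E)) (a b : S) : ℝ :=
  seqDist (a : ℤ → E) (b : ℤ → E)

/-- `A^ℤ`. -/
def fullShift {E : Type*} (A : Set E) : Set (ℤ → E) := {a | ∀ j, a j ∈ A}

/-- `S` is a subshift of the sequence space `(B, seqDist)`: closed in `B` and shift invariant. -/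
def IsSubshift {E : Type*} [Dist E] (B S : Set (ℤ → E)) : Prop :=
  S ⊆ B ∧ @IsClosed B (distTopology (seqDistOn B)) (Subtype.val ⁻¹' S) ∧ shift '' S = S

/-- Let `s : Ω → E^ℤ` be an itinerary map, `T : Ω → Ω`, and `ρ` a function of two variables on the
quotient `Ω/s` of `Ω` by "equal itineraries". Then `ρ` and `d` are metrics, `T` and `s` descend to
homeomorphisms `T̄` of `(Ω/s, ρ)` and `s̄` from `(Ω/s, ρ)` onto `(S, d)`, the set `S` is shift
invariant, and `s̄ ∘ T̄ = σ ∘ s̄`. -/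
def ItineraryConjugacy {Ω E : Type*} [Dist E] (s : Ω → ℤ → E) (T : Ω → Ω)
    (ρ : Quotient (Setoid.ker s) → Quotient (Setoid.ker s) → ℝ) (S : Set (ℤ → E)) : Prop :=
  IsMetricFn ρ ∧ (∀ a ∈ S, ∀ b ∈ S, Summable (seqTerm a b)) ∧ IsMetricFn (seqDistOn S) ∧
  shift '' S = S ∧
  ∃ (Tbar : Quotient (Setoid.ker s) → Quotient (Setoid.ker s))
    (sbar : Quotient (Setoid.ker s) → S),
    (∀ γ : Ω, Tbar (Quotient.mk _ γ) = Quotient.mk _ (T γ)) ∧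
    (∀ γ : Ω, (sbar (Quotient.mk _ γ) : ℤ → E) = s γ) ∧
    IsHomeoFn ρ ρ Tbar ∧
    IsHomeoFn ρ (seqDistOn S) sbar ∧
    ∀ q, (sbar (Tbar q) : ℤ → E) = shift (sbar q : ℤ → E)

/-! ### Planar piecewise smooth vector fields with switching line `Σ = {y = 0}`

The field is `X` on `Σ⁺ = {y ≥ 0}` and `Y` on `Σ⁻ = {y ≤ 0}`; with `f(x, y) = y`, the Lie derivatives
`Xf`, `Yf` are the second components of `X`, `Y`. -/

abbrev Plane := EuclideanSpace ℝ (Fin 2)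

/-- `Σˢ ∪ Σᵉ`: sliding points (`Xf < 0 < Yf`) and escaping points (`Yf < 0 < Xf`). -/
def slidingSet (X Y : Plane → Plane) : Set Plane :=
  {p | p 1 = 0 ∧ ((X p 1 < 0 ∧ 0 < Y p 1) ∨ (0 < X p 1 ∧ Y p 1 < 0))}

/-- The sliding vector field `(Yf · X - Xf · Y) / (Yf - Xf)`, meaningful on `Σˢ ∪ Σᵉ`. -/
def slidingField (X Y : Plane → Plane) (p : Plane) : Plane :=
  (Y p 1 - X p 1)⁻¹ • (Y p 1 • X p - X p 1 • Y p)

/-- `v` is the value at `p` of the continuous extension of the sliding vector field to the closure of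
`Σˢ ∪ Σᵉ`. -/
def IsSlidingVelocity (X Y : Plane → Plane) (p v : Plane) : Prop :=
  p ∈ closure (slidingSet X Y) ∧ Tendsto (slidingField X Y) (𝓝[slidingSet X Y] p) (𝓝 v)

/-- A singular tangency: a fold of `X` and of `Y`, invisible for both. -/
def SingularTangency (X Y : Plane → Plane) (p : Plane) : Prop :=
  p 1 = 0 ∧ X p 1 = 0 ∧ fderiv ℝ (fun q => X q 1) p (X p) < 0 ∧
    Y p 1 = 0 ∧ 0 < fderiv ℝ (fun q => Y q 1) p (Y p)

/-- On `[a, b]`, the curve `γ` is a piece of local trajectory: an orbit of `X` in `Σ⁺`, an orbit of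
`Y` in `Σ⁻`, an orbit of the (extended) sliding vector field, or the rest at a singular tangency. -/
def IsArc (X Y : Plane → Plane) (γ : ℝ → Plane) (a b : ℝ) : Prop :=
  (∀ t ∈ Icc a b, 0 ≤ γ t 1 ∧ HasDerivWithinAt γ (X (γ t)) (Icc a b) t) ∨
  (∀ t ∈ Icc a b, γ t 1 ≤ 0 ∧ HasDerivWithinAt γ (Y (γ t)) (Icc a b) t) ∨
  (∀ t ∈ Icc a b, ¬ SingularTangency X Y (γ t) ∧
    ∃ v, IsSlidingVelocity X Y (γ t) v ∧ HasDerivWithinAt γ v (Icc a b) t) ∨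
  (∃ p, SingularTangency X Y p ∧ ∀ t ∈ Icc a b, γ t = p)

/-- `γ : ℝ → ℝ²` is a global trajectory: a concatenation of pieces of local trajectories on
`[t_i, t_{i+1}]`, with `t_i → ±∞` as `i → ±∞`. -/
def IsGlobalTrajectory (X Y : Plane → Plane) (γ : ℝ → Plane) : Prop :=
  ∃ t : ℤ → ℝ, StrictMono t ∧ Tendsto t atTop atTop ∧ Tendsto t atBot atBot ∧
    ∀ i, IsArc X Y γ (t i) (t (i + 1))

/-- `γ` is a trajectory on the open interval `J`: the same, with `t_i` tending to the two ends of `J`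
as `i → ±∞`. A trajectory on `ℝ` is a global trajectory. -/
def IsTrajectoryOn (X Y : Plane → Plane) (J : Set ℝ) (γ : ℝ → Plane) : Prop :=
  ∃ t : ℤ → ℝ, StrictMono t ∧ (⋃ i, Icc (t i) (t (i + 1))) = J ∧
    ∀ i, IsArc X Y γ (t i) (t (i + 1))

/-- A maximal trajectory: one that no trajectory on a larger open interval extends. -/
def IsMaximalTrajectory (X Y : Plane → Plane) (J : Set ℝ) (γ : ℝ → Plane) : Prop :=
  IsTrajectoryOn X Y J γ ∧
    ∀ J' γ', IsTrajectoryOn X Y J' γ' → J ⊆ J' → EqOn γ' γ J → J' = J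

/-! ### The time-one map on the space of global trajectories

Data: the field `(X, Y)`, an invariant set `L`, the set `M` of marked points of `L`, and a partition
of `L \ M` into arcs `I n`. -/

/-- The space `Ω` of global trajectories with `γ(0) ∈ L`. -/
abbrev Omega (X Y : Plane → Plane) (L : Set Plane) :=
  {γ : ℝ → Plane // IsGlobalTrajectory X Y γ ∧ γ 0 ∈ L}

/-- `n` is the `j`-th symbol of `γ`: `γ(j) ∈ I_n`, or `γ(j)` is marked and `γ(j + 1/2) ∈ I_n`. -/
def IsSymbol (M : Set Plane) (I : ℤ → Set Plane) (γ : ℝ → Plane) (j n : ℤ) : Prop :=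
  γ j ∈ I n ∨ (γ j ∈ M ∧ γ ((j : ℝ) + 1 / 2) ∈ I n)

/-- The itinerary of `γ`. -/
def itinerary (X Y : Plane → Plane) (L M : Set Plane) (I : ℤ → Set Plane)
    (γ : Omega X Y L) (j : ℤ) : ℤ :=
  Classical.epsilon (IsSymbol M I γ.1 j)

/-- Trajectories modulo having the same itinerary. -/
abbrev OmegaBar (X Y : Plane → Plane) (L M : Set Plane) (I : ℤ → Set Plane) :=
  Quotient (Setoid.ker (itinerary X Y L M I))

/-- `γ` is the representative of the class `q` that starts at a marked point. -/
def IsRep (X Y : Plane → Plane) (L M : Set Plane) (I : ℤ → Set Plane)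
    (q : OmegaBar X Y L M I) (γ : Omega X Y L) : Prop :=
  Quotient.mk _ γ = q ∧ γ.1 0 ∈ M

def rep (X Y : Plane → Plane) (L M : Set Plane) (I : ℤ → Set Plane)
    (q : OmegaBar X Y L M I) : Omega X Y L :=
  @Classical.epsilon _ ⟨q.out⟩ (IsRep X Y L M I q)

/-- `d_H(γ₁*([i, i+1]), γ₂*([i, i+1])) / 2^|i|`. -/
def rhoTerm (X Y : Plane → Plane) (L M : Set Plane) (I : ℤ → Set Plane)
    (q q' : OmegaBar X Y L M I) (i : ℤ) : ℝ :=
  Metric.hausdorffDist ((rep X Y L M I q).1 '' Icc (i : ℝ) ((i : ℝ) + 1))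
    ((rep X Y L M I q').1 '' Icc (i : ℝ) ((i : ℝ) + 1)) / 2 ^ i.natAbs

def rho (X Y : Plane → Plane) (L M : Set Plane) (I : ℤ → Set Plane)
    (q q' : OmegaBar X Y L M I) : ℝ :=
  ∑' i : ℤ, rhoTerm X Y L M I q q' i

/-- `L` is invariant, itineraries, distinguished representatives and the distance `ρ` are well
defined, and the time-one map of `Ω`, modulo equal itineraries, is conjugate by the itinerary map to
the shift on `S`. -/
def TimeOneConjugacy (X Y : Plane → Plane) (L M : Set Plane) (I : ℤ → Set Plane)
    (S : Set (ℤ → ℤ)) : Prop :=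
  (∀ γ, IsGlobalTrajectory X Y γ → (∃ t, γ t ∈ L) → ∀ t, γ t ∈ L) ∧
  (∀ (γ : Omega X Y L) (j : ℤ), ∃! n, IsSymbol M I γ.1 j n) ∧
  (∀ q : OmegaBar X Y L M I, ∃! γ, IsRep X Y L M I q γ) ∧
  (∀ q q' : OmegaBar X Y L M I, Summable (rhoTerm X Y L M I q q')) ∧
  ∃ T : Omega X Y L → Omega X Y L, (∀ γ t, (T γ).1 t = γ.1 (t + 1)) ∧
    ItineraryConjugacy (itinerary X Y L M I) T (rho X Y L M I) S

/-! ### The fields `Z_k` and `Z_∞` -/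

/-- The vector field `(c, g(x))`. -/
def planeField (c : ℝ) (g : ℝ → ℝ) (q : Plane) : Plane := !₂[c, g (q 0)]

/-- `P_k`. -/
def polyP (k : ℕ) (x : ℝ) : ℝ :=
  -(x + ((k : ℝ) - 1) / 2) * (x - ((k : ℝ) - 1) / 2) *
    ∏ i ∈ Finset.Icc 1 (k - 1), (x - ((i : ℝ) - (k : ℝ) / 2)) ^ 2

/-- The `x`-coordinate `p_j = j - k/2` of the `j`-th two-fold of `Z_k`. -/
def foldX (k : ℕ) (j : ℤ) : ℝ := (j : ℝ) - (k : ℝ) / 2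

/-- `Λ_k`: the union of the graphs of `P_k` and `-P_k` over `[(1-k)/2, (k-1)/2]`. -/
def LambdaK (k : ℕ) : Set Plane :=
  {q | q 0 ∈ Icc ((1 - (k : ℝ)) / 2) (((k : ℝ) - 1) / 2) ∧
    (q 1 = polyP k (q 0) ∨ q 1 = -polyP k (q 0))}

/-- The two-folds `(p_j, 0)`, `1 ≤ j ≤ k - 1`, in `Λ_k`. -/
def foldsK (k : ℕ) : Set Plane :=
  {q | q 1 = 0 ∧ ∃ j : ℤ, 1 ≤ j ∧ j ≤ (k : ℤ) - 1 ∧ q 0 = foldX k j}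

/-- The arcs of `Λ_k` between two-folds: `I_0` and `I_{2k-3}` are the outer loops, at `p_1` and at
`p_{k-1}`; for `1 ≤ j ≤ k - 2`, `I_{2j-1}` is the upper and `I_{2j}` the lower arc between `p_j` and
`p_{j+1}`. -/
def arcK (k : ℕ) (n : ℤ) : Set Plane :=
  {q |
    (n = 0 ∧ q 0 ∈ Ico ((1 - (k : ℝ)) / 2) (foldX k 1) ∧
      (q 1 = polyP k (q 0) ∨ q 1 = -polyP k (q 0))) ∨
    (∃ j : ℤ, 1 ≤ j ∧ j ≤ (k : ℤ) - 2 ∧ n = 2 * j - 1 ∧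
      q 0 ∈ Ioo (foldX k j) (foldX k (j + 1)) ∧ q 1 = polyP k (q 0)) ∨
    (∃ j : ℤ, 1 ≤ j ∧ j ≤ (k : ℤ) - 2 ∧ n = 2 * j ∧
      q 0 ∈ Ioo (foldX k j) (foldX k (j + 1)) ∧ q 1 = -polyP k (q 0)) ∨
    (n = 2 * (k : ℤ) - 3 ∧ q 0 ∈ Ioc (foldX k ((k : ℤ) - 1)) (((k : ℝ) - 1) / 2) ∧
      (q 1 = polyP k (q 0) ∨ q 1 = -polyP k (q 0)))}

/-- The primitive `(1 - cos 2πx)/π` of `2 sin 2πx` that vanishes at the integers. -/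
def profileInf (x : ℝ) : ℝ := (1 - Real.cos (2 * Real.pi * x)) / Real.pi

/-- `Λ_∞`. -/
def LambdaInf : Set Plane := {q | q 1 = profileInf (q 0) ∨ q 1 = -profileInf (q 0)}

/-- The two-folds `(j, 0)`, `j ∈ ℤ`, in `Λ_∞`. -/
def foldsInf : Set Plane := {q | q 1 = 0 ∧ ∃ j : ℤ, q 0 = j}

/-- `I_{2j}` is the upper and `I_{2j+1}` the lower arc of `Λ_∞` over `(j, j+1)`. -/
def arcInf (n : ℤ) : Set Plane :=
  {q | ∃ j : ℤ, q 0 ∈ Ioo (j : ℝ) ((j : ℝ) + 1) ∧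
    ((n = 2 * j ∧ q 1 = profileInf (q 0)) ∨ (n = 2 * j + 1 ∧ q 1 = -profileInf (q 0)))}

/-- `Θ_∞`: integer sequences whose consecutive entries differ by at most `2`. -/
def ThetaInf : Set (ℤ → ℤ) := {a | ∀ j, |a (j + 1) - a j| ≤ 2}

/-- The sequences in which an even entry `n` is followed by `n + 1` or `n + 2`, and an odd entry `n`
by `n - 1` or `n - 2`. -/
def admissibleInf : Set (ℤ → ℤ) :=
  {a | ∀ j, (Even (a j) ∧ (a (j + 1) = a j + 1 ∨ a (j + 1) = a j + 2)) ∨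
    (Odd (a j) ∧ (a (j + 1) = a j - 1 ∨ a (j + 1) = a j - 2))}

/-! ### The first-return map on a section, on the space of maximal trajectories -/

/-- A maximal trajectory `γ : J → ℝ²` (an open interval `J ∋ 0`) that lies in `L`. As a function on
`ℝ` it is continued by `0` outside `J`, so that equality is equality of `J` and of `γ` on `J`. -/
structure MaxTraj (X Y : Plane → Plane) (L : Set Plane) where
  dom : Set ℝ
  toFun : ℝ → Plane
  maximal : IsMaximalTrajectory X Y dom toFun
  zero_mem : (0 : ℝ) ∈ dom
  mem_set : ∀ t ∈ dom, toFun t ∈ L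
  eq_zero : ∀ t, t ∉ dom → toFun t = 0

/-- `η` is the first positive time at which `γ` meets `K`. -/
def IsReturnTime {X Y : Plane → Plane} {L : Set Plane} (K : Set Plane)
    (γ : MaxTraj X Y L) (η : ℝ) : Prop :=
  IsLeast {t | 0 < t ∧ t ∈ γ.dom ∧ γ.toFun t ∈ K} η

/-- `δ` is `γ(· + η)`, with `η` the first positive time at which `γ` meets `K`. -/
def IsReturn {X Y : Plane → Plane} {L : Set Plane} (K : Set Plane)
    (γ δ : MaxTraj X Y L) : Prop :=
  ∃ η, IsReturnTime K γ η ∧ δ.dom = {t | t + η ∈ γ.dom} ∧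
    ∀ t, δ.toFun t = γ.toFun (t + η)

/-- `(t_j)` is the increasing enumeration of the times at which `γ` meets `K`, with `t_0` the last
such time in `(-∞, 0]`. -/
def IsBeats {X Y : Plane → Plane} {L : Set Plane} (K : Set Plane)
    (γ : MaxTraj X Y L) (t : ℤ → ℝ) : Prop :=
  StrictMono t ∧ range t = {u | u ∈ γ.dom ∧ γ.toFun u ∈ K} ∧ t 0 ≤ 0 ∧ 0 < t 1

def beats {X Y : Plane → Plane} {L : Set Plane} (K : Set Plane) (γ : MaxTraj X Y L) : ℤ → ℝ :=
  Classical.epsilon (IsBeats K γ)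

/-- The sequence of the `y`-coordinates of the successive hits of `K`. -/
def hitItinerary (X Y : Plane → Plane) (L K : Set Plane) (γ : MaxTraj X Y L) (j : ℤ) : ℝ :=
  γ.toFun (beats K γ j) 1

abbrev MaxBar (X Y : Plane → Plane) (L K : Set Plane) :=
  Quotient (Setoid.ker (hitItinerary X Y L K))

/-- `γ` is the representative of the class `q` that starts on `K`. -/
def IsHitRep (X Y : Plane → Plane) (L K : Set Plane) (q : MaxBar X Y L K)
    (γ : MaxTraj X Y L) : Prop :=
  Quotient.mk _ γ = q ∧ γ.toFun 0 ∈ K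

def hitRep (X Y : Plane → Plane) (L K : Set Plane) (q : MaxBar X Y L K) : MaxTraj X Y L :=
  @Classical.epsilon _ ⟨q.out⟩ (IsHitRep X Y L K q)

/-- The `i`-th loop `γ*([t_i, t_{i+1}])` of a class. -/
def loop (X Y : Plane → Plane) (L K : Set Plane) (q : MaxBar X Y L K) (i : ℤ) : Set Plane :=
  (hitRep X Y L K q).toFun ''
    Icc (beats K (hitRep X Y L K q) i) (beats K (hitRep X Y L K q) (i + 1))

def hitRhoTerm (X Y : Plane → Plane) (L K : Set Plane) (q q' : MaxBar X Y L K) (i : ℤ) : ℝ :=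
  Metric.hausdorffDist (loop X Y L K q i) (loop X Y L K q' i) / 2 ^ i.natAbs

def hitRho (X Y : Plane → Plane) (L K : Set Plane) (q q' : MaxBar X Y L K) : ℝ :=
  ∑' i : ℤ, hitRhoTerm X Y L K q q' i

/-- `L` is invariant, hitting times, distinguished representatives and the distance `ρ` are well
defined, and the return map to `K`, modulo equal itineraries, is conjugate by the itinerary map to
the shift on `S`. -/
def ReturnConjugacy (X Y : Plane → Plane) (L K : Set Plane) (S : Set (ℤ → ℝ)) : Prop :=
  (∀ J γ, IsMaximalTrajectory X Y J γ → (∃ t ∈ J, γ t ∈ L) → ∀ t ∈ J, γ t ∈ L) ∧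
  (∀ γ : MaxTraj X Y L, ∃! t, IsBeats K γ t) ∧
  (∀ q : MaxBar X Y L K, ∃! γ, IsHitRep X Y L K q γ) ∧
  (∀ q q' : MaxBar X Y L K, Summable (hitRhoTerm X Y L K q q')) ∧
  ∃ T : MaxTraj X Y L → MaxTraj X Y L, (∀ γ, IsReturn K γ (T γ)) ∧
    ItineraryConjugacy (hitItinerary X Y L K) T (hitRho X Y L K) S

/-- `X = (1, -2x)`. -/
def beanX : Plane → Plane := planeField 1 fun x => -2 * x

/-- `Y = (-2, -4x³ + 2x)`. -/
def beanY : Plane → Plane := planeField (-2) fun x => -4 * x ^ 3 + 2 * x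

/-- `Λ = {-1 ≤ x ≤ 1, x⁴/2 - x²/2 ≤ y ≤ 1 - x²}`. -/
def LambdaBean : Set Plane :=
  {q | q 0 ∈ Icc (-1 : ℝ) 1 ∧ q 1 ∈ Icc ((q 0) ^ 4 / 2 - (q 0) ^ 2 / 2) (1 - (q 0) ^ 2)}

/-- `K = {0} × (0, 1]`. -/
def sectionK : Set Plane := {q | q 0 = 0 ∧ q 1 ∈ Ioc (0 : ℝ) 1}

end

/-! The time-one maps of the fields `(±1, P')` and the return map of the bean field are analysed
by the same method: trajectories are shown to be concatenations of explicit arcs that can be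
chosen freely, subject only to matching end points, so that a trajectory is its sequence of
labels; the distance of classes is then compared with the distance of label sequences.

For the fields `(±1, P')`, the function `|y| - P(x)` is a first integral, and `Λ` is its zero
level. There are no sliding points and no singular tangencies on `Λ`, so in `Λ` a trajectory can
only move to the right along the graph of `P` or to the left along the graph of `-P`
(`IsProfile.right_step`). Away from the two-folds there is no choice, and it is at the two-folds,
where `P` is positive on both sides, that trajectories branch. All arcs, loops included, take unit
time. These facts are collected in `ArcSystem`, and `ArcSystem.timeOneConjugacy` deduces the
conjugacy. As the labels are integers, the Hausdorff distance of two arcs is comparable to the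
distance of their labels: for finitely many arcs because they are distinct compact sets, for `Z_∞`
by a direct estimate. So the two metrics are equivalent.

For the bean field, `beanX` conserves `y + x²`, `beanY` conserves `y - x⁴/2 + x²/2`, and the
sliding motion is given implicitly by `slideTime (x(t)) + t = const`; its velocity extends
continuously to the origin, which is reached in finite time. In the half `x > 0` of the bean,
trajectories are determined forwards until they reach the origin
(`IsLocalTrajectoryOn.eq_descent`): each point of that half lies on the descent from a point `(0,
r²)` of the section. The field is reversible under `(x, y, t) ↦ (-x, y, -t)`, so in the half `x <
0` the past is determined. Hence the only free choice is made when a trajectory leaves the origin,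
and a maximal trajectory is a bi-infinite sequence of bumps of arbitrary amplitudes `r_j ∈ (0,
1]`, the itinerary being `r_j²` (`IsMaximalTrajectory.exists_followsBumps`). Conversely such a
sequence is a maximal trajectory, since its passages through the origin cannot accumulate inside a
trajectory: along a single arc the abscissa is strictly monotone (`exists_le_of_mem`). The bump of
amplitude `r` takes a time between `2r` and `6r`, which gives the criterion for global
trajectories.

There is no uniform comparison of metrics for the bean field, but it suffices that the `i`-th loop
depends continuously on the amplitudes `r_i`, `r_{i+1}` (`exists_hausdorffDist_bumpLoop_lt`) and
that `r_i` can be recovered continuously from it: near the point of the descent with abscissa `r_i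
/ 2`, the integral `y + x²` equals `r_i²` (`abs_sq_sub_sq_le`). The weighted series of bounded
terms then inherit the continuity (`exists_tsum_lt`). -/

noncomputable section

/-! ### Metrics given by weighted series, and conjugacies with a shift -/

lemma isMetricFn_tsum {α : Type*} (f : α → α → ℤ → ℝ) (h0 : ∀ x y i, 0 ≤ f x y i)
    (hself : ∀ x i, f x x i = 0) (hsep : ∀ x y, (∀ i, f x y i = 0) → x = y)
    (hsymm : ∀ x y i, f x y i = f y x i) (htri : ∀ x y z i, f x z i ≤ f x y i + f y z i)
    (hs : ∀ x y, Summable (f x y)) : IsMetricFn fun x y => ∑' i, f x y i := by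
  refine ⟨fun x y => tsum_nonneg (h0 x y), fun x y => ⟨fun h => hsep x y ?_, ?_⟩,
    fun x y => tsum_congr (hsymm x y), fun x y z => ?_⟩
  · have h' := (hs x y).hasSum
    rw [show ∑' i, f x y i = 0 from h] at h'
    have := (hasSum_zero_iff_of_nonneg (h0 x y)).1 h'
    exact fun i => congrFun this i
  · rintro rfl
    simp [hself]
  · rw [← (hs x y).tsum_add (hs y z)]
    exact (hs x z).tsum_le_tsum (htri x y z) ((hs x y).add (hs y z))

/-- A bijection that satisfies the `ε`-`δ` condition in both directions is a homeomorphism.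
Neither `d` nor `d'` need be a metric. -/
lemma isHomeoFn_of_bijective {α β : Type*} {d : α → α → ℝ} {d' : β → β → ℝ} {h : α → β}
    (hb : Function.Bijective h)
    (h1 : ∀ x, ∀ ε > 0, ∃ δ > 0, ∀ y, d x y < δ → d' (h x) (h y) < ε)
    (h2 : ∀ x, ∀ ε > 0, ∃ δ > 0, ∀ y, d' (h x) (h y) < δ → d x y < ε) : IsHomeoFn d d' h := by
  let _ := distTopology d
  let _ := distTopology d'
  refine ⟨⟨fun U hU x hx => ?_⟩, fun U hU y hy => ?_, hb⟩
  · obtain ⟨ε, hε, hU'⟩ := hU (h x) hx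
    obtain ⟨δ, hδ, H⟩ := h1 x ε hε
    exact ⟨δ, hδ, fun y hy => hU' _ (H y hy)⟩
  · obtain ⟨x, hx, rfl⟩ := hy
    obtain ⟨ε, hε, hU'⟩ := hU x hx
    obtain ⟨δ, hδ, H⟩ := h2 x ε hε
    refine ⟨δ, hδ, fun y hy => ?_⟩
    obtain ⟨z, rfl⟩ := hb.2 y
    exact ⟨z, hU' z (H z hy), rfl⟩

lemma summable_linear_div_two_pow (C : ℝ) :
    Summable fun j : ℤ => C * (1 + (j.natAbs : ℝ)) / 2 ^ j.natAbs := by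
  have h : Summable fun n : ℕ => C * (1 + (n : ℝ)) / 2 ^ n := by
    have h1 := summable_pow_mul_geometric_of_norm_lt_one 1 (r := (1 / 2 : ℝ)) (by norm_num)
    have h2 := summable_geometric_of_norm_lt_one (x := (1 / 2 : ℝ)) (by norm_num)
    refine ((h2.add h1).mul_left C).congr fun n => ?_
    simp only [one_div, inv_pow, pow_one]
    field_simp
  refine Summable.of_nat_of_neg ?_ ?_ <;> simpa using h

lemma summable_div_two_pow_of_le {f : ℤ → ℝ} (C : ℝ) (h0 : ∀ j, 0 ≤ f j)
    (h : ∀ j, f j ≤ C * (1 + (j.natAbs : ℝ))) : Summable fun j : ℤ => f j / 2 ^ j.natAbs :=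
  Summable.of_nonneg_of_le (fun j => div_nonneg (h0 j) (by positivity))
    (fun j => by gcongr; exact h j) (summable_linear_div_two_pow C)

section

variable {E : Type*}

@[simp] lemma shift_apply (a : ℤ → E) (j : ℤ) : shift a j = a (j + 1) := rfl

lemma shift_injective : Function.Injective (shift (E := E)) := fun a b h => funext fun j => by
  simpa using congrFun h (j - 1)

lemma shift_image_eq {S : Set (ℤ → E)} (h : ∀ a, shift a ∈ S ↔ a ∈ S) : shift '' S = S := by
  ext a
  constructor
  · rintro ⟨b, hb, rfl⟩
    exact (h b).2 hb
  · intro ha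
    have : shift (fun j => a (j - 1)) = a := by
      funext j
      simp
    exact ⟨fun j => a (j - 1), (h _).1 (by rwa [this]), this⟩

variable [MetricSpace E]

lemma seqTerm_nonneg (a b : ℤ → E) (j : ℤ) : 0 ≤ seqTerm a b j :=
  div_nonneg dist_nonneg (by positivity)

lemma isMetricFn_seqDistOn {S : Set (ℤ → E)}
    (hs : ∀ a ∈ S, ∀ b ∈ S, Summable (seqTerm a b)) : IsMetricFn (seqDistOn S) := by
  refine isMetricFn_tsum (fun a b : S => seqTerm (a : ℤ → E) b) (fun _ _ _ => seqTerm_nonneg _ _ _)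
    (fun _ _ => by simp [seqTerm]) (fun a b h => ?_) (fun _ _ _ => by simp [seqTerm, dist_comm])
    (fun a b c j => ?_) (fun a b => hs a a.2 b b.2)
  · refine Subtype.ext (funext fun j => dist_eq_zero.1 ?_)
    have := h j
    simp only [seqTerm, div_eq_zero_iff] at this
    exact this.resolve_right (by positivity)
  · simp only [seqTerm, ← add_div]
    gcongr
    exact dist_triangle _ _ _

lemma dist_le_seqDist {a b : ℤ → E} (hs : Summable (seqTerm a b)) (j : ℤ) :
    dist (a j) (b j) ≤ 2 ^ j.natAbs * seqDist a b := by
  have := hs.le_tsum j fun i _ => seqTerm_nonneg a b i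
  rw [seqTerm, div_le_iff₀ (by positivity)] at this
  rw [mul_comm]
  exact this

lemma seqTerm_shift_le (a b : ℤ → E) (j : ℤ) :
    seqTerm (shift a) (shift b) j ≤ 2 * seqTerm a b (j + 1) := by
  simp only [seqTerm, shift_apply]
  have h : (2 : ℝ) ^ (j + 1).natAbs ≤ 2 * 2 ^ j.natAbs := by
    rw [← pow_succ']
    exact pow_le_pow_right₀ (by norm_num) (by omega)
  rw [← mul_div_assoc, div_le_div_iff₀ (by positivity) (by positivity)]
  nlinarith [mul_le_mul_of_nonneg_left h (dist_nonneg (x := a (j + 1)) (y := b (j + 1)))]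

lemma le_seqTerm_shift (a b : ℤ → E) (j : ℤ) :
    seqTerm a b (j + 1) ≤ 2 * seqTerm (shift a) (shift b) j := by
  simp only [seqTerm, shift_apply]
  have h : (2 : ℝ) ^ j.natAbs ≤ 2 * 2 ^ (j + 1).natAbs := by
    rw [← pow_succ']
    exact pow_le_pow_right₀ (by norm_num) (by omega)
  rw [← mul_div_assoc, div_le_div_iff₀ (by positivity) (by positivity)]
  nlinarith [mul_le_mul_of_nonneg_left h (dist_nonneg (x := a (j + 1)) (y := b (j + 1)))]

lemma summable_succ {f : ℤ → ℝ} (h : Summable f) : Summable fun j => f (j + 1) :=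
  h.comp_injective (add_left_injective 1)

lemma tsum_succ (f : ℤ → ℝ) : ∑' j, f (j + 1) = ∑' j, f j :=
  (Equiv.addRight (1 : ℤ)).tsum_eq f

lemma seqDist_shift_le {a b : ℤ → E} (h : Summable (seqTerm a b))
    (h' : Summable (seqTerm (shift a) (shift b))) :
    seqDist (shift a) (shift b) ≤ 2 * seqDist a b := by
  rw [seqDist, seqDist, ← tsum_succ (seqTerm a b), ← tsum_mul_left]
  exact h'.tsum_le_tsum (seqTerm_shift_le a b) ((summable_succ h).mul_left 2)

lemma le_seqDist_shift {a b : ℤ → E} (h : Summable (seqTerm a b))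
    (h' : Summable (seqTerm (shift a) (shift b))) :
    seqDist a b ≤ 2 * seqDist (shift a) (shift b) := by
  rw [seqDist, seqDist, ← tsum_succ (seqTerm a b), ← tsum_mul_left]
  exact (summable_succ h).tsum_le_tsum (le_seqTerm_shift a b) (h'.mul_left 2)

/-- A set of sequences is closed if every sequence outside it violates the condition in finitely
many entries that cannot be corrected by a small change. -/
lemma isClosed_of_coordinates {B S : Set (ℤ → E)}
    (hs : ∀ a ∈ B, ∀ b ∈ B, Summable (seqTerm a b))
    (h : ∀ a ∈ B, a ∉ S → ∃ j : ℤ, ∃ ε > 0, ∀ b ∈ B,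
      dist (a j) (b j) < ε → dist (a (j + 1)) (b (j + 1)) < ε → b ∉ S) :
    @IsClosed B (distTopology (seqDistOn B)) (Subtype.val ⁻¹' S) := by
  let _ := distTopology (seqDistOn B)
  refine ⟨fun a ha => ?_⟩
  obtain ⟨j, ε, hε, H⟩ := h a a.2 ha
  have hle : ∀ (b : B) (i : ℤ) (N : ℕ), i.natAbs ≤ N → seqDistOn B a b < ε / 2 ^ N →
      dist (a.1 i) (b.1 i) < ε := fun b i N hi hb => by
    refine (dist_le_seqDist (hs a a.2 b b.2) i).trans_lt ?_
    rw [lt_div_iff₀ (by positivity), mul_comm] at hb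
    refine lt_of_le_of_lt ?_ hb
    have h0 : 0 ≤ seqDistOn B a b := (isMetricFn_seqDistOn hs).1 a b
    exact mul_le_mul_of_nonneg_right (pow_le_pow_right₀ (by norm_num) hi) h0
  refine ⟨ε / 2 ^ (j.natAbs + 1), by positivity, fun b hb => H b b.2 (hle b j _ (by omega) hb)
    (hle b (j + 1) _ (by omega) hb)⟩

/-- An itinerary map onto `S` that intertwines `T` with the shift, and for which `ρ` and the distance
of sequences are small together, is a conjugacy of the induced maps. -/
lemma itineraryConjugacy_of {Ω : Type*} {s : Ω → ℤ → E} {T : Ω → Ω}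
    {ρ : Quotient (Setoid.ker s) → Quotient (Setoid.ker s) → ℝ} {S : Set (ℤ → E)}
    (hρ : IsMetricFn ρ) (hs : ∀ a ∈ S, ∀ b ∈ S, Summable (seqTerm a b))
    (hS : shift '' S = S) (hr : range s = S) (hT : ∀ γ, s (T γ) = shift (s γ))
    (h1 : ∀ γ, ∀ ε > 0, ∃ δ > 0, ∀ γ', ρ (Quotient.mk _ γ) (Quotient.mk _ γ') < δ →
      seqDist (s γ) (s γ') < ε)
    (h2 : ∀ γ, ∀ ε > 0, ∃ δ > 0, ∀ γ', seqDist (s γ) (s γ') < δ →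
      ρ (Quotient.mk _ γ) (Quotient.mk _ γ') < ε) : ItineraryConjugacy s T ρ S := by
  have hmem : ∀ γ, s γ ∈ S := fun γ => hr ▸ mem_range_self γ
  let sbar : Quotient (Setoid.ker s) → S :=
    Quotient.lift (fun γ => (⟨s γ, hmem γ⟩ : S)) fun γ γ' h => Subtype.ext h
  let Tbar : Quotient (Setoid.ker s) → Quotient (Setoid.ker s) :=
    Quotient.map T fun γ γ' h => by
      change s (T γ) = s (T γ')
      rw [hT, hT, show s γ = s γ' from h]
  have hsbar : ∀ γ, (sbar (Quotient.mk _ γ) : ℤ → E) = s γ := fun γ => rfl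
  have hTbar : ∀ γ, Tbar (Quotient.mk _ γ) = Quotient.mk _ (T γ) := fun γ => rfl
  have hconj : ∀ q, (sbar (Tbar q) : ℤ → E) = shift (sbar q : ℤ → E) := fun q => by
    induction q using Quotient.inductionOn with
    | h γ => rw [hTbar, hsbar, hsbar, hT]
  have hsinj : Function.Injective sbar := fun q q' h => by
    induction q using Quotient.inductionOn with
    | h γ => induction q' using Quotient.inductionOn with
      | h γ' => exact Quotient.sound (congrArg Subtype.val h)
  have hssurj : Function.Surjective sbar := fun a => by
    obtain ⟨γ, hγ⟩ : (a : ℤ → E) ∈ range s := hr ▸ a.2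
    exact ⟨Quotient.mk _ γ, Subtype.ext hγ⟩
  have hTb : Function.Bijective Tbar := by
    refine ⟨fun q q' h => hsinj (Subtype.ext (shift_injective ?_)), fun q => ?_⟩
    · rw [← hconj, ← hconj, h]
    · obtain ⟨a, ha, haq⟩ : (sbar q : ℤ → E) ∈ shift '' S := by
        rw [hS]
        exact (sbar q).2
      obtain ⟨q', hq'⟩ := hssurj ⟨a, ha⟩
      refine ⟨q', hsinj (Subtype.ext ?_)⟩
      rw [hconj, hq', haq]
  have hsum : ∀ γ γ', Summable (seqTerm (s γ) (s γ')) := fun γ γ' => hs _ (hmem γ) _ (hmem γ')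
  refine ⟨hρ, hs, isMetricFn_seqDistOn hs, hS, Tbar, sbar, hTbar, hsbar, ?_, ?_, hconj⟩
  · refine isHomeoFn_of_bijective hTb (fun q ε hε => ?_) fun q ε hε => ?_
    · induction q using Quotient.inductionOn with
      | h γ =>
        obtain ⟨δ, hδ, H⟩ := h2 (T γ) ε hε
        obtain ⟨δ', hδ', H'⟩ := h1 γ (δ / 2) (half_pos hδ)
        refine ⟨δ', hδ', fun q' hq' => ?_⟩
        induction q' using Quotient.inductionOn with
        | h γ' =>
          refine H (T γ') ?_
          have := seqDist_shift_le (hsum γ γ') (by rw [← hT, ← hT]; exact hsum _ _)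
          rw [hT, hT]
          linarith [H' γ' hq']
    · induction q using Quotient.inductionOn with
      | h γ =>
        obtain ⟨δ, hδ, H⟩ := h2 γ ε hε
        obtain ⟨δ', hδ', H'⟩ := h1 (T γ) (δ / 2) (half_pos hδ)
        refine ⟨δ', hδ', fun q' hq' => ?_⟩
        induction q' using Quotient.inductionOn with
        | h γ' =>
          refine H γ' ?_
          have := le_seqDist_shift (hsum γ γ') (by rw [← hT, ← hT]; exact hsum _ _)
          have h3 := H' (T γ') hq'
          rw [hT, hT] at h3
          linarith
  · refine isHomeoFn_of_bijective ⟨hsinj, hssurj⟩ (fun q ε hε => ?_) fun q ε hε => ?_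
    · induction q using Quotient.inductionOn with
      | h γ =>
        obtain ⟨δ, hδ, H⟩ := h1 γ ε hε
        refine ⟨δ, hδ, fun q' => ?_⟩
        induction q' using Quotient.inductionOn with
        | h γ' => exact H γ'
    · induction q using Quotient.inductionOn with
      | h γ =>
        obtain ⟨δ, hδ, H⟩ := h2 γ ε hε
        refine ⟨δ, hδ, fun q' => ?_⟩
        induction q' using Quotient.inductionOn with
        | h γ' => exact H γ'

end

/-! ### Chains of intervals -/

/-- `[a, b]` can be cut at finitely many points into intervals whose pairs of end points satisfy `R`.
The set `F` is the set of cut points. -/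
def HasChain (R : ℝ → ℝ → Prop) (a b : ℝ) (F : Finset ℝ) : Prop :=
  a ∈ F ∧ b ∈ F ∧ (∀ x ∈ F, x ∈ Icc a b) ∧
    ∀ x ∈ F, ∀ y ∈ F, x < y → (∀ z ∈ F, z ≤ x ∨ y ≤ z) → R x y

lemma HasChain.refl (R : ℝ → ℝ → Prop) (a : ℝ) : HasChain R a a {a} := by
  refine ⟨by simp, by simp, by simp, fun x hx y hy hxy => ?_⟩
  simp only [Finset.mem_singleton] at hx hy
  exact absurd hxy (by simp [hx, hy])

lemma HasChain.append {R : ℝ → ℝ → Prop} {a b c : ℝ} {F : Finset ℝ} (h : HasChain R a b F)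
    (hR : R b c) (hbc : b < c) : ∃ G, HasChain R a c G := by
  classical
  obtain ⟨ha, hb, hF, hch⟩ := h
  have hab := (hF b hb).1
  refine ⟨insert c F, by simp [ha], by simp, fun x hx => ?_, fun x hx y hy hxy hz => ?_⟩
  · rcases Finset.mem_insert.1 hx with rfl | hx
    · exact ⟨hab.trans hbc.le, le_rfl⟩
    · exact ⟨(hF x hx).1, (hF x hx).2.trans hbc.le⟩
  · rcases Finset.mem_insert.1 hx with hx' | hx'
    · rcases Finset.mem_insert.1 hy with hy' | hy'
      · exact absurd hxy (by simp [hx', hy'])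
      · exact absurd hxy (not_lt.2 (hx' ▸ (hF y hy').2.trans hbc.le))
    · rcases Finset.mem_insert.1 hy with hy' | hy'
      · subst hy'
        rcases hz b (by simp [hb]) with h | h
        · rwa [le_antisymm (hF x hx').2 h]
        · exact absurd h (not_le.2 hbc)
      · exact hch x hx' y hy' hxy fun z hz' => hz z (by simp [hz'])

lemma exists_hasChain {R : ℝ → ℝ → Prop} {J : Set ℝ} (hJ : J.OrdConnected)
    (hR : ∀ t ∈ J, ∃ ε > 0, (∀ s ∈ Ico (t - ε) t, R s t) ∧ ∀ s ∈ Ioc t (t + ε), R t s)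
    {a b : ℝ} (ha : a ∈ J) (hb : b ∈ J) (hab : a ≤ b) : ∃ F, HasChain R a b F := by
  let S : Set ℝ := {x | x ∈ Icc a b ∧ ∃ F, HasChain R a x F}
  have haS : a ∈ S := ⟨⟨le_rfl, hab⟩, _, HasChain.refl R a⟩
  have hbdd : BddAbove S := ⟨b, fun x hx => hx.1.2⟩
  have hac : a ≤ sSup S := le_csSup hbdd haS
  have hcb : sSup S ≤ b := csSup_le ⟨a, haS⟩ fun x hx => hx.1.2
  obtain ⟨ε, hε, hl, hr⟩ := hR (sSup S) (hJ.out ha hb ⟨hac, hcb⟩)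
  obtain ⟨x, hxS, hx⟩ := exists_lt_of_lt_csSup ⟨a, haS⟩ (sub_lt_self (sSup S) hε)
  have hc : sSup S ∈ S := by
    rcases (le_csSup hbdd hxS).eq_or_lt with h | h
    · rwa [← h]
    · obtain ⟨F, hF⟩ := hxS.2
      exact ⟨⟨hac, hcb⟩, hF.append (hl x ⟨hx.le, h⟩) h⟩
  rcases hcb.eq_or_lt with h | h
  · exact h ▸ hc.2
  · obtain ⟨F, hF⟩ := hc.2
    have hlt : sSup S < min b (sSup S + ε) := lt_min h (by linarith)
    have : min b (sSup S + ε) ∈ S :=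
      ⟨⟨hac.trans hlt.le, min_le_left _ _⟩, hF.append (hr _ ⟨hlt, min_le_right _ _⟩) hlt⟩
    exact absurd (le_csSup hbdd this) (not_le.2 hlt)

/-- An open interval is exhausted by a monotone bi-infinite sequence. -/
lemma exists_int_exhaustion {J : Set ℝ} (hJ : J.OrdConnected) (hne : J.Nonempty) :
    ∃ c : ℤ → ℝ, Monotone c ∧ (∀ i, c i ∈ J) ∧ (∀ t ∈ J, ∃ i, t ≤ c i) ∧ ∀ t ∈ J, ∃ i, c i ≤ t := by
  have : Nonempty J := hne.to_subtype
  have := orderTopology_of_ordConnected (t := J)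
  obtain ⟨u, hu, hu'⟩ := exists_seq_monotone_tendsto_atTop_atTop J
  obtain ⟨v, hv, hv'⟩ := exists_seq_antitone_tendsto_atTop_atBot J
  obtain ⟨z, hz⟩ := hne
  refine ⟨fun i => if 0 ≤ i then max z (u i.toNat) else min z (v (-i).toNat), ?_, ?_, ?_, ?_⟩
  · intro i j hij
    by_cases hi : 0 ≤ i
    · simp only [hi, hi.trans hij, if_true]
      exact max_le_max le_rfl (hu (Int.toNat_le_toNat hij))
    · by_cases hj : 0 ≤ j
      · simp only [hi, hj, if_true, if_false]
        exact (min_le_left _ _).trans (le_max_left _ _)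
      · simp only [hi, hj, if_false]
        exact min_le_min le_rfl (hv (Int.toNat_le_toNat (by omega)))
  · intro i
    by_cases hi : 0 ≤ i
    · simp only [hi, if_true]
      rcases max_choice z (u i.toNat).1 with h | h <;> rw [h] <;> first | exact hz | exact Subtype.coe_prop _
    · simp only [hi, if_false]
      rcases min_choice z (v (-i).toNat).1 with h | h <;> rw [h] <;> first | exact hz | exact Subtype.coe_prop _
  · intro t ht
    obtain ⟨n, hn⟩ := (hu'.eventually (eventually_ge_atTop (⟨t, ht⟩ : J))).exists
    refine ⟨n, ?_⟩
    simp only [Int.natCast_nonneg, if_true, Int.toNat_natCast]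
    exact le_trans hn (le_max_right _ _)
  · intro t ht
    obtain ⟨n, hn, hn0⟩ := ((hv'.eventually (eventually_le_atBot (⟨t, ht⟩ : J))).and
      (eventually_gt_atTop 0)).exists
    refine ⟨-(n : ℤ), ?_⟩
    have : ¬ (0 : ℤ) ≤ -(n : ℤ) := by omega
    simp only [this, if_false, neg_neg, Int.toNat_natCast]
    exact (min_le_right _ _).trans hn

/-- If every point of an open interval `J` is the end point of short intervals in relation `R`, then
`J` is the union of a bi-infinite sequence of consecutive intervals in relation `R`. -/
lemma exists_int_chain {R : ℝ → ℝ → Prop} {J : Set ℝ} (hJ : J.OrdConnected) (hne : J.Nonempty)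
    (hop : ∀ t ∈ J, (∃ s ∈ J, s < t) ∧ ∃ s ∈ J, t < s)
    (hR : ∀ t ∈ J, ∃ ε > 0, (∀ s ∈ Ico (t - ε) t, R s t) ∧ ∀ s ∈ Ioc t (t + ε), R t s) :
    ∃ t : ℤ → ℝ, StrictMono t ∧ (⋃ i, Icc (t i) (t (i + 1))) = J ∧ ∀ i, R (t i) (t (i + 1)) := by
  classical
  obtain ⟨c, hc, hcJ, hctop, hcbot⟩ := exists_int_exhaustion hJ hne
  have htop : ∀ t ∈ J, ∃ i, t < c i := fun t ht => by
    obtain ⟨s, hs, hts⟩ := (hop t ht).2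
    obtain ⟨i, hi⟩ := hctop s hs
    exact ⟨i, hts.trans_le hi⟩
  have hbot : ∀ t ∈ J, ∃ i, c i < t := fun t ht => by
    obtain ⟨s, hs, hts⟩ := (hop t ht).1
    obtain ⟨i, hi⟩ := hcbot s hs
    exact ⟨i, hi.trans_lt hts⟩
  choose F hF using fun i => exists_hasChain hJ hR (hcJ i) (hcJ (i + 1)) (hc (by omega))
  have hidx : ∀ t ∈ J, ∃ m, c m ≤ t ∧ t < c (m + 1) := fun t ht => by
    obtain ⟨i, hi⟩ := htop t ht
    obtain ⟨j, hj⟩ := hbot t ht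
    obtain ⟨m, hm, hm'⟩ := Int.exists_greatest_of_bdd (P := fun m => c m ≤ t)
      ⟨i, fun z hz => by
        by_contra h
        exact absurd (hi.trans_le (hc (not_le.1 h).le)) (not_lt.2 hz)⟩ ⟨j, hj.le⟩
    refine ⟨m, hm, ?_⟩
    by_contra h
    have := hm' (m + 1) (not_lt.1 h)
    omega
  let B : Set ℝ := ⋃ i, (F i : Set ℝ)
  have hFB : ∀ {i x}, x ∈ F i → x ∈ B := fun {i x} hx => mem_iUnion.2 ⟨i, hx⟩
  have hcB : ∀ i, c i ∈ B := fun i => hFB (hF i).1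
  have hBJ : B ⊆ J := by
    rintro x hx
    obtain ⟨i, hi⟩ := mem_iUnion.1 hx
    exact hJ.out (hcJ i) (hcJ (i + 1)) ((hF i).2.2.1 x hi)
  have hfin : ∀ x ∈ J, ∀ y ∈ J, (B ∩ Icc x y).Finite := fun x hx y hy => by
    obtain ⟨i, hi⟩ := hbot x hx
    obtain ⟨j, hj⟩ := htop y hy
    refine Set.Finite.subset ((Set.finite_Icc i j).biUnion fun k _ => (F k).finite_toSet) ?_
    rintro z ⟨hz, hzx, hzy⟩
    obtain ⟨k, hk⟩ := mem_iUnion.1 hz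
    have hk' := (hF k).2.2.1 z hk
    refine mem_biUnion (x := k) ⟨?_, ?_⟩ hk
    · by_contra h
      exact absurd (hk'.2.trans (hc (show k + 1 ≤ i by omega))) (not_le.2 (hi.trans_le hzx))
    · by_contra h
      exact absurd ((hc (show j ≤ k by omega)).trans hk'.1) (not_le.2 (hzy.trans_lt hj))
  have hcons : ∀ x ∈ B, ∀ y ∈ B, x < y → (∀ z ∈ B, z ≤ x ∨ y ≤ z) → R x y := by
    intro x hx y hy hxy hz
    obtain ⟨m, hm, hm'⟩ := hidx x (hBJ hx)
    have hym : y ≤ c (m + 1) := (hz _ (hcB (m + 1))).resolve_left (not_le.2 hm')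
    refine (hF m).2.2.2 x ?_ y ?_ hxy fun z hz' => hz z (hFB hz')
    · obtain ⟨i, hi⟩ := mem_iUnion.1 hx
      have hi' := (hF i).2.2.1 x hi
      rcases lt_trichotomy i m with h | rfl | h
      · have := hi'.2.trans (hc (show i + 1 ≤ m by omega))
        rw [le_antisymm this hm]
        exact (hF m).1
      · exact hi
      · exact absurd ((hc (show m + 1 ≤ i by omega)).trans hi'.1) (not_le.2 hm')
    · obtain ⟨i, hi⟩ := mem_iUnion.1 hy
      have hi' := (hF i).2.2.1 y hi
      rcases lt_trichotomy i m with h | rfl | h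
      · exact absurd ((hi'.2.trans (hc (show i + 1 ≤ m by omega))).trans hm) (not_le.2 hxy)
      · exact hi
      · rw [le_antisymm hym ((hc (show m + 1 ≤ i by omega)).trans hi'.1)]
        exact (hF m).2.1
  have : Nonempty B := ⟨⟨c 0, hcB 0⟩⟩
  have : NoMaxOrder B := ⟨fun x => by
    obtain ⟨i, hi⟩ := htop x (hBJ x.2)
    exact ⟨⟨c i, hcB i⟩, hi⟩⟩
  have : NoMinOrder B := ⟨fun x => by
    obtain ⟨i, hi⟩ := hbot x (hBJ x.2)
    exact ⟨⟨c i, hcB i⟩, hi⟩⟩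
  let _ : LocallyFiniteOrder B := LocallyFiniteOrder.ofFiniteIcc fun x y => by
    refine Set.Finite.of_finite_image ((hfin x (hBJ x.2) y (hBJ y.2)).subset ?_)
      Subtype.val_injective.injOn
    rintro _ ⟨z, hz, rfl⟩
    exact ⟨z.2, hz⟩
  let _ : SuccOrder B := LinearLocallyFiniteOrder.succOrder B
  let _ : PredOrder B := LinearLocallyFiniteOrder.predOrder B
  let e : B ≃o ℤ := orderIsoIntOfLinearSuccPredArch
  have hmono : StrictMono fun i => (e.symm i : ℝ) := fun i j hij => e.symm.strictMono hij
  refine ⟨fun i => e.symm i, hmono, ?_, fun i => ?_⟩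
  · ext t
    simp only [mem_iUnion]
    constructor
    · rintro ⟨i, hi⟩
      exact hJ.out (hBJ (e.symm i).2) (hBJ (e.symm (i + 1)).2) hi
    · intro ht
      obtain ⟨i, hi⟩ := htop t ht
      obtain ⟨j, hj⟩ := hbot t ht
      obtain ⟨m, hm, hm'⟩ := Int.exists_greatest_of_bdd (P := fun m => (e.symm m : ℝ) ≤ t)
        ⟨e ⟨c i, hcB i⟩, fun z hz => by
          rw [← e.symm_apply_le]
          exact (hz.trans hi.le)⟩ ⟨e ⟨c j, hcB j⟩, by simpa using hj.le⟩
      refine ⟨m, hm, ?_⟩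
      by_contra h
      have := hm' (m + 1) (not_le.1 h).le
      omega
  · refine hcons _ (e.symm i).2 _ (e.symm (i + 1)).2 (hmono (by simp)) fun z hz => ?_
    rcases le_or_gt (e ⟨z, hz⟩) i with h | h
    · left
      have := e.symm.monotone h
      rwa [e.symm_apply_apply] at this
    · right
      have := e.symm.monotone (show i + 1 ≤ e ⟨z, hz⟩ by omega)
      rwa [e.symm_apply_apply] at this

/-! ### Local trajectories -/

lemma plane_ext {p q : Plane} (h0 : p 0 = q 0) (h1 : p 1 = q 1) : p = q := by
  ext i
  fin_cases i
  · exact h0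
  · exact h1

lemma hasDerivWithinAt_plane {γ : ℝ → Plane} {v : Plane} {s : Set ℝ} {t : ℝ} :
    HasDerivWithinAt γ v s t ↔
      HasDerivWithinAt (fun t => γ t 0) (v 0) s t ∧ HasDerivWithinAt (fun t => γ t 1) (v 1) s t := by
  constructor
  · intro h
    exact ⟨(EuclideanSpace.proj (𝕜 := ℝ) (0 : Fin 2)).hasFDerivAt.comp_hasDerivWithinAt t h,
      (EuclideanSpace.proj (𝕜 := ℝ) (1 : Fin 2)).hasFDerivAt.comp_hasDerivWithinAt t h⟩
  · rintro ⟨h0, h1⟩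
    rw [hasDerivWithinAt_iff_hasFDerivWithinAt, hasFDerivWithinAt_euclidean, Fin.forall_fin_two]
    exact ⟨h0.hasFDerivWithinAt.congr_fderiv (by ext; simp),
      h1.hasFDerivWithinAt.congr_fderiv (by ext; simp)⟩

lemma eq_of_hasDerivWithinAt_zero {f : ℝ → ℝ} {a b : ℝ}
    (h : ∀ t ∈ Icc a b, HasDerivWithinAt f 0 (Icc a b) t) : ∀ t ∈ Icc a b, f t = f a := by
  refine constant_of_derivWithin_zero (fun t ht => (h t ht).differentiableWithinAt) fun t ht => ?_
  exact (h t ⟨ht.1, ht.2.le⟩).derivWithin (uniqueDiffOn_Icc (ht.1.trans_lt ht.2) t ⟨ht.1, ht.2.le⟩)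

/-- The orbits of `(c, c · q(x))` are the parametrized graphs of the primitives of `q`. -/
lemma hasDerivWithinAt_planeField_iff {c : ℝ} {g q Q : ℝ → ℝ} (hQ : ∀ x, HasDerivAt Q (q x) x)
    (hg : ∀ x, g x = c * q x) {γ : ℝ → Plane} {a b : ℝ} :
    (∀ t ∈ Icc a b, HasDerivWithinAt γ (planeField c g (γ t)) (Icc a b) t) ↔
      ∃ x₀ e, ∀ t ∈ Icc a b, γ t = !₂[x₀ + c * t, Q (x₀ + c * t) + e] := by
  constructor
  · intro h
    have h' := fun t ht => hasDerivWithinAt_plane.1 (h t ht)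
    simp only [planeField] at h'
    have h0 : ∀ t ∈ Icc a b, γ t 0 - c * t = γ a 0 - c * a :=
      eq_of_hasDerivWithinAt_zero (f := fun t => γ t 0 - c * t) fun t ht => by
        exact ((h' t ht).1.sub ((hasDerivWithinAt_id t (Icc a b)).const_mul c)).congr_deriv
          (by simp)
    have h1 : ∀ t ∈ Icc a b, γ t 1 - Q (γ t 0) = γ a 1 - Q (γ a 0) :=
      eq_of_hasDerivWithinAt_zero (f := fun t => γ t 1 - Q (γ t 0)) fun t ht => by
        exact ((h' t ht).2.sub ((hQ (γ t 0)).comp_hasDerivWithinAt t (h' t ht).1)).congr_deriv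
          (by simp [hg, mul_comm])
    refine ⟨γ a 0 - c * a, γ a 1 - Q (γ a 0), fun t ht => ?_⟩
    have hx : γ a 0 - c * a + c * t = γ t 0 := by linarith [h0 t ht]
    refine plane_ext (by simp [hx]) ?_
    simp only [hx]
    simp
    linarith [h1 t ht]
  · rintro ⟨x₀, e, h⟩ t ht
    have hx : HasDerivAt (fun t => x₀ + c * t) c t := by
      simpa using ((hasDerivAt_id t).const_mul c).const_add x₀
    refine HasDerivWithinAt.congr ?_ h (h t ht)
    rw [h t ht]
    refine hasDerivWithinAt_plane.2 ⟨?_, ?_⟩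
    · simpa [planeField] using hx.hasDerivWithinAt
    · have := ((hQ (x₀ + c * t)).comp t hx).add_const e
      simpa [planeField, hg, mul_comm, Function.comp_def] using this.hasDerivWithinAt

section

variable {X Y : Plane → Plane} {γ δ : ℝ → Plane} {a b : ℝ}

lemma IsArc.mono (h : IsArc X Y γ a b) {a' b' : ℝ} (ha : a ≤ a') (hb : b' ≤ b) :
    IsArc X Y γ a' b' := by
  have hsub : Icc a' b' ⊆ Icc a b := Icc_subset_Icc ha hb
  rcases h with h | h | h | ⟨p, hp, h⟩
  · exact Or.inl fun t ht => ⟨(h t (hsub ht)).1, (h t (hsub ht)).2.mono hsub⟩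
  · exact Or.inr <| Or.inl fun t ht => ⟨(h t (hsub ht)).1, (h t (hsub ht)).2.mono hsub⟩
  · refine Or.inr <| Or.inr <| Or.inl fun t ht => ?_
    obtain ⟨h1, v, h2, h3⟩ := h t (hsub ht)
    exact ⟨h1, v, h2, h3.mono hsub⟩
  · exact Or.inr <| Or.inr <| Or.inr ⟨p, hp, fun t ht => h t (hsub ht)⟩

lemma IsArc.congr (h : IsArc X Y γ a b) (he : ∀ t ∈ Icc a b, δ t = γ t) : IsArc X Y δ a b := by
  rcases h with h | h | h | ⟨p, hp, h⟩
  · exact Or.inl fun t ht => by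
      rw [he t ht]
      exact ⟨(h t ht).1, (h t ht).2.congr he (he t ht)⟩
  · exact Or.inr <| Or.inl fun t ht => by
      rw [he t ht]
      exact ⟨(h t ht).1, (h t ht).2.congr he (he t ht)⟩
  · refine Or.inr <| Or.inr <| Or.inl fun t ht => ?_
    obtain ⟨h1, v, h2, h3⟩ := h t ht
    rw [he t ht]
    exact ⟨h1, v, h2, h3.congr he (he t ht)⟩
  · exact Or.inr <| Or.inr <| Or.inr ⟨p, hp, fun t ht => (he t ht).trans (h t ht)⟩

lemma hasDerivWithinAt_comp_add {γ : ℝ → Plane} {v : Plane} {a b t : ℝ} (c : ℝ)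
    (h : HasDerivWithinAt γ v (Icc (a + c) (b + c)) (t + c)) :
    HasDerivWithinAt (fun t => γ (t + c)) v (Icc a b) t := by
  have hm : MapsTo (fun t => t + c) (Icc a b) (Icc (a + c) (b + c)) :=
    fun s hs => ⟨by linarith [hs.1], by linarith [hs.2]⟩
  exact (h.scomp t ((hasDerivWithinAt_id t (Icc a b)).add_const c) hm).congr_deriv (by simp)

lemma IsArc.comp_add (c : ℝ) (h : IsArc X Y γ (a + c) (b + c)) :
    IsArc X Y (fun t => γ (t + c)) a b := by
  have hm : ∀ {t}, t ∈ Icc a b → t + c ∈ Icc (a + c) (b + c) :=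
    fun ht => ⟨by linarith [ht.1], by linarith [ht.2]⟩
  rcases h with h | h | h | ⟨p, hp, h⟩
  · exact Or.inl fun t ht => ⟨(h _ (hm ht)).1, hasDerivWithinAt_comp_add c (h _ (hm ht)).2⟩
  · exact Or.inr <| Or.inl fun t ht =>
      ⟨(h _ (hm ht)).1, hasDerivWithinAt_comp_add c (h _ (hm ht)).2⟩
  · refine Or.inr <| Or.inr <| Or.inl fun t ht => ?_
    obtain ⟨h1, v, h2, h3⟩ := h _ (hm ht)
    exact ⟨h1, v, h2, hasDerivWithinAt_comp_add c h3⟩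
  · exact Or.inr <| Or.inr <| Or.inr ⟨p, hp, fun t ht => h _ (hm ht)⟩

lemma IsArc.continuousOn (h : IsArc X Y γ a b) : ContinuousOn γ (Icc a b) := by
  intro t ht
  rcases h with h | h | h | ⟨p, hp, h⟩
  · exact (h t ht).2.continuousWithinAt
  · exact (h t ht).2.continuousWithinAt
  · obtain ⟨_, v, _, h3⟩ := h t ht
    exact h3.continuousWithinAt
  · exact continuousWithinAt_const.congr h (h t ht)

/-- Near each point of `J`, the curve `γ` is a piece of local trajectory on the left and on the
right. On an open interval, this is equivalent to `γ` being a trajectory. -/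
def IsLocalTrajectoryOn (X Y : Plane → Plane) (J : Set ℝ) (γ : ℝ → Plane) : Prop :=
  ∀ t ∈ J, ∃ ε > 0, Icc (t - ε) (t + ε) ⊆ J ∧ IsArc X Y γ (t - ε) t ∧ IsArc X Y γ t (t + ε)

lemma StrictMono.exists_mem_Ico_of_mem {t : ℤ → ℝ} (ht : StrictMono t) {i j : ℤ} {s : ℝ}
    (hi : t i ≤ s) (hj : s ≤ t j) : ∃ m, i ≤ m ∧ t m ≤ s ∧ s < t (m + 1) := by
  obtain ⟨m, hm, hm'⟩ := Int.exists_greatest_of_bdd (P := fun m => t m ≤ s)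
    ⟨j, fun z hz => ht.le_iff_le.1 (hz.trans hj)⟩ ⟨i, hi⟩
  refine ⟨m, hm' i hi, hm, ?_⟩
  by_contra h
  have := hm' (m + 1) (not_lt.1 h)
  omega

lemma StrictMono.iUnion_Icc_ordConnected {t : ℤ → ℝ} (ht : StrictMono t) :
    (⋃ i, Icc (t i) (t (i + 1))).OrdConnected := by
  refine ⟨fun x hx y hy z hz => ?_⟩
  obtain ⟨i, hi⟩ := mem_iUnion.1 hx
  obtain ⟨j, hj⟩ := mem_iUnion.1 hy
  obtain ⟨m, -, hm, hm'⟩ := ht.exists_mem_Ico_of_mem (hi.1.trans hz.1) (hz.2.trans hj.2)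
  exact mem_iUnion.2 ⟨m, hm, hm'.le⟩

lemma StrictMono.mem_iUnion_Icc {t : ℤ → ℝ} (ht : StrictMono t) {i j : ℤ} {s : ℝ}
    (hi : t i ≤ s) (hj : s ≤ t j) : s ∈ ⋃ i, Icc (t i) (t (i + 1)) := by
  obtain ⟨m, -, hm, hm'⟩ := ht.exists_mem_Ico_of_mem hi hj
  exact mem_iUnion.2 ⟨m, hm, hm'.le⟩

lemma StrictMono.iUnion_Icc_nhds {t : ℤ → ℝ} (ht : StrictMono t) {s : ℝ}
    (hs : s ∈ ⋃ i, Icc (t i) (t (i + 1))) :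
    ∃ i j, t i < s ∧ s ≤ t (i + 1) ∧ t j ≤ s ∧ s < t (j + 1) := by
  obtain ⟨i, hi⟩ := mem_iUnion.1 hs
  obtain ⟨i', hi'⟩ : ∃ i', t i' < s ∧ s ≤ t (i' + 1) := by
    rcases hi.1.eq_or_lt with h | h
    · exact ⟨i - 1, h ▸ ht (by omega), by simp [h]⟩
    · exact ⟨i, h, hi.2⟩
  obtain ⟨j, -, hj⟩ := ht.exists_mem_Ico_of_mem hi.1 hi.2
  exact ⟨i', j, hi'.1, hi'.2, hj.1, hj.2⟩

lemma isTrajectoryOn_iff {J : Set ℝ} :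
    IsTrajectoryOn X Y J γ ↔ J.Nonempty ∧ J.OrdConnected ∧ IsLocalTrajectoryOn X Y J γ := by
  constructor
  · rintro ⟨t, ht, rfl, h⟩
    refine ⟨⟨t 0, mem_iUnion.2 ⟨0, le_rfl, (ht (by omega)).le⟩⟩, ht.iUnion_Icc_ordConnected, ?_⟩
    intro s hs
    obtain ⟨i, j, hi, hi', hj, hj'⟩ := ht.iUnion_Icc_nhds hs
    refine ⟨min (s - t i) (t (j + 1) - s), lt_min (by linarith) (by linarith), ?_,
      (h i).mono (by linarith [min_le_left (s - t i) (t (j + 1) - s)]) hi',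
      (h j).mono hj (by linarith [min_le_right (s - t i) (t (j + 1) - s)])⟩
    intro u hu
    exact ht.mem_iUnion_Icc (i := i) (j := j + 1)
      (by linarith [hu.1, min_le_left (s - t i) (t (j + 1) - s)])
      (by linarith [hu.2, min_le_right (s - t i) (t (j + 1) - s)])
  · rintro ⟨hne, hJ, h⟩
    refine exists_int_chain hJ hne (fun t ht => ?_) fun t ht => ?_
    · obtain ⟨ε, hε, hsub, -⟩ := h t ht
      exact ⟨⟨t - ε, hsub ⟨le_rfl, by linarith⟩, by linarith⟩,
        ⟨t + ε, hsub ⟨by linarith, le_rfl⟩, by linarith⟩⟩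
    · obtain ⟨ε, hε, -, hl, hr⟩ := h t ht
      exact ⟨ε, hε, fun s hs => hl.mono hs.1 le_rfl, fun s hs => hr.mono le_rfl hs.2⟩

lemma isGlobalTrajectory_iff : IsGlobalTrajectory X Y γ ↔ IsTrajectoryOn X Y univ γ := by
  constructor
  · rintro ⟨t, ht, htop, hbot, h⟩
    refine ⟨t, ht, eq_univ_of_forall fun s => ?_, h⟩
    obtain ⟨i, hi⟩ := (htop.eventually (eventually_ge_atTop s)).exists
    obtain ⟨j, hj⟩ := (hbot.eventually (eventually_le_atBot s)).exists
    exact ht.mem_iUnion_Icc hj hi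
  · rintro ⟨t, ht, hu, h⟩
    refine ⟨t, ht, tendsto_atTop_atTop.2 fun s => ?_, tendsto_atBot_atBot.2 fun s => ?_, h⟩
    · obtain ⟨i, hi⟩ := mem_iUnion.1 (hu ▸ mem_univ s)
      exact ⟨i + 1, fun j hj => hi.2.trans (ht.monotone hj)⟩
    · obtain ⟨i, hi⟩ := mem_iUnion.1 (hu ▸ mem_univ s)
      exact ⟨i, fun j hj => (ht.monotone hj).trans hi.1⟩

lemma IsLocalTrajectoryOn.continuousAt {J : Set ℝ} (h : IsLocalTrajectoryOn X Y J γ) {t : ℝ}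
    (ht : t ∈ J) : ContinuousAt γ t := by
  obtain ⟨ε, hε, -, hl, hr⟩ := h t ht
  rw [continuousAt_iff_continuous_left_right]
  constructor
  · exact (hl.continuousOn t ⟨by linarith, le_rfl⟩).mono_of_mem_nhdsWithin
      (Icc_mem_nhdsLE (by linarith))
  · exact (hr.continuousOn t ⟨le_rfl, by linarith⟩).mono_of_mem_nhdsWithin
      (Icc_mem_nhdsGE (by linarith))

lemma IsLocalTrajectoryOn.comp_add {J : Set ℝ} (h : IsLocalTrajectoryOn X Y J γ) (c : ℝ) :
    IsLocalTrajectoryOn X Y {t | t + c ∈ J} fun t => γ (t + c) := by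
  intro t ht
  obtain ⟨ε, hε, hsub, hl, hr⟩ := h (t + c) ht
  refine ⟨ε, hε, fun s hs => hsub ⟨by linarith [hs.1], by linarith [hs.2]⟩, ?_, ?_⟩
  · exact IsArc.comp_add c (hl.mono (by linarith) le_rfl)
  · exact IsArc.comp_add c (hr.mono le_rfl (by linarith))

lemma IsTrajectoryOn.comp_add {J : Set ℝ} (h : IsTrajectoryOn X Y J γ) (c : ℝ) :
    IsTrajectoryOn X Y {t | t + c ∈ J} fun t => γ (t + c) := by
  rw [isTrajectoryOn_iff] at h ⊢
  obtain ⟨⟨s, hs⟩, hJ, h⟩ := h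
  refine ⟨⟨s - c, by simpa using hs⟩, ⟨fun x hx y hy z hz => hJ.out hx hy ?_⟩, h.comp_add c⟩
  exact ⟨add_le_add_left hz.1 c, add_le_add_left hz.2 c⟩

lemma IsGlobalTrajectory.comp_add (h : IsGlobalTrajectory X Y γ) (c : ℝ) :
    IsGlobalTrajectory X Y fun t => γ (t + c) := by
  rw [isGlobalTrajectory_iff] at h ⊢
  simpa using h.comp_add c

/-- Two trajectories that agree at `c` can be glued there. -/
lemma IsLocalTrajectoryOn.glue {J K : Set ℝ} (hγ : IsLocalTrajectoryOn X Y J γ)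
    (hδ : IsLocalTrajectoryOn X Y K δ) {c : ℝ} (hcJ : c ∈ J) (hcK : c ∈ K) (hc : γ c = δ c) :
    IsLocalTrajectoryOn X Y ((J ∩ Iic c) ∪ (K ∩ Ici c)) fun t => if t ≤ c then γ t else δ t := by
  have hlarge : ∀ t, c ≤ t → (if t ≤ c then γ t else δ t) = δ t := fun t ht => by
    rcases ht.eq_or_lt with rfl | h
    · simp [hc]
    · simp [not_le.2 h]
  intro t ht
  rcases lt_trichotomy t c with h | rfl | h
  · have htJ : t ∈ J := by
      rcases ht with ht | ht
      · exact ht.1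
      · exact absurd ht.2 (not_le.2 h)
    obtain ⟨ε, hε, hsub, hl, hr⟩ := hγ t htJ
    have hm : min ε (c - t) ≤ ε := min_le_left _ _
    have hm' : min ε (c - t) ≤ c - t := min_le_right _ _
    refine ⟨min ε (c - t), lt_min hε (by linarith), fun s hs => Or.inl ⟨hsub ⟨?_, ?_⟩, ?_⟩, ?_, ?_⟩
    · linarith [hs.1]
    · linarith [hs.2]
    · exact show s ≤ c by linarith [hs.2]
    · exact (hl.mono (by linarith) le_rfl).congr fun s hs => if_pos (hs.2.trans h.le)
    · exact (hr.mono le_rfl (by linarith)).congr fun s hs => if_pos (by linarith [hs.2])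
  · obtain ⟨ε, hε, hsub, hl, hr⟩ := hγ t hcJ
    obtain ⟨ε', hε', hsub', hl', hr'⟩ := hδ t hcK
    have hm : min ε ε' ≤ ε := min_le_left _ _
    have hm' : min ε ε' ≤ ε' := min_le_right _ _
    refine ⟨min ε ε', lt_min hε hε', fun s hs => ?_, ?_, ?_⟩
    · rcases le_total s t with h | h
      · exact Or.inl ⟨hsub ⟨by linarith [hs.1], by linarith⟩, h⟩
      · exact Or.inr ⟨hsub' ⟨by linarith, by linarith [hs.2]⟩, h⟩
    · exact (hl.mono (by linarith) le_rfl).congr fun s hs => if_pos hs.2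
    · exact (hr'.mono le_rfl (by linarith)).congr fun s hs => hlarge s hs.1
  · have htK : t ∈ K := by
      rcases ht with ht | ht
      · exact absurd ht.2 (not_le.2 h)
      · exact ht.1
    obtain ⟨ε, hε, hsub, hl, hr⟩ := hδ t htK
    have hm : min ε (t - c) ≤ ε := min_le_left _ _
    have hm' : min ε (t - c) ≤ t - c := min_le_right _ _
    refine ⟨min ε (t - c), lt_min hε (by linarith), fun s hs => Or.inr ⟨hsub ⟨?_, ?_⟩, ?_⟩, ?_, ?_⟩
    · linarith [hs.1]
    · linarith [hs.2]
    · exact show c ≤ s by linarith [hs.1]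
    · exact (hl.mono (by linarith) le_rfl).congr fun s hs => hlarge s (by linarith [hs.1])
    · exact (hr.mono le_rfl (by linarith)).congr fun s hs => hlarge s (h.le.trans hs.1)

/-- Two continuous curves that agree at `a`, and that agree for a short time whenever they meet,
agree on `[a, b]`. -/
lemma eqOn_Icc_of_local (hγ : ContinuousOn γ (Icc a b)) (hδ : ContinuousOn δ (Icc a b))
    (ha : γ a = δ a)
    (h : ∀ t ∈ Ico a b, γ t = δ t → ∃ ε > 0, ∀ s ∈ Ioc t (t + ε), s ≤ b → γ s = δ s) :
    ∀ t ∈ Icc a b, γ t = δ t := by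
  have hcl : IsClosed ({t | γ t = δ t} ∩ Icc a b) := by
    have := ContinuousOn.preimage_isClosed_of_isClosed (hγ.sub hδ) isClosed_Icc
      (isClosed_singleton (x := (0 : Plane)))
    convert this using 1
    ext t
    simp [sub_eq_zero, and_comm]
  refine fun t ht => hcl.Icc_subset_of_forall_exists_gt ha (fun s hs y hy => ?_) ht
  obtain ⟨ε, hε, H⟩ := h s hs.2 hs.1
  have hlt : s < min (min (s + ε) b) y := lt_min (lt_min (by linarith) hs.2.2) hy
  exact ⟨_, H _ ⟨hlt, (min_le_left _ _).trans (min_le_left _ _)⟩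
    ((min_le_left _ _).trans (min_le_right _ _)), hlt, min_le_right _ _⟩

/-- A set that each arc either avoids or contains is invariant. -/
lemma IsTrajectoryOn.forall_mem_of_exists_mem {J : Set ℝ} (h : IsTrajectoryOn X Y J γ)
    {L : Set Plane}
    (hL : ∀ a b, IsArc X Y γ a b → ∀ s ∈ Icc a b, ∀ t ∈ Icc a b, γ s ∈ L → γ t ∈ L)
    (hex : ∃ t ∈ J, γ t ∈ L) : ∀ t ∈ J, γ t ∈ L := by
  obtain ⟨t, ht, rfl, h⟩ := h
  obtain ⟨s, hs, hsL⟩ := hex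
  obtain ⟨i, hi⟩ := mem_iUnion.1 hs
  have hle : ∀ j, t j ≤ t (j + 1) := fun j => (ht (by omega)).le
  have hall : ∀ j, γ (t j) ∈ L := fun j => by
    induction j using Int.inductionOn' (b := i) with
    | zero => exact hL _ _ (h i) s hi _ ⟨le_rfl, hle i⟩ hsL
    | succ j _ ih => exact hL _ _ (h j) _ ⟨le_rfl, hle j⟩ _ ⟨hle j, le_rfl⟩ ih
    | pred j _ ih =>
      have h1 := h (j - 1)
      have h2 := hle (j - 1)
      rw [sub_add_cancel] at h1 h2
      exact hL _ _ h1 _ ⟨h2, le_rfl⟩ _ ⟨le_rfl, h2⟩ ih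
  intro u hu
  obtain ⟨j, hj⟩ := mem_iUnion.1 hu
  exact hL _ _ (h j) _ ⟨le_rfl, hle j⟩ u hj (hall j)

end

/-! ### Series of Hausdorff distances -/

lemma hausdorffEDist_ne_top {A B : Set Plane} (hA : A.Nonempty) (hA' : IsCompact A)
    (hB : B.Nonempty) (hB' : IsCompact B) : Metric.hausdorffEDist A B ≠ ⊤ :=
  Metric.hausdorffEDist_ne_top_of_nonempty_of_bounded hA hB hA'.isBounded hB'.isBounded

lemma isMetricFn_tsum_hausdorffDist {α : Type*} (A : α → ℤ → Set Plane)
    (hne : ∀ x i, (A x i).Nonempty) (hc : ∀ x i, IsCompact (A x i))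
    (hsep : ∀ x y, (∀ i, A x i = A y i) → x = y)
    (hs : ∀ x y, Summable fun i => Metric.hausdorffDist (A x i) (A y i) / 2 ^ i.natAbs) :
    IsMetricFn fun x y => ∑' i : ℤ, Metric.hausdorffDist (A x i) (A y i) / 2 ^ i.natAbs := by
  refine isMetricFn_tsum (fun x y i => Metric.hausdorffDist (A x i) (A y i) / 2 ^ i.natAbs)
    (fun x y i => div_nonneg Metric.hausdorffDist_nonneg (by positivity))
    (fun x i => by simp) (fun x y h => hsep x y fun i => ?_)
    (fun x y i => by simp only [Metric.hausdorffDist_comm]) (fun x y z i => ?_) hs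
  · have := h i
    rw [div_eq_zero_iff] at this
    exact ((hc x i).isClosed.hausdorffDist_zero_iff_eq (hc y i).isClosed
      (hausdorffEDist_ne_top (hne x i) (hc x i) (hne y i) (hc y i))).1
        (this.resolve_right (by positivity))
  · rw [← add_div]
    gcongr
    exact Metric.hausdorffDist_triangle
      (hausdorffEDist_ne_top (hne x i) (hc x i) (hne y i) (hc y i))

/-! ### Systems whose trajectories are concatenations of unit-time arcs -/

/-- A piecewise smooth field whose global trajectories in `L` are concatenations of the arcs
`φ n : [0, 1] → L`, `n ∈ A`. The marked points `M` are the end points of the arcs, `I n` is the open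
arc `φ n ((0, 1))`, and trajectories are determined forwards up to the next marked point. Moreover,
the Hausdorff distance of arcs is comparable to the distance of their labels. -/
structure ArcSystem (X Y : Plane → Plane) (L M : Set Plane) (I : ℤ → Set Plane) (A : Set ℤ)
    (φ : ℤ → ℝ → Plane) : Prop where
  invariant : ∀ γ, IsGlobalTrajectory X Y γ → (∃ t, γ t ∈ L) → ∀ t, γ t ∈ L
  mem_arc : ∀ n ∈ A, ∀ u ∈ Ioo (0 : ℝ) 1, φ n u ∈ I n
  of_mem_arc : ∀ n, ∀ q ∈ I n, n ∈ A ∧ ∃ u ∈ Ioo (0 : ℝ) 1, φ n u = q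
  arc_disjoint : ∀ n m, n ≠ m → Disjoint (I n) (I m)
  arc_disjoint_marked : ∀ n, Disjoint (I n) M
  start_mem : ∀ n ∈ A, φ n 0 ∈ M
  end_mem : ∀ n ∈ A, φ n 1 ∈ M
  marked_subset : M ⊆ L
  arc_subset : ∀ n, I n ⊆ L
  cover : L ⊆ M ∪ ⋃ n, I n
  follow : ∀ γ, IsGlobalTrajectory X Y γ → (∀ t, γ t ∈ L) → ∀ t, ∀ n ∈ A, ∀ u ∈ Ioo (0 : ℝ) 1,
    γ t = φ n u → γ (t + (1 - u)) = φ n 1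
  branch : ∀ γ, IsGlobalTrajectory X Y γ → (∀ t, γ t ∈ L) → ∀ t, γ t ∈ M →
    ∃ n ∈ A, ∀ u ∈ Icc (0 : ℝ) 1, γ (t + u) = φ n u
  isArc : ∀ n ∈ A, IsArc X Y (φ n) 0 (1 / 2) ∧ IsArc X Y (φ n) (1 / 2) 1
  hausdorff : ∃ c > 0, ∃ C > 0, ∀ n ∈ A, ∀ m ∈ A,
    c * dist n m ≤ Metric.hausdorffDist (φ n '' Icc 0 1) (φ m '' Icc 0 1) ∧
      Metric.hausdorffDist (φ n '' Icc 0 1) (φ m '' Icc 0 1) ≤ C * dist n m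

namespace ArcSystem

variable {X Y : Plane → Plane} {L M : Set Plane} {I : ℤ → Set Plane} {A : Set ℤ}
  {φ : ℤ → ℝ → Plane}

/-- The sequences of labels of consecutive arcs. -/
def admissible (A : Set ℤ) (φ : ℤ → ℝ → Plane) : Set (ℤ → ℤ) :=
  {a | ∀ j, a j ∈ A ∧ φ (a j) 1 = φ (a (j + 1)) 0}

lemma shift_admissible : shift '' admissible A φ = admissible A φ :=
  shift_image_eq fun a => by
    constructor
    · intro h j
      simpa using h (j - 1)
    · intro h j
      exact h (j + 1)

/-- The concatenation of the arcs with labels `a`. -/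
def concat (φ : ℤ → ℝ → Plane) (a : ℤ → ℤ) (t : ℝ) : Plane := φ (a ⌊t⌋) (t - ⌊t⌋)

lemma concat_add {a : ℤ → ℤ} (ha : a ∈ admissible A φ) (j : ℤ) {u : ℝ} (hu : u ∈ Icc (0 : ℝ) 1) :
    concat φ a (j + u) = φ (a j) u := by
  rcases hu.2.eq_or_lt with rfl | h
  · have : ⌊(j : ℝ) + 1⌋ = j + 1 := by simp
    simp only [concat, this]
    rw [(ha j).2]
    simp
  · have : ⌊(j : ℝ) + u⌋ = j := by
      rw [Int.floor_intCast_add, Int.floor_eq_zero_iff.2 ⟨hu.1, h⟩, add_zero]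
    simp [concat, this]

lemma eq_floor_add_fract (t : ℝ) : t = (⌊t⌋ : ℝ) + Int.fract t := (Int.floor_add_fract t).symm

lemma fract_mem_Icc (t : ℝ) : Int.fract t ∈ Icc (0 : ℝ) 1 :=
  ⟨Int.fract_nonneg t, (Int.fract_lt_one t).le⟩

variable (h : ArcSystem X Y L M I A φ)
include h

lemma φ_mem {n : ℤ} (hn : n ∈ A) {u : ℝ} (hu : u ∈ Icc (0 : ℝ) 1) : φ n u ∈ L := by
  rcases hu.1.eq_or_lt with rfl | h0
  · exact h.marked_subset (h.start_mem n hn)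
  rcases hu.2.eq_or_lt with rfl | h1
  · exact h.marked_subset (h.end_mem n hn)
  exact h.arc_subset n (h.mem_arc n hn u ⟨h0, h1⟩)

lemma φ_notMem_marked {n : ℤ} (hn : n ∈ A) {u : ℝ} (hu : u ∈ Ioo (0 : ℝ) 1) : φ n u ∉ M :=
  fun hM => (h.arc_disjoint_marked n).le_bot ⟨h.mem_arc n hn u hu, hM⟩

lemma isGlobalTrajectory_concat {a : ℤ → ℤ} (ha : a ∈ admissible A φ) :
    IsGlobalTrajectory X Y (concat φ a) := by
  rw [isGlobalTrajectory_iff, isTrajectoryOn_iff]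
  have harc : ∀ j : ℤ, IsArc X Y (concat φ a) j (j + 1 / 2) ∧
      IsArc X Y (concat φ a) (j + 1 / 2) (j + 1) := fun j => by
    have hcongr : ∀ t ∈ Icc (j : ℝ) (j + 1), concat φ a t = φ (a j) (t + -j) := fun t ht => by
      rw [← concat_add ha j ⟨by linarith [ht.1], by linarith [ht.2]⟩]
      congr 1
      ring
    obtain ⟨h1, h2⟩ := h.isArc _ (ha j).1
    constructor
    · refine (IsArc.comp_add (-(j : ℝ)) (h1.mono (by simp) (by simp))).congr fun t ht => ?_
      exact hcongr t ⟨ht.1, by linarith [ht.2]⟩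
    · refine (IsArc.comp_add (-(j : ℝ)) (h2.mono (by simp) (by simp))).congr fun t ht => ?_
      exact hcongr t ⟨by linarith [ht.1], ht.2⟩
  refine ⟨univ_nonempty, ordConnected_univ, fun t _ => ?_⟩
  suffices (∃ ε > 0, IsArc X Y (concat φ a) (t - ε) t) ∧
      ∃ ε > 0, IsArc X Y (concat φ a) t (t + ε) by
    obtain ⟨⟨ε, hε, hl⟩, ε', hε', hr⟩ := this
    exact ⟨min ε ε', lt_min hε hε', subset_univ _,
      hl.mono (by linarith [min_le_left ε ε']) le_rfl,
      hr.mono le_rfl (by linarith [min_le_right ε ε'])⟩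
  have hfl := Int.floor_le t
  have hfl' := Int.lt_floor_add_one t
  constructor
  · rcases lt_or_ge ((⌊t⌋ : ℝ) + 1 / 2) t with h1 | h1
    · exact ⟨t - (⌊t⌋ + 1 / 2), by linarith, (harc ⌊t⌋).2.mono (by linarith) hfl'.le⟩
    rcases hfl.lt_or_eq with h2 | h2
    · exact ⟨t - ⌊t⌋, by linarith, (harc ⌊t⌋).1.mono (by linarith) h1⟩
    · refine ⟨1 / 2, by norm_num, (harc (⌊t⌋ - 1)).2.mono ?_ ?_⟩ <;> push_cast <;> linarith
  · rcases lt_or_ge t ((⌊t⌋ : ℝ) + 1 / 2) with h1 | h1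
    · exact ⟨⌊t⌋ + 1 / 2 - t, by linarith, (harc ⌊t⌋).1.mono hfl (by linarith)⟩
    · exact ⟨⌊t⌋ + 1 - t, by linarith, (harc ⌊t⌋).2.mono h1 (by linarith)⟩

lemma concat_mem {a : ℤ → ℤ} (ha : a ∈ admissible A φ) (t : ℝ) : concat φ a t ∈ L := by
  rw [eq_floor_add_fract t, concat_add ha _ (fract_mem_Icc t)]
  exact h.φ_mem (ha _).1 (fract_mem_Icc t)

/-- The element of `Ω` with itinerary `a` that starts at a marked point. -/
def realize {a : ℤ → ℤ} (ha : a ∈ admissible A φ) : Omega X Y L :=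
  ⟨concat φ a, h.isGlobalTrajectory_concat ha, h.concat_mem ha 0⟩

lemma forall_mem (γ : Omega X Y L) (t : ℝ) : γ.1 t ∈ L :=
  h.invariant _ γ.2.1 ⟨0, γ.2.2⟩ t

/-- Within one unit of time, every trajectory meets a marked point. -/
lemma exists_marked (γ : Omega X Y L) (t : ℝ) : ∃ s ∈ Ioc t (t + 1), γ.1 s ∈ M := by
  have hbr : ∀ t, γ.1 t ∈ M → γ.1 (t + 1) ∈ M := fun t ht => by
    obtain ⟨n, hn, H⟩ := h.branch _ γ.2.1 (h.forall_mem γ) t ht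
    rw [H 1 ⟨by norm_num, le_rfl⟩]
    exact h.end_mem n hn
  rcases h.cover (h.forall_mem γ t) with ht | ht
  · exact ⟨t + 1, ⟨by linarith, le_rfl⟩, hbr t ht⟩
  · obtain ⟨n, hn⟩ := mem_iUnion.1 ht
    obtain ⟨hnA, u, hu, hφ⟩ := h.of_mem_arc n _ hn
    refine ⟨t + (1 - u), ⟨by linarith [hu.2], by linarith [hu.1]⟩, ?_⟩
    rw [h.follow _ γ.2.1 (h.forall_mem γ) t n hnA u hu hφ.symm]
    exact h.end_mem n hnA

lemma marked_spacing (γ : Omega X Y L) {s t : ℝ} (hs : γ.1 s ∈ M) (ht : γ.1 t ∈ M) (hst : s < t) :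
    s + 1 ≤ t := by
  by_contra hlt
  obtain ⟨n, hn, H⟩ := h.branch _ γ.2.1 (h.forall_mem γ) s hs
  have hu : t - s ∈ Ioo (0 : ℝ) 1 := ⟨by linarith, by linarith⟩
  have := H (t - s) ⟨hu.1.le, hu.2.le⟩
  rw [add_sub_cancel] at this
  exact h.φ_notMem_marked hn hu (this ▸ ht)

lemma marked_add_int (γ : Omega X Y L) {t : ℝ} (ht : γ.1 t ∈ M) (j : ℤ) : γ.1 (t + j) ∈ M := by
  induction j using Int.induction_on with
  | zero => simpa using ht
  | succ j ih =>
    obtain ⟨n, hn, H⟩ := h.branch _ γ.2.1 (h.forall_mem γ) _ ih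
    have := H 1 ⟨by norm_num, le_rfl⟩
    push_cast at this ⊢
    rw [← add_assoc, this]
    exact h.end_mem n hn
  | pred j ih =>
    -- the last marked time before `t - j` lies at distance at most one, hence exactly one
    obtain ⟨s, hs, hsM⟩ := h.exists_marked γ (t + ((-j : ℤ) : ℝ) - 1 - 1)
    obtain ⟨s', hs', hsM'⟩ : ∃ s ∈ Ico (t + ((-j : ℤ) : ℝ) - 1) (t + ((-j : ℤ) : ℝ)),
        γ.1 s ∈ M := by
      rcases hs.2.lt_or_eq with hlt | heq
      · obtain ⟨n, hn, H⟩ := h.branch _ γ.2.1 (h.forall_mem γ) s hsM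
        have := H 1 ⟨by norm_num, le_rfl⟩
        exact ⟨s + 1, ⟨by linarith [hs.1], by linarith⟩, this ▸ h.end_mem n hn⟩
      · exact ⟨s, ⟨by linarith, by linarith⟩, hsM⟩
    have := h.marked_spacing γ hsM' ih hs'.2
    have heq : s' = t + ((-(j : ℤ) - 1 : ℤ) : ℝ) := by
      push_cast at this hs' ⊢
      linarith [hs'.1]
    exact heq ▸ hsM'

/-- Every element of `Ω` is a time translate of a concatenation of arcs. -/
lemma exists_code (γ : Omega X Y L) : ∃ τ ∈ Ioc (-1 : ℝ) 0, ∃ a ∈ admissible A φ, γ.1 τ ∈ M ∧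
    ∀ j : ℤ, ∀ u ∈ Icc (0 : ℝ) 1, γ.1 (τ + j + u) = φ (a j) u := by
  obtain ⟨τ, hτ, hM⟩ := h.exists_marked γ (-1)
  choose a ha H using fun j : ℤ =>
    h.branch _ γ.2.1 (h.forall_mem γ) _ (h.marked_add_int γ hM j)
  refine ⟨τ, by simpa using hτ, a, fun j => ⟨ha j, ?_⟩, hM, H⟩
  rw [← H j 1 ⟨by norm_num, le_rfl⟩, ← H (j + 1) 0 ⟨le_rfl, by norm_num⟩]
  push_cast
  ring_nf

lemma isSymbol_iff (γ : Omega X Y L) {τ : ℝ} (hτ : τ ∈ Ioc (-1 : ℝ) 0) {a : ℤ → ℤ}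
    (ha : a ∈ admissible A φ) (hγ : ∀ j : ℤ, ∀ u ∈ Icc (0 : ℝ) 1, γ.1 (τ + j + u) = φ (a j) u)
    (j n : ℤ) : IsSymbol M I γ.1 j n ↔ n = a j := by
  have hn : ∀ u ∈ Ioo (0 : ℝ) 1, φ (a j) u ∈ I n ↔ n = a j := fun u hu => by
    constructor
    · intro hI
      by_contra hne
      exact (h.arc_disjoint _ _ hne).le_bot ⟨hI, h.mem_arc _ (ha j).1 u hu⟩
    · rintro rfl
      exact h.mem_arc _ (ha j).1 u hu
  have hj := hγ j (-τ) ⟨by linarith [hτ.2], by linarith [hτ.1]⟩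
  rw [show τ + j + -τ = (j : ℝ) by ring] at hj
  rcases hτ.2.eq_or_lt with rfl | h0
  · have hjM : γ.1 j ∈ M := by
      rw [hj, neg_zero]
      exact h.start_mem _ (ha j).1
    have hj' := hγ j (1 / 2) ⟨by norm_num, by norm_num⟩
    rw [zero_add] at hj'
    rw [IsSymbol, hj', hn _ ⟨by norm_num, by norm_num⟩]
    constructor
    · rintro (hI | hI)
      · exact absurd ⟨hI, hjM⟩ (fun h' => (h.arc_disjoint_marked n).le_bot h')
      · exact hI.2
    · exact fun hI => Or.inr ⟨hjM, hI⟩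
  · have hu : -τ ∈ Ioo (0 : ℝ) 1 := ⟨by linarith, by linarith [hτ.1]⟩
    rw [IsSymbol, hj, hn _ hu]
    constructor
    · rintro (hI | hI)
      · exact hI
      · exact absurd hI.1 (h.φ_notMem_marked (ha j).1 hu)
    · exact Or.inl

lemma itinerary_eq (γ : Omega X Y L) {τ : ℝ} (hτ : τ ∈ Ioc (-1 : ℝ) 0) {a : ℤ → ℤ}
    (ha : a ∈ admissible A φ) (hγ : ∀ j : ℤ, ∀ u ∈ Icc (0 : ℝ) 1, γ.1 (τ + j + u) = φ (a j) u) :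
    itinerary X Y L M I γ = a := by
  funext j
  have hs := fun n => h.isSymbol_iff γ hτ ha hγ j n
  exact (hs _).1 (Classical.epsilon_spec (p := IsSymbol M I γ.1 j) ⟨a j, (hs _).2 rfl⟩)

lemma itinerary_realize {a : ℤ → ℤ} (ha : a ∈ admissible A φ) :
    itinerary X Y L M I (h.realize ha) = a := by
  refine h.itinerary_eq _ (τ := 0) ⟨by norm_num, le_rfl⟩ ha fun j u hu => ?_
  rw [zero_add]
  exact concat_add ha j hu

lemma itinerary_mem (γ : Omega X Y L) : itinerary X Y L M I γ ∈ admissible A φ := by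
  obtain ⟨τ, hτ, a, ha, -, H⟩ := h.exists_code γ
  rw [h.itinerary_eq γ hτ ha H]
  exact ha

/-- A trajectory that starts at a marked point is the concatenation of the arcs of its itinerary. -/
lemma eq_realize (γ : Omega X Y L) (hM : γ.1 0 ∈ M) : γ = h.realize (h.itinerary_mem γ) := by
  obtain ⟨τ, hτ, a, ha, hτM, H⟩ := h.exists_code γ
  have hτ0 : τ = 0 := by
    by_contra hne
    have := h.marked_spacing γ hτM hM (lt_of_le_of_ne hτ.2 hne)
    linarith [hτ.1]
  subst hτ0
  have hit := h.itinerary_eq γ hτ ha H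
  refine Subtype.ext (funext fun t => ?_)
  change γ.1 t = concat φ (itinerary X Y L M I γ) t
  rw [hit, eq_floor_add_fract t, concat_add ha _ (fract_mem_Icc t), ← H _ _ (fract_mem_Icc t),
    zero_add]

lemma isRep_iff (γ : Omega X Y L) (δ : Omega X Y L) :
    IsRep X Y L M I (Quotient.mk _ γ) δ ↔ δ = h.realize (h.itinerary_mem γ) := by
  constructor
  · rintro ⟨h1, h2⟩
    have : itinerary X Y L M I δ = itinerary X Y L M I γ := Quotient.exact h1
    rw [h.eq_realize δ h2]
    simp only [this]
  · rintro rfl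
    refine ⟨Quotient.sound (h.itinerary_realize (h.itinerary_mem γ)), ?_⟩
    change concat φ _ 0 ∈ M
    have := concat_add (h.itinerary_mem γ) 0 (u := 0) ⟨le_rfl, by norm_num⟩
    simp only [Int.cast_zero, add_zero] at this
    rw [this]
    exact h.start_mem _ (h.itinerary_mem γ 0).1

lemma rep_eq (γ : Omega X Y L) :
    rep X Y L M I (Quotient.mk _ γ) = h.realize (h.itinerary_mem γ) :=
  (h.isRep_iff γ _).1 (@Classical.epsilon_spec _ (IsRep X Y L M I (Quotient.mk _ γ))
    ⟨_, (h.isRep_iff γ _).2 rfl⟩)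

lemma rep_image (γ : Omega X Y L) (i : ℤ) :
    (rep X Y L M I (Quotient.mk _ γ)).1 '' Icc (i : ℝ) (i + 1) =
      φ (itinerary X Y L M I γ i) '' Icc 0 1 := by
  rw [h.rep_eq]
  ext q
  constructor
  · rintro ⟨t, ht, rfl⟩
    refine ⟨t - i, ⟨by linarith [ht.1], by linarith [ht.2]⟩, ?_⟩
    rw [← concat_add (h.itinerary_mem γ) i ⟨by linarith [ht.1], by linarith [ht.2]⟩]
    simp [realize]
  · rintro ⟨u, hu, rfl⟩
    exact ⟨i + u, ⟨by linarith [hu.1], by linarith [hu.2]⟩, concat_add (h.itinerary_mem γ) i hu⟩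

lemma rhoTerm_eq (γ γ' : Omega X Y L) (i : ℤ) :
    rhoTerm X Y L M I (Quotient.mk _ γ) (Quotient.mk _ γ') i =
      Metric.hausdorffDist (φ (itinerary X Y L M I γ i) '' Icc 0 1)
        (φ (itinerary X Y L M I γ' i) '' Icc 0 1) / 2 ^ i.natAbs := by
  rw [rhoTerm, h.rep_image, h.rep_image]

lemma continuousOn_φ {n : ℤ} (hn : n ∈ A) : ContinuousOn (φ n) (Icc 0 1) := by
  obtain ⟨h1, h2⟩ := h.isArc n hn
  rw [← Icc_union_Icc_eq_Icc (b := (1 / 2 : ℝ)) (by norm_num) (by norm_num)]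
  exact h1.continuousOn.union_of_isClosed h2.continuousOn isClosed_Icc isClosed_Icc

/-- Itineraries conjugate the time-one map of an arc system to the shift on the admissible
sequences: the two metrics are equivalent, as each term of one series is comparable to that of the other. -/
theorem timeOneConjugacy (hs : ∀ a ∈ admissible A φ, ∀ b ∈ admissible A φ, Summable (seqTerm a b)) :
    TimeOneConjugacy X Y L M I (admissible A φ) := by
  obtain ⟨c, hc, C, hC, hH⟩ := h.hausdorff
  have hle : ∀ γ γ' : Omega X Y L, ∀ i,
      c * seqTerm (itinerary X Y L M I γ) (itinerary X Y L M I γ') i ≤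
        rhoTerm X Y L M I (Quotient.mk _ γ) (Quotient.mk _ γ') i ∧
      rhoTerm X Y L M I (Quotient.mk _ γ) (Quotient.mk _ γ') i ≤
        C * seqTerm (itinerary X Y L M I γ) (itinerary X Y L M I γ') i := fun γ γ' i => by
    obtain ⟨h1, h2⟩ := hH _ (h.itinerary_mem γ i).1 _ (h.itinerary_mem γ' i).1
    rw [h.rhoTerm_eq, seqTerm, ← mul_div_assoc, ← mul_div_assoc]
    exact ⟨by gcongr, by gcongr⟩
  have hsum : ∀ γ γ' : Omega X Y L,
      Summable (seqTerm (itinerary X Y L M I γ) (itinerary X Y L M I γ')) := fun γ γ' =>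
    hs _ (h.itinerary_mem γ) _ (h.itinerary_mem γ')
  have hsum' : ∀ γ γ' : Omega X Y L,
      Summable (rhoTerm X Y L M I (Quotient.mk _ γ) (Quotient.mk _ γ')) := fun γ γ' =>
    Summable.of_nonneg_of_le
      (fun i => div_nonneg Metric.hausdorffDist_nonneg (by positivity))
      (fun i => (hle γ γ' i).2) ((hsum γ γ').mul_left C)
  have hρ1 : ∀ γ γ' : Omega X Y L, c * seqDist (itinerary X Y L M I γ) (itinerary X Y L M I γ') ≤
      rho X Y L M I (Quotient.mk _ γ) (Quotient.mk _ γ') := fun γ γ' => by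
    rw [seqDist, ← tsum_mul_left]
    exact ((hsum γ γ').mul_left c).tsum_le_tsum (fun i => (hle γ γ' i).1) (hsum' γ γ')
  have hρ2 : ∀ γ γ' : Omega X Y L, rho X Y L M I (Quotient.mk _ γ) (Quotient.mk _ γ') ≤
      C * seqDist (itinerary X Y L M I γ) (itinerary X Y L M I γ') := fun γ γ' => by
    rw [seqDist, ← tsum_mul_left]
    exact (hsum' γ γ').tsum_le_tsum (fun i => (hle γ γ' i).2) ((hsum γ γ').mul_left C)
  have hsumq : ∀ q q' : OmegaBar X Y L M I, Summable (rhoTerm X Y L M I q q') := fun q q' => by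
    induction q using Quotient.inductionOn with
    | h γ => induction q' using Quotient.inductionOn with
      | h γ' => exact hsum' γ γ'
  refine ⟨h.invariant, fun γ j => ?_, fun q => ?_, hsumq,
    fun γ => ⟨fun t => γ.1 (t + 1), γ.2.1.comp_add 1, h.forall_mem γ _⟩, fun γ t => rfl, ?_⟩
  · obtain ⟨τ, hτ, a, ha, -, H⟩ := h.exists_code γ
    exact ⟨a j, (h.isSymbol_iff γ hτ ha H j _).2 rfl, fun n => (h.isSymbol_iff γ hτ ha H j n).1⟩
  · induction q using Quotient.inductionOn with
    | h γ => exact ⟨_, (h.isRep_iff γ _).2 rfl, fun δ => (h.isRep_iff γ δ).1⟩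
  refine itineraryConjugacy_of ?_ hs shift_admissible ?_ (fun γ => ?_) (fun γ ε hε => ?_)
    fun γ ε hε => ?_
  · refine isMetricFn_tsum_hausdorffDist
      (fun (q : OmegaBar X Y L M I) (i : ℤ) => (rep X Y L M I q).1 '' Icc (i : ℝ) (i + 1))
      (fun q i => (nonempty_Icc.2 (by linarith)).image _) (fun q i => ?_) (fun q q' hqq' => ?_)
      hsumq
    · induction q using Quotient.inductionOn with
      | h γ =>
        rw [h.rep_image]
        exact isCompact_Icc.image_of_continuousOn (h.continuousOn_φ (h.itinerary_mem γ i).1)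
    · induction q using Quotient.inductionOn with
      | h γ => induction q' using Quotient.inductionOn with
        | h γ' =>
          refine Quotient.sound (funext fun i => ?_)
          have h1 := (hH _ (h.itinerary_mem γ i).1 _ (h.itinerary_mem γ' i).1).1
          have h2 := hqq' i
          rw [h.rep_image, h.rep_image] at h2
          rw [h2, Metric.hausdorffDist_self_zero] at h1
          refine dist_le_zero.1 ?_
          nlinarith [dist_nonneg (x := itinerary X Y L M I γ i) (y := itinerary X Y L M I γ' i)]
  · ext a
    constructor
    · rintro ⟨γ, rfl⟩
      exact h.itinerary_mem γ
    · exact fun ha => ⟨_, h.itinerary_realize ha⟩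
  · funext j
    simp only [itinerary, shift_apply]
    congr 1
    funext n
    simp only [IsSymbol]
    push_cast
    rw [add_right_comm]
  · refine ⟨c * ε, by positivity, fun γ' hγ' => ?_⟩
    exact lt_of_mul_lt_mul_left ((hρ1 γ γ').trans_lt hγ') hc.le
  · refine ⟨ε / C, by positivity, fun γ' hγ' => (hρ2 γ γ').trans_lt ?_⟩
    rwa [lt_div_iff₀ hC, mul_comm] at hγ'

end ArcSystem

/-! ### The fields `(±1, P')` -/

/-- The point of the graph of `P` over `x`. -/
def graphUp (P : ℝ → ℝ) (x : ℝ) : Plane := !₂[x, P x]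

/-- The point of the graph of `-P` over `x`. -/
def graphDown (P : ℝ → ℝ) (x : ℝ) : Plane := !₂[x, -P x]

@[simp] lemma graphUp_zero (P : ℝ → ℝ) (x : ℝ) : graphUp P x 0 = x := by simp [graphUp]
@[simp] lemma graphUp_one (P : ℝ → ℝ) (x : ℝ) : graphUp P x 1 = P x := by simp [graphUp]
@[simp] lemma graphDown_zero (P : ℝ → ℝ) (x : ℝ) : graphDown P x 0 = x := by simp [graphDown]
@[simp] lemma graphDown_one (P : ℝ → ℝ) (x : ℝ) : graphDown P x 1 = -P x := by simp [graphDown]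

/-- The zero set of the first integral `|y| - P(x)` of the field `(±1, P')`. -/
def zeroLevel (P : ℝ → ℝ) : Set Plane := {q | |q 1| = P (q 0)}

lemma mem_zeroLevel {P : ℝ → ℝ} {q : Plane} :
    q ∈ zeroLevel P ↔ 0 ≤ P (q 0) ∧ (q 1 = P (q 0) ∨ q 1 = -P (q 0)) := by
  rw [zeroLevel, mem_ofPred_eq]
  constructor
  · intro h
    exact ⟨h ▸ abs_nonneg _, (abs_eq (h ▸ abs_nonneg _)).1 h⟩
  · rintro ⟨h0, h⟩
    exact (abs_eq h0).2 h

/-- `P` is a primitive of the differentiable function `g`, and near each of its zeros it takes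
positive values. -/
structure IsProfile (P g : ℝ → ℝ) : Prop where
  hasDerivAt : ∀ x, HasDerivAt P (g x) x
  differentiable : Differentiable ℝ g
  exists_pos : ∀ x, P x = 0 → ∀ ε > 0, ∃ y, |y - x| < ε ∧ 0 < P y

namespace IsProfile

variable {P g : ℝ → ℝ} {γ : ℝ → Plane}

lemma slidingSet_eq_empty (g : ℝ → ℝ) : slidingSet (planeField 1 g) (planeField (-1) g) = ∅ := by
  ext p
  simp only [slidingSet, planeField, mem_ofPred_eq, mem_empty_iff_false, iff_false]
  rintro ⟨-, h | h⟩ <;> simp at h <;> linarith [h.1, h.2]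

lemma continuous_graphUp (h : IsProfile P g) : Continuous (graphUp P) := by
  have : Continuous P := continuous_iff_continuousAt.2 fun x => (h.hasDerivAt x).continuousAt
  unfold graphUp
  fun_prop

lemma continuous_graphDown (h : IsProfile P g) : Continuous (graphDown P) := by
  have : Continuous P := continuous_iff_continuousAt.2 fun x => (h.hasDerivAt x).continuousAt
  unfold graphDown
  fun_prop

lemma upper_orbit_iff (h : IsProfile P g) {a b : ℝ} :
    (∀ t ∈ Icc a b, HasDerivWithinAt γ (planeField 1 g (γ t)) (Icc a b) t) ↔
      ∃ x₀ e, ∀ t ∈ Icc a b, γ t = !₂[x₀ + t, P (x₀ + t) + e] := by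
  simpa using hasDerivWithinAt_planeField_iff (c := 1) (g := g) h.hasDerivAt (by simp)
    (γ := γ) (a := a) (b := b)

lemma lower_orbit_iff (h : IsProfile P g) {a b : ℝ} :
    (∀ t ∈ Icc a b, HasDerivWithinAt γ (planeField (-1) g (γ t)) (Icc a b) t) ↔
      ∃ x₀ e, ∀ t ∈ Icc a b, γ t = !₂[x₀ - t, -P (x₀ - t) + e] := by
  simpa [sub_eq_add_neg] using
    hasDerivWithinAt_planeField_iff (c := -1) (g := g) (Q := fun x => -P x) (q := fun x => -g x)
      (fun x => (h.hasDerivAt x).neg) (by simp) (γ := γ) (a := a) (b := b)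

/-- The zero level contains no singular tangency, since at such a point `P` would have a local
maximum. -/
lemma not_singularTangency (h : IsProfile P g) {p : Plane} (hp : p ∈ zeroLevel P) :
    ¬ SingularTangency (planeField 1 g) (planeField (-1) g) p := by
  rintro ⟨h0, h1, h2, -⟩
  have hP0 : P (p 0) = 0 := by
    rw [zeroLevel, mem_ofPred_eq, h0, abs_zero] at hp
    exact hp.symm
  have hderiv : deriv P = g := funext fun x => (h.hasDerivAt x).deriv
  have hg : deriv (deriv P) (p 0) < 0 := by
    have hproj : HasFDerivAt (fun q : Plane => q 0) (EuclideanSpace.proj (𝕜 := ℝ) (0 : Fin 2)) p :=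
      (EuclideanSpace.proj (𝕜 := ℝ) (0 : Fin 2)).hasFDerivAt
    have := ((h.differentiable (p 0)).hasDerivAt.comp_hasFDerivAt p hproj).fderiv
    have h3 : (fun q : Plane => planeField 1 g q 1) = g ∘ fun q : Plane => q 0 := by
      funext q
      simp [planeField]
    rw [h3, this] at h2
    rw [hderiv]
    simpa [planeField] using h2
  have hmax : IsLocalMax P (p 0) := isLocalMax_of_deriv_deriv_neg hg
    (by rw [hderiv]; simpa [planeField] using h1) (h.hasDerivAt _).continuousAt
  obtain ⟨ε, hε, H⟩ := Metric.eventually_nhds_iff.1 hmax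
  obtain ⟨y, hy, hy'⟩ := h.exists_pos _ hP0 ε hε
  have := H (y := y) (by rwa [Real.dist_eq])
  linarith

/-- `|y| - P(x)` is constant along local trajectories. -/
lemma abs_sub_eq (h : IsProfile P g) {a b : ℝ}
    (harc : IsArc (planeField 1 g) (planeField (-1) g) γ a b) :
    ∀ s ∈ Icc a b, ∀ t ∈ Icc a b, |γ s 1| - P (γ s 0) = |γ t 1| - P (γ t 0) := by
  intro s hs t ht
  rcases harc with harc | harc | harc | ⟨p, -, harc⟩
  · obtain ⟨x₀, e, H⟩ := h.upper_orbit_iff.1 fun t ht => (harc t ht).2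
    rw [abs_of_nonneg (harc s hs).1, abs_of_nonneg (harc t ht).1, H s hs, H t ht]
    simp
  · obtain ⟨x₀, e, H⟩ := h.lower_orbit_iff.1 fun t ht => (harc t ht).2
    rw [abs_of_nonpos (harc s hs).1, abs_of_nonpos (harc t ht).1, H s hs, H t ht]
    simp
  · obtain ⟨-, v, hv, -⟩ := harc s hs
    rw [IsSlidingVelocity, slidingSet_eq_empty] at hv
    simp at hv
  · rw [harc s hs, harc t ht]

lemma invariant (h : IsProfile P g)
    (hγ : IsGlobalTrajectory (planeField 1 g) (planeField (-1) g) γ)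
    (hex : ∃ t, γ t ∈ zeroLevel P) : ∀ t, γ t ∈ zeroLevel P := by
  rw [isGlobalTrajectory_iff] at hγ
  obtain ⟨t, ht⟩ := hex
  refine fun s => hγ.forall_mem_of_exists_mem (L := zeroLevel P) (fun a b harc s hs t ht hsL => ?_)
    ⟨t, mem_univ t, ht⟩ s (mem_univ s)
  have := h.abs_sub_eq harc s hs t ht
  rw [zeroLevel, mem_ofPred_eq] at hsL ⊢
  linarith

/-- In the zero level, a trajectory moves to the right along the upper graph or to the left along
the lower graph. -/
lemma right_step (h : IsProfile P g)
    (hγ : IsGlobalTrajectory (planeField 1 g) (planeField (-1) g) γ)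
    (hL : ∀ t, γ t ∈ zeroLevel P) (t : ℝ) : ∃ ε > 0,
      (∀ s ∈ Icc 0 ε, γ (t + s) = graphUp P (γ t 0 + s)) ∨
      ∀ s ∈ Icc 0 ε, γ (t + s) = graphDown P (γ t 0 - s) := by
  rw [isGlobalTrajectory_iff, isTrajectoryOn_iff] at hγ
  obtain ⟨ε, hε, -, -, harc⟩ := hγ.2.2 t (mem_univ t)
  refine ⟨ε, hε, ?_⟩
  have ht : t ∈ Icc t (t + ε) := ⟨le_rfl, by linarith⟩
  have hm : ∀ {s}, s ∈ Icc 0 ε → t + s ∈ Icc t (t + ε) := fun hs =>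
    ⟨by linarith [hs.1], by linarith [hs.2]⟩
  rcases harc with harc | harc | harc | ⟨p, hp, harc⟩
  · left
    obtain ⟨x₀, e, H⟩ := h.upper_orbit_iff.1 fun t ht => (harc t ht).2
    intro s hs
    have h1 := hL (t + s)
    rw [zeroLevel, mem_ofPred_eq, abs_of_nonneg (harc _ (hm hs)).1] at h1
    have hx : γ (t + s) 0 = γ t 0 + s := by
      rw [H _ (hm hs), H _ ht]
      simp
      ring
    exact plane_ext (by simp [hx]) (by simp [h1, hx])
  · right
    obtain ⟨x₀, e, H⟩ := h.lower_orbit_iff.1 fun t ht => (harc t ht).2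
    intro s hs
    have h1 := hL (t + s)
    rw [zeroLevel, mem_ofPred_eq, abs_of_nonpos (harc _ (hm hs)).1] at h1
    have hx : γ (t + s) 0 = γ t 0 - s := by
      rw [H _ (hm hs), H _ ht]
      simp
      ring
    refine plane_ext (by simp [hx]) ?_
    rw [graphDown_one, ← hx, ← h1, neg_neg]
  · obtain ⟨-, v, hv, -⟩ := harc t ht
    rw [IsSlidingVelocity, slidingSet_eq_empty] at hv
    simp at hv
  · exact absurd hp (h.not_singularTangency (harc t ht ▸ hL t))

lemma continuous_trajectory {X Y : Plane → Plane} (hγ : IsGlobalTrajectory X Y γ) :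
    Continuous γ := by
  rw [isGlobalTrajectory_iff, isTrajectoryOn_iff] at hγ
  exact continuous_iff_continuousAt.2 fun t => hγ.2.2.continuousAt (mem_univ t)

lemma follow_upper (h : IsProfile P g)
    (hγ : IsGlobalTrajectory (planeField 1 g) (planeField (-1) g) γ)
    (hL : ∀ t, γ t ∈ zeroLevel P) {t x₀ x₁ : ℝ} (h0 : γ t = graphUp P x₀)
    (hpos : ∀ x ∈ Ioo x₀ x₁, 0 < P x)
    (hst : 0 < P x₀ ∨ ∃ ε > 0, ∀ s ∈ Icc 0 ε, γ (t + s) = graphUp P (x₀ + s)) :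
    ∀ s ∈ Icc 0 (x₁ - x₀), γ (t + s) = graphUp P (x₀ + s) := by
  have hcγ := continuous_trajectory hγ
  have hcu := h.continuous_graphUp
  refine eqOn_Icc_of_local (γ := fun s => γ (t + s)) (δ := fun s => graphUp P (x₀ + s))
    (by fun_prop) (by fun_prop) (by simpa using h0) fun s hs heq => ?_
  have hP : 0 < P (x₀ + s) →
      ∃ ε > 0, ∀ s' ∈ Ioc s (s + ε), s' ≤ x₁ - x₀ → γ (t + s') = graphUp P (x₀ + s') := by
    intro hP
    obtain ⟨ε, hε, H | H⟩ := h.right_step hγ hL (t + s)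
    · refine ⟨ε, hε, fun s' hs' _ => ?_⟩
      have := H (s' - s) ⟨by linarith [hs'.1], by linarith [hs'.2]⟩
      rw [heq, graphUp_zero] at this
      convert this using 2 <;> ring
    · have := congrArg (fun q : Plane => q 1) (H 0 ⟨le_rfl, hε.le⟩)
      simp only [add_zero, sub_zero, heq, graphUp_one, graphUp_zero, graphDown_one] at this
      linarith
  rcases hs.1.eq_or_lt with rfl | hs0
  · rcases hst with hst | ⟨ε, hε, H⟩
    · exact hP (by simpa using hst)
    · exact ⟨ε, hε, fun s hs _ => H s ⟨hs.1.le, by linarith [hs.2]⟩⟩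
  · exact hP (hpos _ ⟨by linarith, by linarith [hs.2]⟩)

lemma follow_lower (h : IsProfile P g)
    (hγ : IsGlobalTrajectory (planeField 1 g) (planeField (-1) g) γ)
    (hL : ∀ t, γ t ∈ zeroLevel P) {t x₀ x₁ : ℝ} (h0 : γ t = graphDown P x₀)
    (hpos : ∀ x ∈ Ioo x₁ x₀, 0 < P x)
    (hst : 0 < P x₀ ∨ ∃ ε > 0, ∀ s ∈ Icc 0 ε, γ (t + s) = graphDown P (x₀ - s)) :
    ∀ s ∈ Icc 0 (x₀ - x₁), γ (t + s) = graphDown P (x₀ - s) := by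
  have hcγ := continuous_trajectory hγ
  have hcl := h.continuous_graphDown
  refine eqOn_Icc_of_local (γ := fun s => γ (t + s)) (δ := fun s => graphDown P (x₀ - s))
    (by fun_prop) (by fun_prop) (by simpa using h0) fun s hs heq => ?_
  have hP : 0 < P (x₀ - s) →
      ∃ ε > 0, ∀ s' ∈ Ioc s (s + ε), s' ≤ x₀ - x₁ → γ (t + s') = graphDown P (x₀ - s') := by
    intro hP
    obtain ⟨ε, hε, H | H⟩ := h.right_step hγ hL (t + s)
    · have := congrArg (fun q : Plane => q 1) (H 0 ⟨le_rfl, hε.le⟩)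
      simp only [add_zero, heq, graphUp_one, graphDown_zero, graphDown_one] at this
      linarith
    · refine ⟨ε, hε, fun s' hs' _ => ?_⟩
      have := H (s' - s) ⟨by linarith [hs'.1], by linarith [hs'.2]⟩
      rw [heq, graphDown_zero] at this
      convert this using 2 <;> ring
  rcases hs.1.eq_or_lt with rfl | hs0
  · rcases hst with hst | ⟨ε, hε, H⟩
    · exact hP (by simpa using hst)
    · exact ⟨ε, hε, fun s hs _ => H s ⟨hs.1.le, by linarith [hs.2]⟩⟩
  · exact hP (hpos _ ⟨by linarith [hs.2], by linarith⟩)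

/-- At a point of the switching line beyond which `P < 0`, the trajectory turns from the upper to
the lower graph. -/
lemma turn_lower (h : IsProfile P g)
    (hγ : IsGlobalTrajectory (planeField 1 g) (planeField (-1) g) γ)
    (hL : ∀ t, γ t ∈ zeroLevel P) {t x₀ : ℝ} (h0 : γ t 0 = x₀)
    (hneg : ∀ x, x₀ < x → P x < 0) :
    ∃ ε > 0, ∀ s ∈ Icc 0 ε, γ (t + s) = graphDown P (x₀ - s) := by
  obtain ⟨ε, hε, H | H⟩ := h.right_step hγ hL t
  · have h1 := (mem_zeroLevel.1 (hL (t + ε))).1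
    rw [H ε ⟨hε.le, le_rfl⟩, graphUp_zero, h0] at h1
    linarith [hneg (x₀ + ε) (by linarith)]
  · exact ⟨ε, hε, h0 ▸ H⟩

lemma turn_upper (h : IsProfile P g)
    (hγ : IsGlobalTrajectory (planeField 1 g) (planeField (-1) g) γ)
    (hL : ∀ t, γ t ∈ zeroLevel P) {t x₀ : ℝ} (h0 : γ t 0 = x₀)
    (hneg : ∀ x, x < x₀ → P x < 0) :
    ∃ ε > 0, ∀ s ∈ Icc 0 ε, γ (t + s) = graphUp P (x₀ + s) := by
  obtain ⟨ε, hε, H | H⟩ := h.right_step hγ hL t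
  · exact ⟨ε, hε, h0 ▸ H⟩
  · have h1 := (mem_zeroLevel.1 (hL (t + ε))).1
    rw [H ε ⟨hε.le, le_rfl⟩, graphDown_zero, h0] at h1
    linarith [hneg (x₀ - ε) (by linarith)]

lemma isArc_upper (h : IsProfile P g) {x₀ a b : ℝ} (hpos : ∀ t ∈ Icc a b, 0 ≤ P (x₀ + t)) :
    IsArc (planeField 1 g) (planeField (-1) g) (fun t => graphUp P (x₀ + t)) a b := by
  have := h.upper_orbit_iff (γ := fun t => graphUp P (x₀ + t)) (a := a) (b := b) |>.2
    ⟨x₀, 0, fun t _ => by simp [graphUp]⟩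
  exact Or.inl fun t ht => ⟨by simpa using hpos t ht, this t ht⟩

lemma isArc_lower (h : IsProfile P g) {x₀ a b : ℝ} (hpos : ∀ t ∈ Icc a b, 0 ≤ P (x₀ - t)) :
    IsArc (planeField 1 g) (planeField (-1) g) (fun t => graphDown P (x₀ - t)) a b := by
  have := h.lower_orbit_iff (γ := fun t => graphDown P (x₀ - t)) (a := a) (b := b) |>.2
    ⟨x₀, 0, fun t _ => by simp [graphDown]⟩
  exact Or.inr <| Or.inl fun t ht => ⟨by simpa using hpos t ht, this t ht⟩

end IsProfile

/-! ### Estimates for distances in the plane -/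

lemma abs_sub_le_dist (p q : Plane) (i : Fin 2) : |p i - q i| ≤ dist p q := by
  rw [← Real.dist_eq]
  exact PiLp.dist_apply_le p q i

lemma dist_le_abs_add_abs (p q : Plane) : dist p q ≤ |p 0 - q 0| + |p 1 - q 1| := by
  rw [EuclideanSpace.dist_eq, Fin.sum_univ_two, Real.dist_eq, Real.dist_eq]
  refine Real.sqrt_le_iff.2 ⟨by positivity, ?_⟩
  nlinarith [mul_nonneg (abs_nonneg (p 0 - q 0)) (abs_nonneg (p 1 - q 1))]

lemma le_hausdorffDist {A B : Set Plane} (hA : IsCompact A) (hB : IsCompact B) (hB' : B.Nonempty)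
    {r : ℝ} {p : Plane} (hp : p ∈ A) (h : ∀ q ∈ B, r ≤ dist p q) :
    r ≤ Metric.hausdorffDist A B := by
  by_contra hlt
  obtain ⟨q, hq, hpq⟩ := Metric.exists_dist_lt_of_hausdorffDist_lt hp (not_le.1 hlt)
    (hausdorffEDist_ne_top ⟨p, hp⟩ hA hB' hB)
  exact absurd (h q hq) (not_le.2 hpq)

lemma hausdorffDist_le_of_dist_le {A B : Set Plane} (hA : A.Nonempty) (hB : B.Nonempty) {r : ℝ}
    (h : ∀ p ∈ A, ∀ q ∈ B, dist p q ≤ r) : Metric.hausdorffDist A B ≤ r := by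
  obtain ⟨p, hp⟩ := hA
  obtain ⟨q, hq⟩ := hB
  exact Metric.hausdorffDist_le_of_mem_dist (dist_nonneg.trans (h p hp q hq))
    (fun x hx => ⟨q, hq, h x hx q hq⟩) fun y hy => ⟨p, hp, by rw [dist_comm]; exact h p hp y hy⟩

/-! ### The field `Z_∞` -/

lemma profileInf_intCast (j : ℤ) : profileInf j = 0 := by
  have : Real.cos (2 * Real.pi * j) = 1 := by
    rw [mul_comm]
    exact Real.cos_int_mul_two_pi j
  simp [profileInf, this]

lemma profileInf_nonneg (x : ℝ) : 0 ≤ profileInf x :=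
  div_nonneg (by linarith [Real.cos_le_one (2 * Real.pi * x)]) Real.pi_pos.le

lemma profileInf_le (x : ℝ) : profileInf x ≤ 1 := by
  rw [profileInf, div_le_one Real.pi_pos]
  linarith [Real.neg_one_le_cos (2 * Real.pi * x), Real.pi_gt_three]

lemma profileInf_pos {j : ℤ} {x : ℝ} (hx : x ∈ Ioo (j : ℝ) (j + 1)) : 0 < profileInf x := by
  refine (profileInf_nonneg x).lt_of_ne' fun h => ?_
  rw [profileInf, div_eq_zero_iff] at h
  have hcos : Real.cos (2 * Real.pi * x) = 1 := by
    linarith [h.resolve_right Real.pi_ne_zero]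
  obtain ⟨n, hn⟩ := (Real.cos_eq_one_iff _).1 hcos
  have hnx : (n : ℝ) = x := by
    have := Real.pi_pos
    nlinarith
  rw [← hnx] at hx
  have h1 : j < n := by exact_mod_cast hx.1
  have h2 : n < j + 1 := by exact_mod_cast hx.2
  omega

lemma profileInf_add_half (j : ℤ) : profileInf (j + 1 / 2) = 2 / Real.pi := by
  have : Real.cos (2 * Real.pi * (j + 1 / 2)) = -1 := by
    rw [show 2 * Real.pi * ((j : ℝ) + 1 / 2) = Real.pi + j * (2 * Real.pi) by ring]
    rw [Real.cos_add_int_mul_two_pi, Real.cos_pi]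
  rw [profileInf, this]
  norm_num

lemma profileInf_eq_zero_iff {x : ℝ} : profileInf x = 0 ↔ ∃ j : ℤ, x = j := by
  constructor
  · intro h
    refine ⟨⌊x⌋, ?_⟩
    by_contra hne
    have := profileInf_pos (j := ⌊x⌋) (x := x)
      ⟨lt_of_le_of_ne (Int.floor_le x) (Ne.symm hne), Int.lt_floor_add_one x⟩
    exact this.ne' h
  · rintro ⟨j, rfl⟩
    exact profileInf_intCast j

lemma isProfile_inf : IsProfile profileInf fun x => 2 * Real.sin (2 * Real.pi * x) where
  hasDerivAt x := by
    have h1 : HasDerivAt (fun x : ℝ => 2 * Real.pi * x) (2 * Real.pi) x := by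
      simpa using (hasDerivAt_id x).const_mul (2 * Real.pi)
    have := (((hasDerivAt_const x (1 : ℝ)).sub h1.cos).div_const Real.pi)
    refine this.congr_deriv ?_
    have := Real.pi_ne_zero
    field_simp
    ring
  differentiable := by fun_prop
  exists_pos x hx ε hε := by
    obtain ⟨j, rfl⟩ := profileInf_eq_zero_iff.1 hx
    have h0 : 0 < min ε 1 := lt_min hε one_pos
    have h1 := min_le_left ε 1
    have h2 := min_le_right ε 1
    refine ⟨j + min ε 1 / 2, ?_, profileInf_pos (j := j) ⟨by linarith, by linarith⟩⟩
    rw [add_sub_cancel_left, abs_of_pos (by linarith)]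
    linarith

lemma LambdaInf_eq : LambdaInf = zeroLevel profileInf := by
  ext q
  rw [mem_zeroLevel]
  exact ⟨fun h => ⟨profileInf_nonneg _, h⟩, fun h => h.2⟩

/-- The parametrization of `I_n` by unit time. -/
def pathInf (n : ℤ) (u : ℝ) : Plane :=
  if Even n then graphUp profileInf ((n / 2 : ℤ) + u)
  else graphDown profileInf ((n / 2 : ℤ) + (1 - u))

lemma pathInf_of_even {n : ℤ} (h : Even n) :
    pathInf n = fun u => graphUp profileInf ((n / 2 : ℤ) + u) := funext fun _ => if_pos h

lemma pathInf_of_not_even {n : ℤ} (h : ¬ Even n) :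
    pathInf n = fun u => graphDown profileInf ((n / 2 : ℤ) + (1 - u)) := funext fun _ => if_neg h

lemma mem_arcInf {n : ℤ} {q : Plane} : q ∈ arcInf n ↔
    q 0 ∈ Ioo ((n / 2 : ℤ) : ℝ) ((n / 2 : ℤ) + 1) ∧
      ((Even n ∧ q 1 = profileInf (q 0)) ∨ (¬ Even n ∧ q 1 = -profileInf (q 0))) := by
  constructor
  · rintro ⟨j, hj, ⟨rfl, h⟩ | ⟨rfl, h⟩⟩
    · rw [show 2 * j / 2 = j by omega]
      exact ⟨hj, Or.inl ⟨even_two_mul j, h⟩⟩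
    · rw [show (2 * j + 1) / 2 = j by omega]
      exact ⟨hj, Or.inr ⟨by simp, h⟩⟩
  · rintro ⟨hq, ⟨he, h⟩ | ⟨he, h⟩⟩
    · rw [Int.even_iff] at he
      exact ⟨n / 2, hq, Or.inl ⟨by omega, h⟩⟩
    · rw [Int.even_iff] at he
      exact ⟨n / 2, hq, Or.inr ⟨by omega, h⟩⟩

lemma pathInf_zero_mem {n : ℤ} {u : ℝ} (hu : u ∈ Icc (0 : ℝ) 1) :
    pathInf n u 0 ∈ Icc ((n / 2 : ℤ) : ℝ) ((n / 2 : ℤ) + 1) := by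
  by_cases h : Even n
  · simp only [pathInf, h, if_true, graphUp_zero]
    exact ⟨by linarith [hu.1], by linarith [hu.2]⟩
  · simp only [pathInf, h, if_false, graphDown_zero]
    exact ⟨by linarith [hu.2], by linarith [hu.1]⟩

lemma abs_pathInf_one (n : ℤ) (u : ℝ) : |pathInf n u 1| ≤ 1 := by
  by_cases h : Even n
  · simp only [pathInf, h, if_true, graphUp_one]
    rw [abs_of_nonneg (profileInf_nonneg _)]
    exact profileInf_le _
  · simp only [pathInf, h, if_false, graphDown_one]
    rw [abs_neg, abs_of_nonneg (profileInf_nonneg _)]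
    exact profileInf_le _

lemma continuous_pathInf (n : ℤ) : Continuous (pathInf n) := by
  have h1 := isProfile_inf.continuous_graphUp
  have h2 := isProfile_inf.continuous_graphDown
  by_cases h : Even n
  · rw [pathInf_of_even h]
    exact (h1.comp (continuous_const.add continuous_id) :)
  · rw [pathInf_of_not_even h]
    exact (h2.comp (continuous_const.add (continuous_const.sub continuous_id)) :)

lemma graphUp_profileInf_intCast (j : ℤ) : graphUp profileInf j = !₂[(j : ℝ), 0] := by
  simp [graphUp, profileInf_intCast]

lemma graphDown_profileInf_intCast (j : ℤ) : graphDown profileInf j = !₂[(j : ℝ), 0] := by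
  simp [graphDown, profileInf_intCast]

lemma pathInf_start (n : ℤ) :
    pathInf n 0 = !₂[((if Even n then n / 2 else n / 2 + 1 : ℤ) : ℝ), 0] := by
  by_cases h : Even n
  · simp only [pathInf, h, if_true, add_zero, graphUp_profileInf_intCast]
  · simp only [pathInf, h, if_false, sub_zero]
    exact_mod_cast graphDown_profileInf_intCast (n / 2 + 1)

lemma pathInf_end (n : ℤ) :
    pathInf n 1 = !₂[((if Even n then n / 2 + 1 else n / 2 : ℤ) : ℝ), 0] := by
  by_cases h : Even n
  · simp only [pathInf, h, if_true]
    exact_mod_cast graphUp_profileInf_intCast (n / 2 + 1)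
  · simp only [pathInf, h, if_false, sub_self, add_zero, graphDown_profileInf_intCast]

/-- The arcs over different unit intervals are far apart, and the two arcs over the same
interval are at positive distance in the middle. -/
lemma pathInf_hausdorff (n m : ℤ) :
    1 / 3 * dist n m ≤ Metric.hausdorffDist (pathInf n '' Icc 0 1) (pathInf m '' Icc 0 1) ∧
      Metric.hausdorffDist (pathInf n '' Icc 0 1) (pathInf m '' Icc 0 1) ≤ 4 * dist n m := by
  rcases eq_or_ne n m with rfl | hne
  · simp
  have hcpt : ∀ n, IsCompact (pathInf n '' Icc 0 1) := fun n =>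
    isCompact_Icc.image (continuous_pathInf n)
  have hnon : ∀ n, (pathInf n '' Icc (0 : ℝ) 1).Nonempty := fun n =>
    (nonempty_Icc.2 zero_le_one).image _
  -- labels of the same pair of arcs differ by one
  have hint : |n - m| ≤ 2 * |n / 2 - m / 2| + 1 ∧ |n / 2 - m / 2| ≤ |n - m| ∧ 1 ≤ |n - m| := by
    refine ⟨?_, ?_, ?_⟩ <;> grind
  have hd : dist n m = |(n : ℝ) - m| := Int.dist_eq n m
  have hint1 : dist n m ≤ 2 * |((n / 2 : ℤ) : ℝ) - (m / 2 : ℤ)| + 1 := by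
    rw [hd]; exact_mod_cast hint.1
  have hint2 : |((n / 2 : ℤ) : ℝ) - (m / 2 : ℤ)| ≤ dist n m := by
    rw [hd]; exact_mod_cast hint.2.1
  have hint3 : 1 ≤ dist n m := by
    rw [hd]; exact_mod_cast hint.2.2
  constructor
  · have key : ∀ n m : ℤ, m / 2 < n / 2 →
        dist n m ≤ 2 * |((n / 2 : ℤ) : ℝ) - (m / 2 : ℤ)| + 1 →
        1 / 3 * dist n m ≤
          Metric.hausdorffDist (pathInf n '' Icc 0 1) (pathInf m '' Icc 0 1) := by
      intro n m hlt hle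
      have h1 : ((m / 2 : ℤ) : ℝ) + 1 ≤ (n / 2 : ℤ) := by exact_mod_cast hlt
      rw [abs_of_pos (by linarith)] at hle
      obtain ⟨u, hu, hx⟩ : ∃ u ∈ Icc (0 : ℝ) 1, pathInf n u 0 = (n / 2 : ℤ) + 1 := by
        by_cases h : Even n
        · exact ⟨1, by norm_num, by simp [pathInf, h]⟩
        · exact ⟨0, by norm_num, by simp [pathInf, h]⟩
      refine le_hausdorffDist (hcpt n) (hcpt m) (hnon m) (mem_image_of_mem _ hu) ?_
      rintro _ ⟨v, hv, rfl⟩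
      have h2 := (pathInf_zero_mem (n := m) hv).2
      refine le_trans ?_ (abs_sub_le_dist _ _ 0)
      rw [hx]
      refine le_trans ?_ (le_abs_self _)
      linarith
    rcases lt_trichotomy (n / 2) (m / 2) with h | h | h
    · rw [dist_comm, Metric.hausdorffDist_comm]
      refine key m n h ?_
      rwa [dist_comm, abs_sub_comm]
    · rw [h, sub_self, abs_zero, mul_zero, zero_add] at hint1
      refine le_trans (b := 1 / 3) (by linarith) ?_
      refine le_hausdorffDist (hcpt n) (hcpt m) (hnon m)
        (mem_image_of_mem _ (show (1 / 2 : ℝ) ∈ Icc (0 : ℝ) 1 by norm_num)) ?_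
      rintro _ ⟨v, hv, rfl⟩
      refine le_trans ?_ (abs_sub_le_dist _ _ 1)
      have h0 := profileInf_add_half (n / 2)
      have h0' : (1 : ℝ) / 3 ≤ 2 / Real.pi := by
        rw [div_le_div_iff₀ (by norm_num) Real.pi_pos]
        linarith [Real.pi_le_four]
      by_cases hn : Even n
      · have hm : ¬ Even m := by
          intro hm
          rw [Int.even_iff] at hn hm
          omega
        simp only [pathInf, hn, hm, if_true, if_false, graphUp_one, graphDown_one, h0]
        have := profileInf_nonneg ((m / 2 : ℤ) + (1 - v))
        rw [abs_of_nonneg] <;> linarith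
      · have hm : Even m := by
          rw [Int.even_iff] at hn ⊢
          omega
        have h0'' : profileInf ((n / 2 : ℤ) + (1 - 1 / 2)) = 2 / Real.pi := by
          rw [← h0]; norm_num
        simp only [pathInf, hn, hm, if_true, if_false, graphUp_one, graphDown_one, h0'']
        have := profileInf_nonneg ((m / 2 : ℤ) + v)
        rw [abs_of_nonpos] <;> linarith
    · exact key n m h hint1
  · refine hausdorffDist_le_of_dist_le (hnon n) (hnon m) ?_
    rintro _ ⟨u, hu, rfl⟩ _ ⟨v, hv, rfl⟩
    refine (dist_le_abs_add_abs _ _).trans ?_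
    have h1 : |pathInf n u 0 - pathInf m v 0| ≤ |((n / 2 : ℤ) : ℝ) - (m / 2 : ℤ)| + 1 := by
      have hn := pathInf_zero_mem (n := n) hu
      have hm := pathInf_zero_mem (n := m) hv
      have h1 := le_abs_self (((n / 2 : ℤ) : ℝ) - (m / 2 : ℤ))
      have h2 := neg_abs_le (((n / 2 : ℤ) : ℝ) - (m / 2 : ℤ))
      exact abs_le.2 ⟨by linarith [hn.1, hm.2], by linarith [hn.2, hm.1]⟩
    have h2 : |pathInf n u 1 - pathInf m v 1| ≤ 2 := by
      refine (abs_sub _ _).trans ?_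
      linarith [abs_pathInf_one n u, abs_pathInf_one m v]
    linarith

/-- The arcs of `Λ_∞` form an arc system. -/
lemma arcSystem_inf : ArcSystem (planeField 1 fun x => 2 * Real.sin (2 * Real.pi * x))
    (planeField (-1) fun x => 2 * Real.sin (2 * Real.pi * x)) LambdaInf foldsInf arcInf univ
    pathInf where
  invariant γ hγ hex := by
    rw [LambdaInf_eq] at hex ⊢
    exact isProfile_inf.invariant hγ hex
  mem_arc n _ u hu := by
    rw [mem_arcInf]
    by_cases h : Even n
    · simp only [pathInf, h, if_true, graphUp_zero, graphUp_one]
      exact ⟨⟨by linarith [hu.1], by linarith [hu.2]⟩, by simp⟩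
    · simp only [pathInf, h, if_false, graphDown_zero, graphDown_one]
      exact ⟨⟨by linarith [hu.2], by linarith [hu.1]⟩, by simp⟩
  of_mem_arc n q hq := by
    refine ⟨mem_univ n, ?_⟩
    rw [mem_arcInf] at hq
    obtain ⟨⟨h0, h1⟩, ⟨he, hq⟩ | ⟨he, hq⟩⟩ := hq
    · refine ⟨q 0 - (n / 2 : ℤ), ⟨by linarith, by linarith⟩, ?_⟩
      simp only [pathInf, he, if_true, add_sub_cancel]
      exact plane_ext (by simp) (by simp [hq])
    · refine ⟨(n / 2 : ℤ) + 1 - q 0, ⟨by linarith, by linarith⟩, ?_⟩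
      simp only [pathInf, he, if_false]
      rw [show ((n / 2 : ℤ) : ℝ) + (1 - ((n / 2 : ℤ) + 1 - q 0)) = q 0 by ring]
      exact plane_ext (by simp) (by simp [hq])
  arc_disjoint n m hnm := by
    rw [Set.disjoint_left]
    intro q hn hm
    rw [mem_arcInf] at hn hm
    have h1 : n / 2 < m / 2 + 1 := by exact_mod_cast hn.1.1.trans hm.1.2
    have h2 : m / 2 < n / 2 + 1 := by exact_mod_cast hm.1.1.trans hn.1.2
    have hpos := profileInf_pos hn.1
    rcases hn.2 with ⟨he, hq⟩ | ⟨he, hq⟩ <;> rcases hm.2 with ⟨he', hq'⟩ | ⟨he', hq'⟩ <;>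
      rw [Int.even_iff] at he he'
    · omega
    · linarith
    · linarith
    · omega
  arc_disjoint_marked n := by
    rw [Set.disjoint_left]
    rintro q hq ⟨-, j, hj⟩
    rw [mem_arcInf, hj] at hq
    have h1 : n / 2 < j := by exact_mod_cast hq.1.1
    have h2 : j < n / 2 + 1 := by exact_mod_cast hq.1.2
    omega
  start_mem n _ := by
    rw [pathInf_start]
    exact ⟨rfl, _, rfl⟩
  end_mem n _ := by
    rw [pathInf_end]
    exact ⟨rfl, _, rfl⟩
  marked_subset := by
    rintro q ⟨h1, j, hj⟩
    exact Or.inl (by rw [h1, hj, profileInf_intCast])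
  arc_subset n q hq := by
    rw [mem_arcInf] at hq
    exact hq.2.imp And.right And.right
  cover := by
    intro q hq
    by_cases h : q 0 = ⌊q 0⌋
    · left
      refine ⟨?_, _, h⟩
      have h0 := profileInf_intCast ⌊q 0⌋
      rw [← h] at h0
      rcases hq with hq | hq <;> simp [hq, h0]
    · right
      have hx : q 0 ∈ Ioo (⌊q 0⌋ : ℝ) (⌊q 0⌋ + 1) :=
        ⟨lt_of_le_of_ne (Int.floor_le _) (Ne.symm h), Int.lt_floor_add_one _⟩
      rcases hq with hq | hq
      · exact mem_iUnion.2 ⟨2 * ⌊q 0⌋, ⌊q 0⌋, hx, Or.inl ⟨rfl, hq⟩⟩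
      · exact mem_iUnion.2 ⟨2 * ⌊q 0⌋ + 1, ⌊q 0⌋, hx, Or.inr ⟨rfl, hq⟩⟩
  follow γ hγ hL t n _ u hu heq := by
    rw [LambdaInf_eq] at hL
    by_cases h : Even n
    · simp only [pathInf, h, if_true] at heq ⊢
      have := isProfile_inf.follow_upper hγ hL heq (x₁ := (n / 2 : ℤ) + 1)
        (fun x hx => profileInf_pos (j := n / 2) ⟨by linarith [hx.1, hu.1], hx.2⟩)
        (Or.inl (profileInf_pos (j := n / 2) ⟨by linarith [hu.1], by linarith [hu.2]⟩))
        (1 - u) ⟨by linarith [hu.2], by linarith⟩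
      rw [this]
      congr 1
      ring
    · simp only [pathInf, h, if_false] at heq ⊢
      have := isProfile_inf.follow_lower hγ hL heq (x₁ := (n / 2 : ℤ))
        (fun x hx => profileInf_pos (j := n / 2) ⟨hx.1, by linarith [hx.2, hu.1]⟩)
        (Or.inl (profileInf_pos (j := n / 2) ⟨by linarith [hu.2], by linarith [hu.1]⟩))
        (1 - u) ⟨by linarith [hu.2], by linarith⟩
      rw [this]
      congr 1
      ring
  branch γ hγ hL t ht := by
    rw [LambdaInf_eq] at hL
    obtain ⟨h1, j, hj⟩ := ht
    obtain ⟨ε, hε, H | H⟩ := isProfile_inf.right_step hγ hL t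
    · refine ⟨2 * j, mem_univ _, fun u hu => ?_⟩
      rw [hj] at H
      have := isProfile_inf.follow_upper hγ hL (x₀ := j) (x₁ := j + 1)
        (plane_ext (by simp [hj]) (by simp [h1, profileInf_intCast]))
        (fun x hx => profileInf_pos hx) (Or.inr ⟨ε, hε, H⟩) u (by simpa using hu)
      simpa [pathInf] using this
    · refine ⟨2 * (j - 1) + 1, mem_univ _, fun u hu => ?_⟩
      rw [hj] at H
      have := isProfile_inf.follow_lower hγ hL (x₀ := j) (x₁ := j - 1)
        (plane_ext (by simp [hj]) (by simp [h1, profileInf_intCast]))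
        (fun x hx => profileInf_pos (j := j - 1) (by push_cast; simpa using hx))
        (Or.inr ⟨ε, hε, H⟩) u (by simpa using hu)
      have hodd : ¬ Even (2 * (j - 1) + 1) := by simp
      simp only [pathInf, hodd, if_false]
      rw [this, show (2 * (j - 1) + 1) / 2 = j - 1 by omega]
      push_cast
      congr 1
      ring
  isArc n _ := by
    by_cases h : Even n
    · have := fun a b => isProfile_inf.isArc_upper (x₀ := (n / 2 : ℤ)) (a := a) (b := b)
        fun t _ => profileInf_nonneg _
      rw [pathInf_of_even h]
      exact ⟨this _ _, this _ _⟩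
    · have := fun a b => isProfile_inf.isArc_lower (x₀ := (n / 2 : ℤ) + 1) (a := a) (b := b)
        fun t _ => profileInf_nonneg _
      simp only [add_sub_assoc] at this
      rw [pathInf_of_not_even h]
      exact ⟨this _ _, this _ _⟩
  hausdorff := ⟨1 / 3, by norm_num, 4, by norm_num, fun n _ m _ => pathInf_hausdorff n m⟩

lemma admissible_inf : ArcSystem.admissible univ pathInf = admissibleInf := by
  have key : ∀ n m : ℤ, pathInf n 1 = pathInf m 0 ↔
      (Even n ∧ (m = n + 1 ∨ m = n + 2)) ∨ (Odd n ∧ (m = n - 1 ∨ m = n - 2)) := fun n m => by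
    rw [pathInf_end, pathInf_start, ← Int.not_even_iff_odd]
    have : ∀ i j : ℤ, (!₂[(i : ℝ), 0] : Plane) = !₂[(j : ℝ), 0] ↔ i = j := fun i j => by
      constructor
      · intro h
        have := congrArg (fun q : Plane => q 0) h
        simpa using this
      · rintro rfl
        rfl
    rw [this]
    by_cases hn : Even n <;> by_cases hm : Even m <;> simp only [hn, hm, if_true, if_false] <;>
      rw [Int.even_iff] at hn hm <;> simp <;> omega
  ext a
  simp only [ArcSystem.admissible, admissibleInf, mem_univ, true_and, key, mem_ofPred_eq]

lemma abs_sub_le_of_mem_ThetaInf {a : ℤ → ℤ} (ha : a ∈ ThetaInf) (j : ℤ) :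
    |a j - a 0| ≤ 2 * j.natAbs := by
  induction j using Int.induction_on with
  | zero => simp
  | succ j ih =>
    have h1 := ha j
    have h2 := abs_sub_le (a (j + 1)) (a j) (a 0)
    omega
  | pred j ih =>
    have h1 := ha (-j - 1)
    rw [sub_add_cancel, abs_sub_comm] at h1
    have h2 := abs_sub_le (a (-j - 1)) (a (-j)) (a 0)
    omega

lemma summable_seqTerm_ThetaInf {a b : ℤ → ℤ} (ha : a ∈ ThetaInf) (hb : b ∈ ThetaInf) :
    Summable (seqTerm a b) := by
  refine summable_div_two_pow_of_le (f := fun j => dist (a j) (b j)) (dist (a 0) (b 0) + 4)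
    (fun j => dist_nonneg) fun j => ?_
  have h1 : dist (a j) (a 0) ≤ 2 * j.natAbs := by
    have := abs_sub_le_of_mem_ThetaInf ha j
    rw [Int.dist_eq, ← Int.cast_natCast]
    exact_mod_cast this
  have h2 : dist (b j) (b 0) ≤ 2 * j.natAbs := by
    have := abs_sub_le_of_mem_ThetaInf hb j
    rw [Int.dist_eq, ← Int.cast_natCast]
    exact_mod_cast this
  have h3 := dist_triangle4 (a j) (a 0) (b 0) (b j)
  rw [dist_comm (b 0)] at h3
  have h4 : (0 : ℝ) ≤ dist (a 0) (b 0) * j.natAbs := by positivity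
  nlinarith

lemma admissibleInf_subset : admissibleInf ⊆ ThetaInf := by
  intro a ha j
  rw [abs_le]
  rcases ha j with ⟨-, h | h⟩ | ⟨-, h | h⟩ <;> constructor <;> omega

lemma Int.eq_of_dist_lt_one {m n : ℤ} (h : dist m n < 1) : m = n := by
  rw [Int.dist_eq] at h
  have : |m - n| < 1 := by exact_mod_cast h
  have := Int.abs_lt_one_iff.1 this
  omega

lemma isSubshift_inf : IsSubshift ThetaInf admissibleInf := by
  refine ⟨admissibleInf_subset, ?_, ?_⟩
  · refine isClosed_of_coordinates (fun a ha b hb => summable_seqTerm_ThetaInf ha hb)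
      fun a _ haS => ?_
    simp only [admissibleInf, mem_ofPred_eq, not_forall] at haS
    obtain ⟨j, hj⟩ := haS
    refine ⟨j, 1, one_pos, fun b _ h1 h2 hb => hj ?_⟩
    rw [Int.eq_of_dist_lt_one h1, Int.eq_of_dist_lt_one h2]
    exact hb j
  · rw [← admissible_inf]
    exact ArcSystem.shift_admissible

theorem timeOneConjugacy_inf :
    TimeOneConjugacy (planeField 1 fun x => 2 * Real.sin (2 * Real.pi * x))
      (planeField (-1) fun x => 2 * Real.sin (2 * Real.pi * x))
      LambdaInf foldsInf arcInf admissibleInf := by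
  have := arcSystem_inf.timeOneConjugacy
  rw [admissible_inf] at this
  exact this fun a ha b hb =>
    summable_seqTerm_ThetaInf (admissibleInf_subset ha) (admissibleInf_subset hb)

/-! ### The profiles `P_k` -/

lemma polyP_prod_pos {k : ℕ} {x : ℝ} (h : ∀ j : ℤ, 1 ≤ j → j ≤ (k : ℤ) - 1 → x ≠ foldX k j) :
    0 < ∏ i ∈ Finset.Icc 1 (k - 1), (x - ((i : ℝ) - (k : ℝ) / 2)) ^ 2 := by
  refine Finset.prod_pos fun i hi => ?_
  rw [Finset.mem_Icc] at hi
  have := h i (by omega) (by omega)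
  simp only [foldX, Int.cast_natCast] at this
  have : x - ((i : ℝ) - k / 2) ≠ 0 := sub_ne_zero.2 this
  positivity

lemma polyP_nonneg {k : ℕ} {x : ℝ} (hx : x ∈ Icc ((1 - (k : ℝ)) / 2) (((k : ℝ) - 1) / 2)) :
    0 ≤ polyP k x := by
  refine mul_nonneg ?_ (Finset.prod_nonneg fun i _ => sq_nonneg _)
  nlinarith [mul_nonneg (sub_nonneg.2 hx.1) (sub_nonneg.2 hx.2)]

lemma polyP_pos {k : ℕ} {j : ℤ} {x : ℝ} (hj : x ∈ Ioo (foldX k j) (foldX k (j + 1)))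
    (hx : x ∈ Ioo ((1 - (k : ℝ)) / 2) (((k : ℝ) - 1) / 2)) : 0 < polyP k x := by
  refine mul_pos ?_ (polyP_prod_pos fun i _ _ hi => ?_)
  · nlinarith [mul_pos (sub_pos.2 hx.1) (sub_pos.2 hx.2)]
  · simp only [hi, foldX, mem_Ioo, sub_lt_sub_iff_right, Int.cast_lt] at hj
    omega

lemma polyP_neg {k : ℕ} (hk : 1 ≤ k) {x : ℝ} (hx : x < (1 - (k : ℝ)) / 2 ∨ ((k : ℝ) - 1) / 2 < x) :
    polyP k x < 0 := by
  have hk' : (1 : ℝ) ≤ k := by exact_mod_cast hk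
  refine mul_neg_of_neg_of_pos ?_ (polyP_prod_pos fun i hi hi' h => ?_)
  · rcases hx with hx | hx <;> nlinarith
  · have h1 : (1 : ℝ) ≤ i := by exact_mod_cast hi
    have h2 : (i : ℝ) ≤ k - 1 := by exact_mod_cast hi'
    rw [foldX] at h
    rcases hx with hx | hx <;> linarith

lemma polyP_foldX {k : ℕ} {j : ℤ} (h1 : 1 ≤ j) (h2 : j ≤ (k : ℤ) - 1) :
    polyP k (foldX k j) = 0 := by
  refine mul_eq_zero_of_right _
    (Finset.prod_eq_zero (i := j.toNat) (Finset.mem_Icc.2 ⟨by omega, by omega⟩) ?_)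
  have : ((j.toNat : ℤ) : ℝ) = j := by rw [Int.toNat_of_nonneg (by omega)]
  rw [Int.cast_natCast] at this
  simp [foldX, this]

lemma polyP_right (k : ℕ) : polyP k (((k : ℝ) - 1) / 2) = 0 := by
  simp [polyP]

lemma polyP_left (k : ℕ) : polyP k ((1 - (k : ℝ)) / 2) = 0 := by
  have : (1 - (k : ℝ)) / 2 + ((k : ℝ) - 1) / 2 = 0 := by ring
  simp [polyP, this]

lemma contDiff_polyP (k : ℕ) : ContDiff ℝ (⊤ : ℕ∞) (polyP k) := by
  unfold polyP
  fun_prop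

lemma isProfile_polyP {k : ℕ} (hk : 2 ≤ k) : IsProfile (polyP k) (deriv (polyP k)) where
  hasDerivAt x := ((contDiff_polyP k).differentiable (by simp) x).hasDerivAt
  differentiable := ((contDiff_polyP k).iterate_deriv 1).differentiable (by simp)
  exists_pos x hx ε hε := by
    have hk' : (2 : ℝ) ≤ k := by exact_mod_cast hk
    have hx1 : (1 - (k : ℝ)) / 2 ≤ x := by
      by_contra h
      exact (polyP_neg (by omega) (Or.inl (not_le.1 h))).ne hx
    have hx2 : x ≤ ((k : ℝ) - 1) / 2 := by
      by_contra h
      exact (polyP_neg (by omega) (Or.inr (not_le.1 h))).ne hx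
    have hm := min_le_left ε (1 / 2)
    have hm' := min_le_right ε (1 / 2)
    have hm0 : 0 < min ε (1 / 2) := lt_min hε (by norm_num)
    rcases hx2.lt_or_eq with hlt | rfl
    · have hf1 := Int.floor_le (x + k / 2)
      have hf2 := Int.lt_floor_add_one (x + k / 2)
      set j := ⌊x + k / 2⌋
      have hδ : 0 < min (min ε (((k : ℝ) - 1) / 2 - x)) (foldX k (j + 1) - x) := by
        refine lt_min (lt_min hε (by linarith)) ?_
        simp only [foldX]
        push_cast
        linarith
      set δ := min (min ε (((k : ℝ) - 1) / 2 - x)) (foldX k (j + 1) - x) with hδdef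
      have h1 : δ ≤ ε := (min_le_left _ _).trans (min_le_left _ _)
      have h2 : δ ≤ ((k : ℝ) - 1) / 2 - x := (min_le_left _ _).trans (min_le_right _ _)
      have h3 : δ ≤ foldX k (j + 1) - x := min_le_right _ _
      refine ⟨x + δ / 2, ?_, polyP_pos (j := j) ⟨?_, by linarith⟩ ⟨by linarith, by linarith⟩⟩
      · rw [add_sub_cancel_left, abs_of_pos (by linarith)]
        linarith
      · simp only [foldX]
        linarith
    · refine ⟨((k : ℝ) - 1) / 2 - min ε (1 / 2) / 2, ?_,
        polyP_pos (j := (k : ℤ) - 1) ⟨?_, ?_⟩ ⟨?_, ?_⟩⟩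
      · rw [sub_sub_cancel_left, abs_neg, abs_of_pos (by linarith)]
        linarith
      all_goals first | linarith | (simp only [foldX]; push_cast; linarith)

lemma LambdaK_eq {k : ℕ} (hk : 1 ≤ k) : LambdaK k = zeroLevel (polyP k) := by
  ext q
  rw [mem_zeroLevel]
  constructor
  · exact fun h => ⟨polyP_nonneg h.1, h.2⟩
  · rintro ⟨h0, h⟩
    refine ⟨⟨?_, ?_⟩, h⟩
    · by_contra hlt
      exact absurd h0 (not_le.2 (polyP_neg hk (Or.inl (not_le.1 hlt))))
    · by_contra hlt
      exact absurd h0 (not_le.2 (polyP_neg hk (Or.inr (not_le.1 hlt))))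

lemma isCompact_LambdaK {k : ℕ} (hk : 2 ≤ k) : IsCompact (LambdaK k) := by
  have h1 := (isProfile_polyP hk).continuous_graphUp
  have h2 := (isProfile_polyP hk).continuous_graphDown
  have hc : IsCompact (Icc ((1 - (k : ℝ)) / 2) (((k : ℝ) - 1) / 2)) := isCompact_Icc
  convert (hc.image h1).union (hc.image h2) using 1
  ext q
  constructor
  · rintro ⟨hq, h | h⟩
    · exact Or.inl ⟨q 0, hq, plane_ext (by simp) (by simp [h])⟩
    · exact Or.inr ⟨q 0, hq, plane_ext (by simp) (by simp [h])⟩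
  · rintro (⟨x, hx, rfl⟩ | ⟨x, hx, rfl⟩)
    · exact ⟨by simpa using hx, by simp⟩
    · exact ⟨by simpa using hx, by simp⟩

/-! ### The arcs of `Λ_k` -/

/-- The parametrization of `I_n` by unit time. The two loops pass through the ends of `Λ_k` at time
`1/2`. -/
def pathK (k : ℕ) (n : ℤ) : ℝ → Plane :=
  if n = 0 then fun u => if u ≤ 1 / 2 then graphDown (polyP k) (foldX k 1 - u)
    else graphUp (polyP k) (foldX k 1 - 1 + u)
  else if n = 2 * (k : ℤ) - 3 then
    fun u => if u ≤ 1 / 2 then graphUp (polyP k) (foldX k ((k : ℤ) - 1) + u)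
      else graphDown (polyP k) (foldX k ((k : ℤ) - 1) + 1 - u)
  else if Even n then fun u => graphDown (polyP k) (foldX k (n / 2 + 1) - u)
  else fun u => graphUp (polyP k) (foldX k ((n + 1) / 2) + u)

section

variable {k : ℕ}

lemma pathK_left : pathK k 0 = fun u => if u ≤ 1 / 2 then graphDown (polyP k) (foldX k 1 - u)
    else graphUp (polyP k) (foldX k 1 - 1 + u) := by
  simp [pathK]

lemma pathK_right : pathK k (2 * (k : ℤ) - 3) = fun u =>
    if u ≤ 1 / 2 then graphUp (polyP k) (foldX k ((k : ℤ) - 1) + u)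
      else graphDown (polyP k) (foldX k ((k : ℤ) - 1) + 1 - u) := by
  have : 2 * (k : ℤ) - 3 ≠ 0 := by omega
  rw [pathK, if_neg this, if_pos rfl]

lemma pathK_up {j : ℤ} (h2 : j ≤ (k : ℤ) - 2) :
    pathK k (2 * j - 1) = fun u => graphUp (polyP k) (foldX k j + u) := by
  have h3 : ¬ Even (2 * j - 1) := by rw [Int.even_iff]; omega
  rw [pathK, if_neg (by omega), if_neg (by omega), if_neg h3,
    show (2 * j - 1 + 1) / 2 = j by omega]

lemma pathK_down {j : ℤ} (h1 : 1 ≤ j) :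
    pathK k (2 * j) = fun u => graphDown (polyP k) (foldX k (j + 1) - u) := by
  rw [pathK, if_neg (by omega), if_neg (by omega), if_pos (even_two_mul j),
    show 2 * j / 2 = j by omega]

/-- The labels of the loops, of the upper arcs, and of the lower arcs. -/
lemma label_cases {n : ℤ} (hn : n ∈ Ico 0 (2 * ((k : ℤ) - 1))) :
    n = 0 ∨ n = 2 * (k : ℤ) - 3 ∨ (∃ j, 1 ≤ j ∧ j ≤ (k : ℤ) - 2 ∧ n = 2 * j - 1) ∨
      ∃ j, 1 ≤ j ∧ j ≤ (k : ℤ) - 2 ∧ n = 2 * j := by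
  obtain ⟨h1, h2⟩ := hn
  by_cases h3 : n = 0
  · exact Or.inl h3
  by_cases h4 : n = 2 * (k : ℤ) - 3
  · exact Or.inr (Or.inl h4)
  rcases Int.emod_two_eq_zero_or_one n with h | h
  · exact Or.inr (Or.inr (Or.inr ⟨n / 2, by omega, by omega, by omega⟩))
  · exact Or.inr (Or.inr (Or.inl ⟨(n + 1) / 2, by omega, by omega, by omega⟩))

lemma foldX_add_one (j : ℤ) : foldX k (j + 1) = foldX k j + 1 := by
  simp only [foldX]
  push_cast
  ring

lemma foldX_lt_foldX {i j : ℤ} : foldX k i < foldX k j ↔ i < j := by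
  simp [foldX]

lemma foldX_le_foldX {i j : ℤ} : foldX k i ≤ foldX k j ↔ i ≤ j := by
  simp [foldX]

lemma left_end_eq : (1 - (k : ℝ)) / 2 = foldX k 1 - 1 / 2 := by
  simp only [foldX]
  push_cast
  ring

lemma right_end_eq : ((k : ℝ) - 1) / 2 = foldX k ((k : ℤ) - 1) + 1 / 2 := by
  simp only [foldX]
  push_cast
  ring

lemma polyP_pos_left (hk : 2 ≤ k) {x : ℝ} (hx : x ∈ Ioo (foldX k 1 - 1 / 2) (foldX k 1)) :
    0 < polyP k x := by
  have h0 := foldX_add_one (k := k) 0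
  have h1 : foldX k 1 ≤ foldX k ((k : ℤ) - 1) := foldX_le_foldX.2 (by omega)
  rw [zero_add] at h0
  refine polyP_pos (j := 0) ⟨by linarith [hx.1], by simpa using hx.2⟩ ?_
  rw [left_end_eq, right_end_eq]
  exact ⟨hx.1, by linarith [hx.2]⟩

lemma polyP_pos_right (hk : 2 ≤ k) {x : ℝ}
    (hx : x ∈ Ioo (foldX k ((k : ℤ) - 1)) (foldX k ((k : ℤ) - 1) + 1 / 2)) :
    0 < polyP k x := by
  have h1 : foldX k 1 ≤ foldX k ((k : ℤ) - 1) := foldX_le_foldX.2 (by omega)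
  refine polyP_pos (j := (k : ℤ) - 1) ⟨hx.1, by rw [foldX_add_one]; linarith [hx.2]⟩ ?_
  rw [left_end_eq, right_end_eq]
  exact ⟨by linarith [hx.1], hx.2⟩

lemma polyP_pos_middle {j : ℤ} (h1 : 1 ≤ j) (h2 : j ≤ (k : ℤ) - 2) {x : ℝ}
    (hx : x ∈ Ioo (foldX k j) (foldX k (j + 1))) : 0 < polyP k x := by
  have h3 : foldX k 1 ≤ foldX k j := foldX_le_foldX.2 h1
  have h4 : foldX k (j + 1) ≤ foldX k ((k : ℤ) - 1) := foldX_le_foldX.2 (by omega)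
  refine polyP_pos hx ?_
  rw [left_end_eq, right_end_eq]
  exact ⟨by linarith [hx.1], by linarith [hx.2]⟩

lemma graphUp_foldX {j : ℤ} (h1 : 1 ≤ j) (h2 : j ≤ (k : ℤ) - 1) :
    graphUp (polyP k) (foldX k j) = !₂[foldX k j, 0] := by
  simp [graphUp, polyP_foldX h1 h2]

lemma graphDown_foldX {j : ℤ} (h1 : 1 ≤ j) (h2 : j ≤ (k : ℤ) - 1) :
    graphDown (polyP k) (foldX k j) = !₂[foldX k j, 0] := by
  simp [graphDown, polyP_foldX h1 h2]

lemma pathK_left_start (hk : 2 ≤ k) : pathK k 0 0 = !₂[foldX k 1, 0] := by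
  simp [pathK_left, graphDown_foldX (k := k) (j := 1) le_rfl (by omega)]

lemma pathK_left_end (hk : 2 ≤ k) : pathK k 0 1 = !₂[foldX k 1, 0] := by
  have : ¬ (1 : ℝ) ≤ 1 / 2 := by norm_num
  simp only [pathK_left, this, if_false, sub_add_cancel]
  exact graphUp_foldX (k := k) (j := 1) le_rfl (by omega)

lemma pathK_right_start (hk : 2 ≤ k) :
    pathK k (2 * (k : ℤ) - 3) 0 = !₂[foldX k ((k : ℤ) - 1), 0] := by
  simp [pathK_right, graphUp_foldX (k := k) (j := (k : ℤ) - 1) (by omega) le_rfl]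

lemma pathK_right_end (hk : 2 ≤ k) :
    pathK k (2 * (k : ℤ) - 3) 1 = !₂[foldX k ((k : ℤ) - 1), 0] := by
  have : ¬ (1 : ℝ) ≤ 1 / 2 := by norm_num
  simp only [pathK_right, this, if_false, add_sub_cancel_right]
  exact graphDown_foldX (k := k) (j := (k : ℤ) - 1) (by omega) le_rfl

lemma pathK_up_start {j : ℤ} (h1 : 1 ≤ j) (h2 : j ≤ (k : ℤ) - 2) :
    pathK k (2 * j - 1) 0 = !₂[foldX k j, 0] := by
  simp only [pathK_up h2, add_zero]
  exact graphUp_foldX h1 (by omega)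

lemma pathK_up_end {j : ℤ} (h1 : 1 ≤ j) (h2 : j ≤ (k : ℤ) - 2) :
    pathK k (2 * j - 1) 1 = !₂[foldX k (j + 1), 0] := by
  simp only [pathK_up h2, ← foldX_add_one]
  exact graphUp_foldX (by omega) (by omega)

lemma pathK_down_start {j : ℤ} (h1 : 1 ≤ j) (h2 : j ≤ (k : ℤ) - 2) :
    pathK k (2 * j) 0 = !₂[foldX k (j + 1), 0] := by
  simp only [pathK_down h1, sub_zero]
  exact graphDown_foldX (by omega) (by omega)

lemma pathK_down_end {j : ℤ} (h1 : 1 ≤ j) (h2 : j ≤ (k : ℤ) - 2) :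
    pathK k (2 * j) 1 = !₂[foldX k j, 0] := by
  simp only [pathK_down h1, foldX_add_one, add_sub_cancel_right]
  exact graphDown_foldX h1 (by omega)

lemma mem_foldsK {j : ℤ} (h1 : 1 ≤ j) (h2 : j ≤ (k : ℤ) - 1) :
    (!₂[foldX k j, 0] : Plane) ∈ foldsK k :=
  ⟨by simp, j, h1, h2, by simp⟩

lemma pathK_start_mem (hk : 2 ≤ k) {n : ℤ} (hn : n ∈ Ico 0 (2 * ((k : ℤ) - 1))) :
    pathK k n 0 ∈ foldsK k := by
  rcases label_cases hn with rfl | rfl | ⟨j, h1, h2, rfl⟩ | ⟨j, h1, h2, rfl⟩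
  · rw [pathK_left_start hk]
    exact mem_foldsK le_rfl (by omega)
  · rw [pathK_right_start hk]
    exact mem_foldsK (by omega) le_rfl
  · rw [pathK_up_start h1 h2]
    exact mem_foldsK h1 (by omega)
  · rw [pathK_down_start h1 h2]
    exact mem_foldsK (by omega) (by omega)

lemma pathK_end_mem (hk : 2 ≤ k) {n : ℤ} (hn : n ∈ Ico 0 (2 * ((k : ℤ) - 1))) :
    pathK k n 1 ∈ foldsK k := by
  rcases label_cases hn with rfl | rfl | ⟨j, h1, h2, rfl⟩ | ⟨j, h1, h2, rfl⟩
  · rw [pathK_left_end hk]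
    exact mem_foldsK le_rfl (by omega)
  · rw [pathK_right_end hk]
    exact mem_foldsK (by omega) le_rfl
  · rw [pathK_up_end h1 h2]
    exact mem_foldsK (by omega) (by omega)
  · rw [pathK_down_end h1 h2]
    exact mem_foldsK h1 (by omega)

lemma pathK_mem_arcK {n : ℤ} (hn : n ∈ Ico 0 (2 * ((k : ℤ) - 1))) {u : ℝ}
    (hu : u ∈ Ioo (0 : ℝ) 1) : pathK k n u ∈ arcK k n := by
  rcases label_cases hn with rfl | rfl | ⟨j, h1, h2, rfl⟩ | ⟨j, h1, h2, rfl⟩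
  · refine Or.inl ⟨rfl, ?_⟩
    rw [left_end_eq]
    by_cases h : u ≤ 1 / 2
    · simp only [pathK_left, h, if_true, graphDown_zero, graphDown_one]
      exact ⟨⟨by linarith, by linarith [hu.1]⟩, by simp⟩
    · simp only [pathK_left, h, if_false, graphUp_zero, graphUp_one]
      exact ⟨⟨by linarith, by linarith [hu.2]⟩, by simp⟩
  · refine Or.inr (Or.inr (Or.inr ⟨rfl, ?_⟩))
    rw [right_end_eq]
    by_cases h : u ≤ 1 / 2
    · simp only [pathK_right, h, if_true, graphUp_zero, graphUp_one]
      exact ⟨⟨by linarith [hu.1], by linarith⟩, by simp⟩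
    · simp only [pathK_right, h, if_false, graphDown_zero, graphDown_one]
      exact ⟨⟨by linarith [hu.2], by linarith⟩, by simp⟩
  · refine Or.inr (Or.inl ⟨j, h1, h2, rfl, ?_⟩)
    simp only [pathK_up h2, graphUp_zero, graphUp_one, foldX_add_one]
    exact ⟨⟨by linarith [hu.1], by linarith [hu.2]⟩, trivial⟩
  · refine Or.inr (Or.inr (Or.inl ⟨j, h1, h2, rfl, ?_⟩))
    simp only [pathK_down h1, graphDown_zero, graphDown_one, foldX_add_one]
    exact ⟨⟨by linarith [hu.2], by linarith [hu.1]⟩, trivial⟩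

lemma graphUp_eq_graphDown {P : ℝ → ℝ} {x : ℝ} (h : P x = 0) : graphUp P x = graphDown P x := by
  simp only [graphUp, graphDown, h, neg_zero]

lemma exists_pathK_eq (hk : 2 ≤ k) {n : ℤ} {q : Plane} (hq : q ∈ arcK k n) :
    n ∈ Ico 0 (2 * ((k : ℤ) - 1)) ∧ ∃ u ∈ Ioo (0 : ℝ) 1, pathK k n u = q := by
  rcases hq with ⟨rfl, hq, h⟩ | ⟨j, h1, h2, rfl, hq, h⟩ | ⟨j, h1, h2, rfl, hq, h⟩ | ⟨rfl, hq, h⟩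
  · refine ⟨⟨le_rfl, by omega⟩, ?_⟩
    rw [left_end_eq] at hq
    simp only [pathK_left]
    rcases hq.1.eq_or_lt with h0 | h0
    · refine ⟨1 / 2, by norm_num, ?_⟩
      have hP : polyP k (q 0) = 0 := by rw [← h0, ← left_end_eq, polyP_left]
      have h' : q 1 = 0 := by simpa [hP] using h
      rw [if_pos le_rfl, h0]
      exact plane_ext (by simp) (by simp [hP, h'])
    · rcases h with h | h
      · refine ⟨q 0 - foldX k 1 + 1, ⟨by linarith, by linarith [hq.2]⟩, ?_⟩
        rw [if_neg (by linarith), show foldX k 1 - 1 + (q 0 - foldX k 1 + 1) = q 0 by ring]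
        exact plane_ext (by simp) (by simp [h])
      · refine ⟨foldX k 1 - q 0, ⟨by linarith [hq.2], by linarith⟩, ?_⟩
        rw [if_pos (by linarith), sub_sub_cancel]
        exact plane_ext (by simp) (by simp [h])
  · refine ⟨⟨by omega, by omega⟩, q 0 - foldX k j, ⟨by linarith [hq.1], ?_⟩, ?_⟩
    · rw [foldX_add_one] at hq
      linarith [hq.2]
    · simp only [pathK_up h2, add_sub_cancel]
      exact plane_ext (by simp) (by simp [h])
  · refine ⟨⟨by omega, by omega⟩, foldX k (j + 1) - q 0, ⟨by linarith [hq.2], ?_⟩, ?_⟩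
    · rw [foldX_add_one] at hq ⊢
      linarith [hq.1]
    · simp only [pathK_down h1, sub_sub_cancel]
      exact plane_ext (by simp) (by simp [h])
  · refine ⟨⟨by omega, by omega⟩, ?_⟩
    rw [right_end_eq] at hq
    simp only [pathK_right]
    rcases hq.2.eq_or_lt with h0 | h0
    · refine ⟨1 / 2, by norm_num, ?_⟩
      have hP : polyP k (q 0) = 0 := by rw [h0, ← right_end_eq, polyP_right]
      have h' : q 1 = 0 := by simpa [hP] using h
      rw [if_pos le_rfl, ← h0]
      exact plane_ext (by simp) (by simp [hP, h'])
    · rcases h with h | h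
      · refine ⟨q 0 - foldX k ((k : ℤ) - 1), ⟨by linarith [hq.1], by linarith⟩, ?_⟩
        rw [if_pos (by linarith), add_sub_cancel]
        exact plane_ext (by simp) (by simp [h])
      · refine ⟨foldX k ((k : ℤ) - 1) + 1 - q 0, ⟨by linarith, by linarith [hq.1]⟩, ?_⟩
        rw [if_neg (by linarith), sub_sub_cancel]
        exact plane_ext (by simp) (by simp [h])

/-- The label of an open arc is determined by the unit interval between the `p_j` that contains the
first coordinate and, except on the loops, by the sign of the second coordinate. -/
lemma label_of_mem_arcK (hk : 2 ≤ k) {n : ℤ} {q : Plane} (hq : q ∈ arcK k n) :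
    ∃ j : ℤ, foldX k j ≤ q 0 ∧ q 0 < foldX k (j + 1) ∧ (1 ≤ j → foldX k j < q 0) ∧
      ((j = 0 ∧ n = 0) ∨ (1 ≤ j ∧ j = (k : ℤ) - 1 ∧ n = 2 * (k : ℤ) - 3) ∨
        (1 ≤ j ∧ j ≤ (k : ℤ) - 2 ∧ n = 2 * j - 1 ∧ 0 < q 1) ∨
        (1 ≤ j ∧ j ≤ (k : ℤ) - 2 ∧ n = 2 * j ∧ q 1 < 0)) := by
  rcases hq with ⟨rfl, hq, h⟩ | ⟨j, h1, h2, rfl, hq, h⟩ | ⟨j, h1, h2, rfl, hq, h⟩ | ⟨rfl, hq, h⟩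
  · have h0 := foldX_add_one (k := k) 0
    rw [zero_add] at h0
    rw [left_end_eq] at hq
    exact ⟨0, by linarith [hq.1], by simpa using hq.2, by omega, Or.inl ⟨rfl, rfl⟩⟩
  · refine ⟨j, hq.1.le, hq.2, fun _ => hq.1, Or.inr (Or.inr (Or.inl ⟨h1, h2, rfl, ?_⟩))⟩
    rw [h]
    exact polyP_pos_middle h1 h2 hq
  · refine ⟨j, hq.1.le, hq.2, fun _ => hq.1, Or.inr (Or.inr (Or.inr ⟨h1, h2, rfl, ?_⟩))⟩
    rw [h, neg_lt_zero]
    exact polyP_pos_middle h1 h2 hq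
  · rw [right_end_eq] at hq
    refine ⟨(k : ℤ) - 1, hq.1.le, ?_, fun _ => hq.1, Or.inr (Or.inl ⟨by omega, rfl, rfl⟩)⟩
    rw [foldX_add_one]
    linarith [hq.2]

lemma arcK_disjoint (hk : 2 ≤ k) {n m : ℤ} (hnm : n ≠ m) : Disjoint (arcK k n) (arcK k m) := by
  rw [Set.disjoint_left]
  intro q hn hm
  obtain ⟨i, hi1, hi2, -, hi⟩ := label_of_mem_arcK hk hn
  obtain ⟨j, hj1, hj2, -, hj⟩ := label_of_mem_arcK hk hm
  have h1 := foldX_lt_foldX.1 (hi1.trans_lt hj2)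
  have h2 := foldX_lt_foldX.1 (hj1.trans_lt hi2)
  obtain rfl : i = j := by omega
  rcases hi with hi | hi | hi | hi <;> rcases hj with hj | hj | hj | hj <;>
    first | omega | exact lt_asymm hi.2.2.2 hj.2.2.2

lemma arcK_disjoint_foldsK (hk : 2 ≤ k) (n : ℤ) : Disjoint (arcK k n) (foldsK k) := by
  rw [Set.disjoint_left]
  rintro q hq ⟨-, i, hi1, hi2, hi⟩
  obtain ⟨j, hj1, hj2, hj3, -⟩ := label_of_mem_arcK hk hq
  rw [hi] at hj1 hj2 hj3
  have h1 := foldX_le_foldX.1 hj1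
  have h2 := foldX_lt_foldX.1 hj2
  have h3 := foldX_lt_foldX.1 (hj3 (by omega))
  omega

lemma LambdaK_subset : LambdaK k ⊆ foldsK k ∪ ⋃ n, arcK k n := by
  rintro q ⟨hq, h⟩
  have hf1 := Int.floor_le (q 0 + k / 2)
  have hf2 := Int.lt_floor_add_one (q 0 + k / 2)
  set j := ⌊q 0 + k / 2⌋ with hj
  have hj0 : 0 ≤ j := Int.floor_nonneg.2 (by linarith [hq.1])
  have hjk : j ≤ (k : ℤ) - 1 := by
    have : (j : ℝ) < (k : ℤ) := by
      push_cast
      linarith [hq.2]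
    have : j < k := by exact_mod_cast this
    omega
  have h1 : foldX k j ≤ q 0 := by
    rw [foldX]
    linarith
  have h2 : q 0 < foldX k (j + 1) := by
    rw [foldX]
    push_cast
    linarith
  rcases hj0.eq_or_lt with h0 | h0
  · rw [← h0, zero_add] at h2
    exact Or.inr (mem_iUnion.2 ⟨0, Or.inl ⟨rfl, ⟨hq.1, h2⟩, h⟩⟩)
  rcases h1.eq_or_lt with h3 | h3
  · refine Or.inl ⟨?_, j, h0, hjk, h3.symm⟩
    rw [← h3, polyP_foldX h0 hjk] at h
    simpa using h
  rcases hjk.eq_or_lt with h4 | h4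
  · rw [h4] at h3
    exact Or.inr (mem_iUnion.2 ⟨_, Or.inr (Or.inr (Or.inr ⟨rfl, ⟨h3, hq.2⟩, h⟩))⟩)
  · rcases h with h | h
    · exact Or.inr (mem_iUnion.2 ⟨_, Or.inr (Or.inl ⟨j, h0, by omega, rfl, ⟨h3, h2⟩, h⟩)⟩)
    · exact Or.inr (mem_iUnion.2
        ⟨_, Or.inr (Or.inr (Or.inl ⟨j, h0, by omega, rfl, ⟨h3, h2⟩, h⟩))⟩)

lemma foldsK_subset : foldsK k ⊆ LambdaK k := by
  rintro q ⟨h, j, h1, h2, hj⟩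
  refine ⟨?_, Or.inl (by rw [h, hj, polyP_foldX h1 h2])⟩
  have h3 : foldX k 1 ≤ foldX k j := foldX_le_foldX.2 h1
  have h4 : foldX k j ≤ foldX k ((k : ℤ) - 1) := foldX_le_foldX.2 h2
  rw [left_end_eq, right_end_eq, hj]
  exact ⟨by linarith, by linarith⟩

lemma arcK_subset (hk : 2 ≤ k) (n : ℤ) : arcK k n ⊆ LambdaK k := by
  have h5 : foldX k 1 ≤ foldX k ((k : ℤ) - 1) := foldX_le_foldX.2 (by omega)
  intro q hq
  rw [LambdaK, left_end_eq, right_end_eq]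
  rcases hq with ⟨rfl, hq, h⟩ | ⟨j, h1, h2, rfl, hq, h⟩ | ⟨j, h1, h2, rfl, hq, h⟩ | ⟨rfl, hq, h⟩
  · rw [left_end_eq] at hq
    exact ⟨⟨hq.1, by linarith [hq.2]⟩, h⟩
  · have h3 : foldX k 1 ≤ foldX k j := foldX_le_foldX.2 h1
    have h4 : foldX k (j + 1) ≤ foldX k ((k : ℤ) - 1) := foldX_le_foldX.2 (by omega)
    exact ⟨⟨by linarith [hq.1], by linarith [hq.2]⟩, Or.inl h⟩
  · have h3 : foldX k 1 ≤ foldX k j := foldX_le_foldX.2 h1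
    have h4 : foldX k (j + 1) ≤ foldX k ((k : ℤ) - 1) := foldX_le_foldX.2 (by omega)
    exact ⟨⟨by linarith [hq.1], by linarith [hq.2]⟩, Or.inr h⟩
  · rw [right_end_eq] at hq
    exact ⟨⟨by linarith [hq.1], hq.2⟩, h⟩

/-! ### The trajectories in `Λ_k` -/

/-- At the left end of `Λ_k`, trajectories turn from the lower to the upper graph. -/
lemma left_loop_second (hk : 2 ≤ k) {γ : ℝ → Plane}
    (hγ : IsGlobalTrajectory (planeField 1 (deriv (polyP k))) (planeField (-1) (deriv (polyP k))) γ)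
    (hL : ∀ t, γ t ∈ zeroLevel (polyP k)) {t : ℝ}
    (h0 : γ t = graphDown (polyP k) (foldX k 1 - 1 / 2)) :
    ∀ s ∈ Icc (0 : ℝ) (1 / 2), γ (t + s) = graphUp (polyP k) (foldX k 1 - 1 / 2 + s) := by
  have hP : polyP k (foldX k 1 - 1 / 2) = 0 := by rw [← left_end_eq, polyP_left]
  obtain ⟨ε, hε, H⟩ := (isProfile_polyP hk).turn_upper hγ hL (t := t)
    (x₀ := foldX k 1 - 1 / 2) (by simp [h0])
    fun x hx => polyP_neg (by omega) (Or.inl (by rwa [left_end_eq]))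
  have := (isProfile_polyP hk).follow_upper hγ hL (t := t) (x₀ := foldX k 1 - 1 / 2)
    (x₁ := foldX k 1) (h0.trans (graphUp_eq_graphDown hP).symm)
    (fun x hx => polyP_pos_left hk hx) (Or.inr ⟨ε, hε, H⟩)
  rwa [show foldX k 1 - (foldX k 1 - 1 / 2) = 1 / 2 by ring] at this

/-- At the right end of `Λ_k`, trajectories turn from the upper to the lower graph. -/
lemma right_loop_second (hk : 2 ≤ k) {γ : ℝ → Plane}
    (hγ : IsGlobalTrajectory (planeField 1 (deriv (polyP k))) (planeField (-1) (deriv (polyP k))) γ)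
    (hL : ∀ t, γ t ∈ zeroLevel (polyP k)) {t : ℝ}
    (h0 : γ t = graphUp (polyP k) (foldX k ((k : ℤ) - 1) + 1 / 2)) :
    ∀ s ∈ Icc (0 : ℝ) (1 / 2),
      γ (t + s) = graphDown (polyP k) (foldX k ((k : ℤ) - 1) + 1 / 2 - s) := by
  have hP : polyP k (foldX k ((k : ℤ) - 1) + 1 / 2) = 0 := by rw [← right_end_eq, polyP_right]
  obtain ⟨ε, hε, H⟩ := (isProfile_polyP hk).turn_lower hγ hL (t := t)
    (x₀ := foldX k ((k : ℤ) - 1) + 1 / 2) (by simp [h0])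
    fun x hx => polyP_neg (by omega) (Or.inr (by rwa [right_end_eq]))
  have := (isProfile_polyP hk).follow_lower hγ hL (t := t) (x₀ := foldX k ((k : ℤ) - 1) + 1 / 2)
    (x₁ := foldX k ((k : ℤ) - 1)) (h0.trans (graphUp_eq_graphDown hP))
    (fun x hx => polyP_pos_right hk hx) (Or.inr ⟨ε, hε, H⟩)
  rwa [add_sub_cancel_left] at this

/-- A trajectory inside an arc follows it to its end. -/
lemma pathK_follow (hk : 2 ≤ k) {γ : ℝ → Plane}
    (hγ : IsGlobalTrajectory (planeField 1 (deriv (polyP k))) (planeField (-1) (deriv (polyP k))) γ)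
    (hL : ∀ t, γ t ∈ zeroLevel (polyP k)) {t : ℝ} {n : ℤ}
    (hn : n ∈ Ico 0 (2 * ((k : ℤ) - 1))) {u : ℝ} (hu : u ∈ Ioo (0 : ℝ) 1)
    (h0 : γ t = pathK k n u) : γ (t + (1 - u)) = pathK k n 1 := by
  have hp := isProfile_polyP hk
  have h1' : ¬ (1 : ℝ) ≤ 1 / 2 := by norm_num
  rcases label_cases hn with rfl | rfl | ⟨j, h1, h2, rfl⟩ | ⟨j, h1, h2, rfl⟩
  · simp only [pathK_left, h1', if_false] at h0 ⊢
    rcases lt_trichotomy u (1 / 2) with h | h | h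
    · rw [if_pos h.le] at h0
      have h3 := hp.follow_lower hγ hL h0 (x₁ := foldX k 1 - 1 / 2)
        (fun x hx => polyP_pos_left hk ⟨hx.1, by linarith [hx.2, hu.1]⟩)
        (Or.inl (polyP_pos_left hk ⟨by linarith, by linarith [hu.1]⟩))
        (1 / 2 - u) ⟨by linarith, by linarith⟩
      rw [show foldX k 1 - u - (1 / 2 - u) = foldX k 1 - 1 / 2 by ring] at h3
      have h4 := left_loop_second hk hγ hL h3 (1 / 2) ⟨by norm_num, le_rfl⟩
      convert h4 using 2 <;> ring
    · rw [if_pos h.le, h] at h0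
      have h4 := left_loop_second hk hγ hL h0 (1 / 2) ⟨by norm_num, le_rfl⟩
      convert h4 using 2
      · rw [h]; ring
      · ring
    · rw [if_neg (not_le.2 h)] at h0
      have h3 := hp.follow_upper hγ hL h0 (x₁ := foldX k 1)
        (fun x hx => polyP_pos_left hk ⟨by linarith [hx.1], hx.2⟩)
        (Or.inl (polyP_pos_left hk ⟨by linarith, by linarith [hu.2]⟩))
        (1 - u) ⟨by linarith [hu.2], by linarith⟩
      rw [h3]
      congr 1
      ring
  · simp only [pathK_right, h1', if_false] at h0 ⊢
    rcases lt_trichotomy u (1 / 2) with h | h | h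
    · rw [if_pos h.le] at h0
      have h3 := hp.follow_upper hγ hL h0 (x₁ := foldX k ((k : ℤ) - 1) + 1 / 2)
        (fun x hx => polyP_pos_right hk ⟨by linarith [hx.1, hu.1], hx.2⟩)
        (Or.inl (polyP_pos_right hk ⟨by linarith [hu.1], by linarith⟩))
        (1 / 2 - u) ⟨by linarith, by linarith⟩
      rw [show foldX k ((k : ℤ) - 1) + u + (1 / 2 - u) = foldX k ((k : ℤ) - 1) + 1 / 2 by ring] at h3
      have h4 := right_loop_second hk hγ hL h3 (1 / 2) ⟨by norm_num, le_rfl⟩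
      convert h4 using 2 <;> ring
    · rw [if_pos h.le, h] at h0
      have h4 := right_loop_second hk hγ hL h0 (1 / 2) ⟨by norm_num, le_rfl⟩
      convert h4 using 2
      · rw [h]; ring
      · ring
    · rw [if_neg (not_le.2 h)] at h0
      have h3 := hp.follow_lower hγ hL h0 (x₁ := foldX k ((k : ℤ) - 1))
        (fun x hx => polyP_pos_right hk ⟨hx.1, by linarith [hx.2]⟩)
        (Or.inl (polyP_pos_right hk ⟨by linarith [hu.2], by linarith⟩))
        (1 - u) ⟨by linarith [hu.2], by linarith⟩
      rw [h3]
      congr 1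
      ring
  · simp only [pathK_up h2] at h0 ⊢
    have h3 := hp.follow_upper hγ hL h0 (x₁ := foldX k (j + 1))
      (fun x hx => polyP_pos_middle h1 h2 ⟨by linarith [hx.1, hu.1], hx.2⟩)
      (Or.inl (polyP_pos_middle h1 h2 ⟨by linarith [hu.1], by
        rw [foldX_add_one]; linarith [hu.2]⟩))
      (1 - u) ⟨by linarith [hu.2], by rw [foldX_add_one]; linarith⟩
    rw [h3]
    congr 1
    ring
  · simp only [pathK_down h1] at h0 ⊢
    have h3 := hp.follow_lower hγ hL h0 (x₁ := foldX k j)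
      (fun x hx => polyP_pos_middle h1 h2 ⟨hx.1, by linarith [hx.2, hu.1]⟩)
      (Or.inl (polyP_pos_middle h1 h2 ⟨by rw [foldX_add_one]; linarith [hu.2], by
        linarith [hu.1]⟩))
      (1 - u) ⟨by linarith [hu.2], by rw [foldX_add_one]; linarith⟩
    rw [h3]
    congr 1
    ring

/-- From each two-fold, a trajectory follows one of the arcs that start there. -/
lemma pathK_branch (hk : 2 ≤ k) {γ : ℝ → Plane}
    (hγ : IsGlobalTrajectory (planeField 1 (deriv (polyP k))) (planeField (-1) (deriv (polyP k))) γ)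
    (hL : ∀ t, γ t ∈ zeroLevel (polyP k)) {t : ℝ} (ht : γ t ∈ foldsK k) :
    ∃ n ∈ Ico 0 (2 * ((k : ℤ) - 1)), ∀ u ∈ Icc (0 : ℝ) 1, γ (t + u) = pathK k n u := by
  have hp := isProfile_polyP hk
  obtain ⟨hy, j, h1, h2, hj⟩ := ht
  have hup : γ t = graphUp (polyP k) (foldX k j) :=
    plane_ext (by simp [hj]) (by simp [hy, polyP_foldX h1 h2])
  have hdown : γ t = graphDown (polyP k) (foldX k j) :=
    plane_ext (by simp [hj]) (by simp [hy, polyP_foldX h1 h2])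
  obtain ⟨ε, hε, H⟩ := hp.right_step hγ hL t
  rw [hj] at H
  rcases H with H | H
  · rcases h2.eq_or_lt with rfl | h2
    · refine ⟨2 * (k : ℤ) - 3, ⟨by omega, by omega⟩, fun u hu => ?_⟩
      have h3 := hp.follow_upper hγ hL hup (x₁ := foldX k ((k : ℤ) - 1) + 1 / 2)
        (fun x hx => polyP_pos_right hk hx) (Or.inr ⟨ε, hε, H⟩)
      rw [add_sub_cancel_left] at h3
      simp only [pathK_right]
      by_cases h : u ≤ 1 / 2
      · rw [if_pos h]
        exact h3 u ⟨hu.1, h⟩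
      · rw [if_neg h]
        have h4 := right_loop_second hk hγ hL (h3 _ ⟨by norm_num, le_rfl⟩) (u - 1 / 2)
          ⟨by linarith, by linarith [hu.2]⟩
        convert h4 using 2 <;> ring
    · refine ⟨2 * j - 1, ⟨by omega, by omega⟩, fun u hu => ?_⟩
      have h3 := hp.follow_upper hγ hL hup (x₁ := foldX k (j + 1))
        (fun x hx => polyP_pos_middle h1 (by omega) hx) (Or.inr ⟨ε, hε, H⟩)
      rw [foldX_add_one, add_sub_cancel_left] at h3
      simp only [pathK_up (show j ≤ (k : ℤ) - 2 by omega)]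
      exact h3 u hu
  · rcases h1.eq_or_lt with rfl | h1
    · refine ⟨0, ⟨by omega, by omega⟩, fun u hu => ?_⟩
      have h3 := hp.follow_lower hγ hL hdown (x₁ := foldX k 1 - 1 / 2)
        (fun x hx => polyP_pos_left hk hx) (Or.inr ⟨ε, hε, H⟩)
      rw [sub_sub_cancel] at h3
      simp only [pathK_left]
      by_cases h : u ≤ 1 / 2
      · rw [if_pos h]
        exact h3 u ⟨hu.1, h⟩
      · rw [if_neg h]
        have h4 := left_loop_second hk hγ hL (h3 _ ⟨by norm_num, le_rfl⟩) (u - 1 / 2)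
          ⟨by linarith, by linarith [hu.2]⟩
        convert h4 using 2 <;> ring
    · refine ⟨2 * (j - 1), ⟨by omega, by omega⟩, fun u hu => ?_⟩
      have hj' : foldX k j = foldX k (j - 1) + 1 := by rw [← foldX_add_one, sub_add_cancel]
      have h3 := hp.follow_lower hγ hL hdown (x₁ := foldX k (j - 1))
        (fun x hx => polyP_pos_middle (j := j - 1) (by omega) (by omega)
          (by rwa [sub_add_cancel])) (Or.inr ⟨ε, hε, H⟩)
      rw [show foldX k j - foldX k (j - 1) = 1 by linarith] at h3
      simp only [pathK_down (show 1 ≤ j - 1 by omega), sub_add_cancel]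
      exact h3 u hu

lemma pathK_isArc (hk : 2 ≤ k) {n : ℤ} (hn : n ∈ Ico 0 (2 * ((k : ℤ) - 1))) :
    IsArc (planeField 1 (deriv (polyP k))) (planeField (-1) (deriv (polyP k))) (pathK k n)
      0 (1 / 2) ∧
    IsArc (planeField 1 (deriv (polyP k))) (planeField (-1) (deriv (polyP k))) (pathK k n)
      (1 / 2) 1 := by
  have hp := isProfile_polyP hk
  have h13 : foldX k 1 ≤ foldX k ((k : ℤ) - 1) := foldX_le_foldX.2 (by omega)
  have hnn : ∀ x, foldX k 1 - 1 / 2 ≤ x → x ≤ foldX k ((k : ℤ) - 1) + 1 / 2 → 0 ≤ polyP k x :=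
    fun x hx hx' => polyP_nonneg ⟨by rwa [left_end_eq], by rwa [right_end_eq]⟩
  rcases label_cases hn with rfl | rfl | ⟨j, h1, h2, rfl⟩ | ⟨j, h1, h2, rfl⟩
  · rw [pathK_left]
    constructor
    · refine (hp.isArc_lower (x₀ := foldX k 1) fun t ht => hnn _ ?_ ?_).congr
        fun t ht => if_pos ht.2
      · linarith [ht.2]
      · linarith [ht.1]
    · refine (hp.isArc_upper (x₀ := foldX k 1 - 1) fun t ht => hnn _ ?_ ?_).congr fun t ht => ?_
      · linarith [ht.1]
      · linarith [ht.2]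
      · rcases ht.1.eq_or_lt with rfl | h
        · have : polyP k (foldX k 1 - 1 / 2) = 0 := by rw [← left_end_eq, polyP_left]
          rw [if_pos le_rfl, show foldX k 1 - 1 + 1 / 2 = foldX k 1 - 1 / 2 by ring]
          exact (graphUp_eq_graphDown this).symm
        · exact if_neg (not_le.2 h)
  · rw [pathK_right]
    constructor
    · refine (hp.isArc_upper (x₀ := foldX k ((k : ℤ) - 1)) fun t ht => hnn _ ?_ ?_).congr
        fun t ht => if_pos ht.2
      · linarith [ht.1]
      · linarith [ht.2]
    · refine (hp.isArc_lower (x₀ := foldX k ((k : ℤ) - 1) + 1) fun t ht => hnn _ ?_ ?_).congr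
        fun t ht => ?_
      · linarith [ht.2]
      · linarith [ht.1]
      · rcases ht.1.eq_or_lt with rfl | h
        · have : polyP k (foldX k ((k : ℤ) - 1) + 1 / 2) = 0 := by
            rw [← right_end_eq, polyP_right]
          rw [if_pos le_rfl, show foldX k ((k : ℤ) - 1) + 1 - 1 / 2 =
            foldX k ((k : ℤ) - 1) + 1 / 2 by ring]
          exact graphUp_eq_graphDown this
        · exact if_neg (not_le.2 h)
  · have h3 : foldX k 1 ≤ foldX k j := foldX_le_foldX.2 h1
    have h4 : foldX k (j + 1) ≤ foldX k ((k : ℤ) - 1) := foldX_le_foldX.2 (by omega)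
    rw [foldX_add_one] at h4
    rw [pathK_up h2]
    have := hp.isArc_upper (x₀ := foldX k j) (a := 0) (b := 1)
      fun t ht => hnn _ (by linarith [ht.1]) (by linarith [ht.2])
    exact ⟨this.mono le_rfl (by norm_num), this.mono (by norm_num) le_rfl⟩
  · have h3 : foldX k 1 ≤ foldX k j := foldX_le_foldX.2 h1
    have h4 : foldX k (j + 1) ≤ foldX k ((k : ℤ) - 1) := foldX_le_foldX.2 (by omega)
    have h5 := foldX_add_one (k := k) j
    rw [pathK_down h1]
    have := hp.isArc_lower (x₀ := foldX k (j + 1)) (a := 0) (b := 1)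
      fun t ht => hnn _ (by linarith [ht.2]) (by linarith [ht.1])
    exact ⟨this.mono le_rfl (by norm_num), this.mono (by norm_num) le_rfl⟩

lemma exists_pos_forall_le {ι : Type*} (s : Finset ι) (f : ι → ℝ) (hf : ∀ i ∈ s, 0 < f i) :
    ∃ c > 0, ∀ i ∈ s, c ≤ f i := by
  rcases s.eq_empty_or_nonempty with rfl | hs
  · exact ⟨1, one_pos, by simp⟩
  · obtain ⟨i, hi, H⟩ := s.exists_min_image f hs
    exact ⟨f i, hf i hi, H⟩

/-- Finitely many distinct compact sets with integer labels have Hausdorff distances comparable to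
the distances of their labels. -/
lemma exists_hausdorff_bounds (A : Finset ℤ) (F : ℤ → Set Plane)
    (hne : ∀ n ∈ A, (F n).Nonempty) (hc : ∀ n ∈ A, IsCompact (F n))
    (hinj : ∀ n ∈ A, ∀ m ∈ A, F n = F m → n = m) :
    ∃ c > 0, ∃ C > 0, ∀ n ∈ A, ∀ m ∈ A, c * dist n m ≤ Metric.hausdorffDist (F n) (F m) ∧
      Metric.hausdorffDist (F n) (F m) ≤ C * dist n m := by
  classical
  have hpos : ∀ p ∈ A.offDiag, 0 < dist p.1 p.2 := fun p hp =>
    dist_pos.2 (Finset.mem_offDiag.1 hp).2.2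
  have hpos' : ∀ p ∈ A.offDiag, 0 < Metric.hausdorffDist (F p.1) (F p.2) := fun p hp => by
    obtain ⟨h1, h2, h3⟩ := Finset.mem_offDiag.1 hp
    refine Metric.hausdorffDist_nonneg.lt_of_ne' fun h => h3 (hinj _ h1 _ h2 ?_)
    exact ((hc _ h1).isClosed.hausdorffDist_zero_iff_eq (hc _ h2).isClosed
      (hausdorffEDist_ne_top (hne _ h1) (hc _ h1) (hne _ h2) (hc _ h2))).1 h
  obtain ⟨c, hc0, hcle⟩ := exists_pos_forall_le A.offDiag
    (fun p => Metric.hausdorffDist (F p.1) (F p.2) / dist p.1 p.2)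
    fun p hp => div_pos (hpos' p hp) (hpos p hp)
  obtain ⟨C, hC0, hCle⟩ := exists_pos_forall_le A.offDiag
    (fun p => dist p.1 p.2 / Metric.hausdorffDist (F p.1) (F p.2))
    fun p hp => div_pos (hpos p hp) (hpos' p hp)
  refine ⟨c, hc0, C⁻¹, inv_pos.2 hC0, fun n hn m hm => ?_⟩
  rcases eq_or_ne n m with rfl | hnm
  · simp
  · have hp : (n, m) ∈ A.offDiag := Finset.mem_offDiag.2 ⟨hn, hm, hnm⟩
    have h1 := hcle _ hp
    have h2 := hCle _ hp
    have h3 := hpos _ hp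
    have h4 := hpos' _ hp
    simp only at h1 h2 h3 h4
    rw [le_div_iff₀ h3] at h1
    rw [le_div_iff₀ h4] at h2
    refine ⟨h1, ?_⟩
    rw [inv_mul_eq_div, le_div_iff₀ hC0]
    linarith

/-- The arcs of `Λ_k` form an arc system. -/
lemma arcSystem_K (hk : 2 ≤ k) : ArcSystem (planeField 1 (deriv (polyP k)))
    (planeField (-1) (deriv (polyP k))) (LambdaK k) (foldsK k) (arcK k)
    (Ico 0 (2 * ((k : ℤ) - 1))) (pathK k) where
  invariant γ hγ hex := by
    rw [LambdaK_eq (by omega)] at hex ⊢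
    exact (isProfile_polyP hk).invariant hγ hex
  mem_arc n hn u hu := pathK_mem_arcK hn hu
  of_mem_arc n q hq := exists_pathK_eq hk hq
  arc_disjoint n m hnm := arcK_disjoint hk hnm
  arc_disjoint_marked n := arcK_disjoint_foldsK hk n
  start_mem n hn := pathK_start_mem hk hn
  end_mem n hn := pathK_end_mem hk hn
  marked_subset := foldsK_subset
  arc_subset n := arcK_subset hk n
  cover := LambdaK_subset
  follow γ hγ hL t n hn u hu h0 := by
    rw [LambdaK_eq (by omega)] at hL
    exact pathK_follow hk hγ hL hn hu h0
  branch γ hγ hL t ht := by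
    rw [LambdaK_eq (by omega)] at hL
    exact pathK_branch hk hγ hL ht
  isArc n hn := pathK_isArc hk hn
  hausdorff := by
    have hcont : ∀ n ∈ Ico 0 (2 * ((k : ℤ) - 1)), ContinuousOn (pathK k n) (Icc 0 1) := by
      intro n hn
      obtain ⟨h1, h2⟩ := pathK_isArc hk hn
      rw [← Icc_union_Icc_eq_Icc (b := (1 / 2 : ℝ)) (by norm_num) (by norm_num)]
      exact h1.continuousOn.union_of_isClosed h2.continuousOn isClosed_Icc isClosed_Icc
    have := exists_hausdorff_bounds (Finset.Ico 0 (2 * ((k : ℤ) - 1)))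
      (fun n => pathK k n '' Icc 0 1) (fun n _ => (nonempty_Icc.2 zero_le_one).image _)
      (fun n hn => isCompact_Icc.image_of_continuousOn (hcont n (Finset.mem_Ico.1 hn)))
      fun n hn m hm hnm => ?_
    · simpa using this
    · rw [Finset.mem_Ico] at hn hm
      have hmid : (1 / 2 : ℝ) ∈ Ioo (0 : ℝ) 1 := by norm_num
      have h1 := pathK_mem_arcK hn hmid
      have h2 : pathK k n (1 / 2) ∈ pathK k m '' Icc 0 1 :=
        hnm ▸ mem_image_of_mem _ (show (1 / 2 : ℝ) ∈ Icc (0 : ℝ) 1 by norm_num)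
      obtain ⟨u, hu, hum⟩ := h2
      rw [← hum] at h1
      rcases hu.1.eq_or_lt with rfl | hu0
      · exact absurd (pathK_start_mem hk hm) ((arcK_disjoint_foldsK hk n).notMem_of_mem_left h1)
      rcases hu.2.eq_or_lt with rfl | hu1
      · exact absurd (pathK_end_mem hk hm) ((arcK_disjoint_foldsK hk n).notMem_of_mem_left h1)
      by_contra hne
      exact (arcK_disjoint hk hne).le_bot ⟨h1, pathK_mem_arcK hm ⟨hu0, hu1⟩⟩

/-! ### The subshift of `Z_k` -/

lemma summable_seqTerm_of_mem_Ico {a b : ℤ → ℤ} {N : ℤ} (ha : ∀ j, a j ∈ Ico 0 N)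
    (hb : ∀ j, b j ∈ Ico 0 N) : Summable (seqTerm a b) := by
  refine summable_div_two_pow_of_le (f := fun j => dist (a j) (b j)) N
    (fun j => dist_nonneg) fun j => ?_
  have h1 : |a j - b j| ≤ N := by
    rw [abs_le]
    constructor <;> linarith [(ha j).1, (ha j).2, (hb j).1, (hb j).2]
  have h2 : dist (a j) (b j) ≤ N := by
    rw [Int.dist_eq]
    exact_mod_cast h1
  have h3 : (0 : ℝ) ≤ N := dist_nonneg.trans h2
  nlinarith [mul_nonneg h3 (Nat.cast_nonneg (α := ℝ) j.natAbs)]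

lemma isSubshift_K : IsSubshift (fullShift (Ico 0 (2 * ((k : ℤ) - 1))))
    (ArcSystem.admissible (Ico 0 (2 * ((k : ℤ) - 1))) (pathK k)) := by
  refine ⟨fun a ha j => (ha j).1, ?_, ArcSystem.shift_admissible⟩
  refine isClosed_of_coordinates (fun a ha b hb => summable_seqTerm_of_mem_Ico ha hb)
    fun a ha haS => ?_
  simp only [ArcSystem.admissible, mem_ofPred_eq, not_forall] at haS
  obtain ⟨j, hj⟩ := haS
  refine ⟨j, 1, one_pos, fun b _ h1 h2 hb => hj ?_⟩
  rw [Int.eq_of_dist_lt_one h1, Int.eq_of_dist_lt_one h2]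
  exact hb j

/-- Each arc closes up to a loop of period one or two. -/
lemma exists_admissible (hk : 2 ≤ k) {n : ℤ} (hn : n ∈ Ico 0 (2 * ((k : ℤ) - 1))) :
    ∃ a ∈ ArcSystem.admissible (Ico 0 (2 * ((k : ℤ) - 1))) (pathK k), ∃ j, a j = n := by
  obtain ⟨m, hm, h1, h2⟩ : ∃ m ∈ Ico 0 (2 * ((k : ℤ) - 1)),
      pathK k n 1 = pathK k m 0 ∧ pathK k m 1 = pathK k n 0 := by
    rcases label_cases hn with rfl | rfl | ⟨j, h1, h2, rfl⟩ | ⟨j, h1, h2, rfl⟩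
    · exact ⟨0, hn, by rw [pathK_left_end hk, pathK_left_start hk],
        by rw [pathK_left_end hk, pathK_left_start hk]⟩
    · exact ⟨_, hn, by rw [pathK_right_end hk, pathK_right_start hk],
        by rw [pathK_right_end hk, pathK_right_start hk]⟩
    · exact ⟨2 * j, ⟨by omega, by omega⟩, by rw [pathK_up_end h1 h2, pathK_down_start h1 h2],
        by rw [pathK_down_end h1 h2, pathK_up_start h1 h2]⟩
    · exact ⟨2 * j - 1, ⟨by omega, by omega⟩, by rw [pathK_down_end h1 h2, pathK_up_start h1 h2],
        by rw [pathK_up_end h1 h2, pathK_down_start h1 h2]⟩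
  refine ⟨fun j => if Even j then n else m, fun j => ?_, 0, by simp⟩
  by_cases hj : Even j
  · have : ¬ Even (j + 1) := by simpa [Int.even_add_one] using hj
    simp only [hj, this, if_true, if_false]
    exact ⟨hn, h1⟩
  · have : Even (j + 1) := by simpa [Int.even_add_one] using hj
    simp only [hj, this, if_true, if_false]
    exact ⟨hm, h2⟩

theorem timeOneConjugacy_K (hk : 2 ≤ k) : TimeOneConjugacy (planeField 1 (deriv (polyP k)))
    (planeField (-1) (deriv (polyP k))) (LambdaK k) (foldsK k) (arcK k)
    (ArcSystem.admissible (Ico 0 (2 * ((k : ℤ) - 1))) (pathK k)) :=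
  (arcSystem_K hk).timeOneConjugacy fun _ ha _ hb =>
    summable_seqTerm_of_mem_Ico (fun j => (ha j).1) fun j => (hb j).1

end

lemma admissible_two : ArcSystem.admissible (Ico 0 (2 * (((2 : ℕ) : ℤ) - 1))) (pathK 2) =
    fullShift {0, 1} := by
  have hstart : ∀ n : ℤ, n = 0 ∨ n = 1 → pathK 2 n 0 = !₂[foldX 2 1, 0] := by
    rintro n (rfl | rfl)
    · exact pathK_left_start le_rfl
    · exact pathK_right_start (k := 2) le_rfl
  have hend : ∀ n : ℤ, n = 0 ∨ n = 1 → pathK 2 n 1 = !₂[foldX 2 1, 0] := by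
    rintro n (rfl | rfl)
    · exact pathK_left_end le_rfl
    · exact pathK_right_end (k := 2) le_rfl
  ext a
  constructor
  · intro ha j
    have h1 : 0 ≤ a j := (ha j).1.1
    have h2 : a j < 2 * (((2 : ℕ) : ℤ) - 1) := (ha j).1.2
    exact show a j = 0 ∨ a j = 1 by omega
  · intro ha j
    have h1 : a j = 0 ∨ a j = 1 := ha j
    refine ⟨⟨by omega, by omega⟩, ?_⟩
    rw [hend _ h1, hstart _ (ha (j + 1))]

lemma deriv_polyP_two : deriv (polyP 2) = fun x => x / 2 - 4 * x ^ 3 := by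
  have h : polyP 2 = fun x => x ^ 2 / 4 - x ^ 4 := by
    funext x
    simp [polyP]
    ring
  funext x
  rw [h]
  have := (((hasDerivAt_pow 2 x).div_const 4).sub (hasDerivAt_pow 4 x)).deriv
  refine this.trans ?_
  norm_num
  ring

/-! ### The sliding motion of the bean field -/

/-- The primitive of the slope of the orbits of `beanY` that vanishes at `0`. -/
def beanQ (x : ℝ) : ℝ := x ^ 4 / 2 - x ^ 2 / 2

/-- The time in which the sliding motion goes from `(x, 0)` to the origin. -/
def slideTime (x : ℝ) : ℝ := -x + 3 / √2 * Real.arctan (√2 * x)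

lemma hasDerivAt_beanQ (x : ℝ) : HasDerivAt beanQ (2 * x ^ 3 - x) x := by
  have := ((hasDerivAt_pow 4 x).div_const 2).sub ((hasDerivAt_pow 2 x).div_const 2)
  refine this.congr_deriv ?_
  norm_num
  ring

lemma hasDerivAt_slideTime (x : ℝ) :
    HasDerivAt slideTime (2 * (1 - x ^ 2) / (1 + 2 * x ^ 2)) x := by
  have h2 : √2 ^ 2 = 2 := Real.sq_sqrt (by norm_num)
  have h0 : √2 ≠ 0 := by positivity
  have h1 : HasDerivAt (fun x : ℝ => √2 * x) (√2) x := by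
    simpa using (hasDerivAt_id x).const_mul √2
  have := (hasDerivAt_id x).neg.add ((h1.arctan).const_mul (3 / √2))
  refine this.congr_deriv ?_
  rw [mul_pow, h2]
  have : 1 + 2 * x ^ 2 ≠ 0 := by positivity
  field_simp
  ring

@[simp] lemma slideTime_zero : slideTime 0 = 0 := by simp [slideTime]

lemma slideTime_neg (x : ℝ) : slideTime (-x) = -slideTime x := by
  simp only [slideTime, mul_neg, Real.arctan_neg]
  ring

lemma continuous_slideTime : Continuous slideTime :=
  continuous_iff_continuousAt.2 fun x => (hasDerivAt_slideTime x).continuousAt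

lemma strictMonoOn_slideTime : StrictMonoOn slideTime (Icc (-1) 1) := by
  refine strictMonoOn_of_deriv_pos (convex_Icc _ _) continuous_slideTime.continuousOn fun x hx => ?_
  rw [interior_Icc] at hx
  rw [(hasDerivAt_slideTime x).deriv]
  have : 0 < 1 - x ^ 2 := by nlinarith [hx.1, hx.2]
  positivity

/-- The inverse of `slideTime` on `[-1, 1]`. -/
def slidePos (w : ℝ) : ℝ := Function.invFunOn slideTime (Icc (-1) 1) w

lemma exists_slideTime_eq {w : ℝ} (hw : w ∈ Icc (-slideTime 1) (slideTime 1)) :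
    ∃ x ∈ Icc (-1 : ℝ) 1, slideTime x = w := by
  rw [← slideTime_neg] at hw
  exact intermediate_value_Icc (by norm_num) continuous_slideTime.continuousOn hw

lemma slidePos_mem {w : ℝ} (hw : w ∈ Icc (-slideTime 1) (slideTime 1)) :
    slidePos w ∈ Icc (-1 : ℝ) 1 := Function.invFunOn_mem (exists_slideTime_eq hw)

lemma slideTime_slidePos {w : ℝ} (hw : w ∈ Icc (-slideTime 1) (slideTime 1)) :
    slideTime (slidePos w) = w := Function.invFunOn_eq (exists_slideTime_eq hw)

lemma slideTime_mem {x : ℝ} (hx : x ∈ Icc (-1 : ℝ) 1) :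
    slideTime x ∈ Icc (-slideTime 1) (slideTime 1) := by
  rw [← slideTime_neg]
  exact ⟨strictMonoOn_slideTime.monotoneOn (by norm_num) hx hx.1,
    strictMonoOn_slideTime.monotoneOn hx (by norm_num) hx.2⟩

lemma slidePos_slideTime {x : ℝ} (hx : x ∈ Icc (-1 : ℝ) 1) : slidePos (slideTime x) = x :=
  strictMonoOn_slideTime.injOn (slidePos_mem (slideTime_mem hx)) hx
    (slideTime_slidePos (slideTime_mem hx))

@[simp] lemma slidePos_zero : slidePos 0 = 0 := by
  have := slidePos_slideTime (x := 0) (by norm_num)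
  rwa [slideTime_zero] at this

lemma strictMonoOn_slidePos : StrictMonoOn slidePos (Icc (-slideTime 1) (slideTime 1)) := by
  intro v hv w hw hvw
  by_contra h
  have := strictMonoOn_slideTime.monotoneOn (slidePos_mem hw) (slidePos_mem hv) (not_lt.1 h)
  rw [slideTime_slidePos hv, slideTime_slidePos hw] at this
  linarith

lemma slidePos_mem_Ioo {w : ℝ} (hw : w ∈ Ioo (-slideTime 1) (slideTime 1)) :
    slidePos w ∈ Ioo (-1 : ℝ) 1 := by
  have h1 := slidePos_slideTime (x := 1) (by norm_num)
  have h2 := slidePos_slideTime (x := -1) (by norm_num)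
  rw [slideTime_neg] at h2
  have hw' : w ∈ Icc (-slideTime 1) (slideTime 1) := ⟨hw.1.le, hw.2.le⟩
  constructor
  · have := strictMonoOn_slidePos ⟨le_rfl, (hw.1.trans hw.2).le⟩ hw' hw.1
    rwa [h2] at this
  · have := strictMonoOn_slidePos hw' ⟨(hw.1.trans hw.2).le, le_rfl⟩ hw.2
    rwa [h1] at this

lemma continuousAt_slidePos {w : ℝ} (hw : w ∈ Ioo (-slideTime 1) (slideTime 1)) :
    ContinuousAt slidePos w := by
  refine continuousAt_of_monotoneOn_of_image_mem_nhds strictMonoOn_slidePos.monotoneOn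
    (Icc_mem_nhds hw.1 hw.2) (mem_of_superset
      (Icc_mem_nhds (slidePos_mem_Ioo hw).1 (slidePos_mem_Ioo hw).2) fun x hx => ?_)
  exact ⟨slideTime x, slideTime_mem hx, slidePos_slideTime hx⟩

lemma hasDerivAt_slidePos {w : ℝ} (hw : w ∈ Ioo (-slideTime 1) (slideTime 1)) :
    HasDerivAt slidePos (2 * (1 - slidePos w ^ 2) / (1 + 2 * slidePos w ^ 2))⁻¹ w := by
  have hx := slidePos_mem_Ioo hw
  have h1 : 0 < 1 - slidePos w ^ 2 := by nlinarith [hx.1, hx.2]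
  refine HasDerivAt.of_local_left_inverse (continuousAt_slidePos hw)
    (hasDerivAt_slideTime (slidePos w)) (by positivity) ?_
  filter_upwards [Icc_mem_nhds hw.1 hw.2] with v hv using slideTime_slidePos hv

/-- The speed of the sliding motion. -/
def slideSpeed (x : ℝ) : ℝ := -(1 + 2 * x ^ 2) / (2 * (1 - x ^ 2))

lemma mem_Icc_of_two_mul_sq_le {x : ℝ} (hx : 2 * x ^ 2 ≤ 1) : x ∈ Ioo (-1 : ℝ) 1 := by
  constructor <;> nlinarith

lemma slidingSet_bean : slidingSet beanX beanY = {p | p 1 = 0 ∧ p 0 ≠ 0 ∧ 2 * p 0 ^ 2 < 1} := by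
  ext p
  simp only [slidingSet, beanX, beanY, planeField, mem_ofPred_eq]
  refine and_congr_right fun _ => ?_
  simp only [Matrix.cons_val_one, Matrix.cons_val_fin_one]
  set x := p 0
  constructor
  · rintro (⟨h1, h2⟩ | ⟨h1, h2⟩)
    · have hx : 0 < x := by linarith
      exact ⟨hx.ne', by nlinarith⟩
    · have hx : x < 0 := by linarith
      exact ⟨hx.ne, by nlinarith⟩
  · rintro ⟨h1, h2⟩
    rcases lt_or_gt_of_ne h1 with hx | hx
    · exact Or.inr ⟨by linarith, by nlinarith⟩
    · exact Or.inl ⟨by linarith, by nlinarith⟩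

lemma mem_closure_slidingSet_bean {p : Plane} :
    p ∈ closure (slidingSet beanX beanY) ↔ p 1 = 0 ∧ 2 * p 0 ^ 2 ≤ 1 := by
  rw [slidingSet_bean]
  constructor
  · intro h
    have h3 : Continuous fun p : Plane => p 1 := by fun_prop
    have hcl : IsClosed {p : Plane | p 1 = 0 ∧ 2 * p 0 ^ 2 ≤ 1} :=
      (isClosed_eq h3 continuous_const).inter
        (isClosed_le (by fun_prop : Continuous fun p : Plane => 2 * p 0 ^ 2) continuous_const)
    exact closure_minimal (t := {p : Plane | p 1 = 0 ∧ 2 * p 0 ^ 2 ≤ 1})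
      (fun q hq => ⟨hq.1, hq.2.2.le⟩) hcl h
  · rintro ⟨h1, h2⟩
    -- approach `p` along a segment that points to the interior of the sliding segment
    set z : ℝ := if p 0 = 0 then 1 / 2 else 0 with hz
    have ht : Tendsto (fun δ : ℝ => (!₂[(1 - δ) * p 0 + δ * z, 0] : Plane)) (𝓝[>] 0) (𝓝 p) := by
      have hc : Continuous fun δ : ℝ => (!₂[(1 - δ) * p 0 + δ * z, 0] : Plane) := by fun_prop
      have := (hc.tendsto 0).mono_left (nhdsWithin_le_nhds (s := Ioi 0))
      convert this using 2
      exact plane_ext (by simp) (by simp [h1])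
    refine mem_closure_of_tendsto ht ?_
    filter_upwards [Ioo_mem_nhdsGT (show (0 : ℝ) < 1 by norm_num)] with δ hδ
    refine ⟨by simp, ?_⟩
    simp only [Matrix.cons_val_zero]
    by_cases h0 : p 0 = 0
    · simp only [h0, if_true, mul_zero, zero_add] at hz ⊢
      rw [hz]
      exact ⟨by linarith [hδ.1], by nlinarith [hδ.1, hδ.2]⟩
    · simp only [h0, if_false] at hz
      rw [hz, mul_zero, add_zero]
      refine ⟨mul_ne_zero (by linarith [hδ.2]) h0, ?_⟩
      have h3 : (1 - δ) ^ 2 < 1 := by nlinarith [hδ.1, hδ.2]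
      have h4 : 0 < p 0 ^ 2 := by positivity
      rw [mul_pow]
      nlinarith

lemma slidingField_bean {p : Plane} (hp : p ∈ slidingSet beanX beanY) :
    slidingField beanX beanY p = !₂[slideSpeed (p 0), 0] := by
  rw [slidingSet_bean] at hp
  obtain ⟨h1, h2, h3⟩ := hp
  have h4 : 1 - p 0 ^ 2 ≠ 0 := by nlinarith
  have h5 : -4 * p 0 ^ 3 + 2 * p 0 - -2 * p 0 ≠ 0 := by
    rw [show -4 * p 0 ^ 3 + 2 * p 0 - -2 * p 0 = 4 * p 0 * (1 - p 0 ^ 2) by ring]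
    exact mul_ne_zero (mul_ne_zero (by norm_num) h2) h4
  refine plane_ext ?_ ?_
  · simp only [slidingField, beanX, beanY, planeField, slideSpeed, PiLp.smul_apply, PiLp.sub_apply,
      PiLp.toLp_apply, Matrix.cons_val_one, Matrix.cons_val_fin_one, Matrix.cons_val_zero,
      smul_eq_mul]
    rw [inv_mul_eq_div, div_eq_div_iff h5 (mul_ne_zero (by norm_num) h4)]
    ring
  · simp only [slidingField, beanX, beanY, planeField, PiLp.smul_apply, PiLp.sub_apply,
      PiLp.toLp_apply, Matrix.cons_val_one, Matrix.cons_val_fin_one,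
      smul_eq_mul]
    ring

lemma isSlidingVelocity_bean {p v : Plane} :
    IsSlidingVelocity beanX beanY p v ↔
      (p 1 = 0 ∧ 2 * p 0 ^ 2 ≤ 1) ∧ v = !₂[slideSpeed (p 0), 0] := by
  rw [IsSlidingVelocity, mem_closure_slidingSet_bean]
  refine and_congr_right fun hp => ?_
  have hlim : Tendsto (slidingField beanX beanY) (𝓝[slidingSet beanX beanY] p)
      (𝓝 !₂[slideSpeed (p 0), 0]) := by
    have hc : ContinuousAt (fun q : Plane => (!₂[slideSpeed (q 0), 0] : Plane)) p := by
      have h0 : 2 * (1 - p 0 ^ 2) ≠ 0 := by nlinarith [hp.2]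
      unfold slideSpeed
      fun_prop (disch := exact h0)
    refine (hc.tendsto.mono_left nhdsWithin_le_nhds).congr' ?_
    filter_upwards [self_mem_nhdsWithin] with q hq using (slidingField_bean hq).symm
  have : (𝓝[slidingSet beanX beanY] p).NeBot :=
    mem_closure_iff_nhdsWithin_neBot.1 (mem_closure_slidingSet_bean.2 hp)
  exact ⟨fun h => tendsto_nhds_unique h hlim, fun h => h ▸ hlim⟩

/-- The bean field has no singular tangency: the only fold of `beanX` is the origin, which is a
visible fold of `beanY`. -/
lemma not_singularTangency_bean (p : Plane) : ¬ SingularTangency beanX beanY p := by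
  rintro ⟨-, h1, -, -, h2⟩
  have hx : p 0 = 0 := by simpa [beanX, planeField] using h1
  have hproj : HasFDerivAt (fun q : Plane => q 0) (EuclideanSpace.proj (𝕜 := ℝ) (0 : Fin 2)) p :=
    (EuclideanSpace.proj (𝕜 := ℝ) (0 : Fin 2)).hasFDerivAt
  have hd : HasDerivAt (fun x : ℝ => -4 * x ^ 3 + 2 * x) 2 (p 0) := by
    have := ((hasDerivAt_pow 3 (p 0)).const_mul (-4)).add ((hasDerivAt_id (p 0)).const_mul 2)
    refine this.congr_deriv ?_
    simp [hx]
  have := (hd.comp_hasFDerivAt p hproj).fderiv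
  have h3 : (fun q : Plane => beanY q 1) =
      (fun x : ℝ => -4 * x ^ 3 + 2 * x) ∘ fun q : Plane => q 0 := by
    funext q
    simp [beanY, planeField]
  rw [h3, this] at h2
  simp [beanY, planeField] at h2
  linarith

/-! ### The arcs of the bean field -/

/-- On `[a, b]`, the curve `γ` is an orbit of `beanX`, an orbit of `beanY`, or slides, in terms of
the first integrals `y + x²`, `y - beanQ(x)` and `slideTime(x) + t`. -/
def IsBeanArc (γ : ℝ → Plane) (a b : ℝ) : Prop :=
  (∃ x₀ e, ∀ t ∈ Icc a b, 0 ≤ γ t 1 ∧ γ t = !₂[x₀ + t, e - (x₀ + t) ^ 2]) ∨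
  (∃ x₀ e, ∀ t ∈ Icc a b, γ t 1 ≤ 0 ∧ γ t = !₂[x₀ - 2 * t, beanQ (x₀ - 2 * t) + e]) ∨
  ∃ c, ∀ t ∈ Icc a b, γ t 1 = 0 ∧ 2 * γ t 0 ^ 2 ≤ 1 ∧ slideTime (γ t 0) = c - t

lemma beanX_orbit_iff {γ : ℝ → Plane} {a b : ℝ} :
    (∀ t ∈ Icc a b, HasDerivWithinAt γ (beanX (γ t)) (Icc a b) t) ↔
      ∃ x₀ e, ∀ t ∈ Icc a b, γ t = !₂[x₀ + t, e - (x₀ + t) ^ 2] := by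
  refine (hasDerivWithinAt_planeField_iff (c := 1) (g := fun x => -2 * x) (Q := fun x => -x ^ 2)
    (q := fun x => -2 * x) (fun x => ?_) fun x => by ring).trans ?_
  · exact (hasDerivAt_pow 2 x).neg.congr_deriv (by norm_num)
  · simp only [one_mul, neg_add_eq_sub]

lemma beanY_orbit_iff {γ : ℝ → Plane} {a b : ℝ} :
    (∀ t ∈ Icc a b, HasDerivWithinAt γ (beanY (γ t)) (Icc a b) t) ↔
      ∃ x₀ e, ∀ t ∈ Icc a b, γ t = !₂[x₀ - 2 * t, beanQ (x₀ - 2 * t) + e] := by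
  refine (hasDerivWithinAt_planeField_iff (c := -2) (g := fun x => -4 * x ^ 3 + 2 * x)
    hasDerivAt_beanQ fun x => by ring).trans ?_
  simp only [neg_mul, ← sub_eq_add_neg]

lemma isArc_bean_iff {γ : ℝ → Plane} {a b : ℝ} :
    IsArc beanX beanY γ a b ↔ IsBeanArc γ a b := by
  constructor
  · rintro (h | h | h | ⟨p, hp, -⟩)
    · obtain ⟨x₀, e, H⟩ := beanX_orbit_iff.1 fun t ht => (h t ht).2
      exact Or.inl ⟨x₀, e, fun t ht => ⟨(h t ht).1, H t ht⟩⟩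
    · obtain ⟨x₀, e, H⟩ := beanY_orbit_iff.1 fun t ht => (h t ht).2
      exact Or.inr (Or.inl ⟨x₀, e, fun t ht => ⟨(h t ht).1, H t ht⟩⟩)
    · simp only [isSlidingVelocity_bean] at h
      refine Or.inr (Or.inr ⟨slideTime (γ a 0) + a, fun t ht => ?_⟩)
      obtain ⟨-, v, ⟨⟨h1, h2⟩, -⟩, -⟩ := h t ht
      refine ⟨h1, h2, ?_⟩
      have := eq_of_hasDerivWithinAt_zero (f := fun t => slideTime (γ t 0) + t) (a := a) (b := b)
        (fun t ht => by
          obtain ⟨-, v, ⟨⟨-, h2⟩, rfl⟩, h3⟩ := h t ht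
          refine (((hasDerivAt_slideTime _).comp_hasDerivWithinAt t
            (hasDerivWithinAt_plane.1 h3).1).add (hasDerivWithinAt_id t _)).congr_deriv ?_
          have h4 : 1 - γ t 0 ^ 2 ≠ 0 := by nlinarith
          have h5 : 1 + 2 * γ t 0 ^ 2 ≠ 0 := by positivity
          simp only [slideSpeed, Matrix.cons_val_zero]
          field_simp
          ring) t ht
      simp only at this
      linarith
    · exact absurd hp (not_singularTangency_bean p)
  · rintro (⟨x₀, e, h⟩ | ⟨x₀, e, h⟩ | ⟨c, h⟩)
    · have := beanX_orbit_iff.2 ⟨x₀, e, fun t ht => (h t ht).2⟩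
      exact Or.inl fun t ht => ⟨(h t ht).1, this t ht⟩
    · have := beanY_orbit_iff.2 ⟨x₀, e, fun t ht => (h t ht).2⟩
      exact Or.inr (Or.inl fun t ht => ⟨(h t ht).1, this t ht⟩)
    · refine Or.inr (Or.inr (Or.inl fun t ht => ⟨not_singularTangency_bean _, _,
        isSlidingVelocity_bean.2 ⟨⟨(h t ht).1, (h t ht).2.1⟩, rfl⟩, ?_⟩))
      have hpos : ∀ t ∈ Icc a b, γ t 0 = slidePos (c - t) := fun t ht => by
        have := mem_Icc_of_two_mul_sq_le (h t ht).2.1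
        rw [← (h t ht).2.2, slidePos_slideTime ⟨this.1.le, this.2.le⟩]
      have hct : c - t ∈ Ioo (-slideTime 1) (slideTime 1) := by
        have := mem_Icc_of_two_mul_sq_le (h t ht).2.1
        rw [← (h t ht).2.2, ← slideTime_neg]
        exact ⟨strictMonoOn_slideTime (by norm_num) ⟨this.1.le, this.2.le⟩ this.1,
          strictMonoOn_slideTime ⟨this.1.le, this.2.le⟩ (by norm_num) this.2⟩
      refine hasDerivWithinAt_plane.2 ⟨?_, ?_⟩
      · have h1 : HasDerivAt (fun t => c - t) (-1) t := by
          simpa using (hasDerivAt_id t).const_sub c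
        have h2 := ((hasDerivAt_slidePos hct).comp t h1).hasDerivWithinAt (s := Icc a b)
        rw [← hpos t ht] at h2
        refine (h2.congr hpos (hpos t ht)).congr_deriv ?_
        simp only [slideSpeed, inv_div, Matrix.cons_val_zero]
        ring
      · refine ((hasDerivWithinAt_const t (Icc a b) (0 : ℝ)).congr (fun s hs => (h s hs).1)
          (h t ht).1).congr_deriv (by simp)

/-! ### The descent from the section to the origin -/

/-- The abscissa `m ∈ [0, r]` at which the descent from `(0, r²)` starts to slide. -/
def slideStart (r : ℝ) : ℝ := min r √(1 - r ^ 2)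

/-- The time at which the descent from `(0, r²)` starts to slide. -/
def flightTime (r : ℝ) : ℝ := r + (r - slideStart r) / 2

/-- The time in which the descent from `(0, r²)` reaches the origin. -/
def descentTime (r : ℝ) : ℝ := flightTime r + slideTime (slideStart r)

/-- The trajectory from `(0, r²)` to the origin: along `beanX` to `(r, 0)`, then, if `(r, 0)` is not
yet a sliding point, along `beanY` to `(m, 0)`, and finally sliding to the origin. -/
def descent (r u : ℝ) : Plane :=
  if u ≤ r then !₂[u, r ^ 2 - u ^ 2]
  else if u ≤ flightTime r then !₂[3 * r - 2 * u, beanQ (3 * r - 2 * u) - beanQ r]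
  else !₂[slidePos (descentTime r - u), 0]

lemma beanQ_sub (x r : ℝ) : beanQ x - beanQ r = (r ^ 2 - x ^ 2) * (1 - r ^ 2 - x ^ 2) / 2 := by
  unfold beanQ
  ring

/-- If `2r² ≤ 1`, the point `(r, 0)` already slides. Otherwise the orbit of `beanY` through `(r, 0)`
returns to `Σ` at `(m, 0)` with `m² + r² = 1`. -/
lemma slideStart_cases {r : ℝ} (hr : r ∈ Ioc (0 : ℝ) 1) :
    (slideStart r = r ∧ 2 * r ^ 2 ≤ 1) ∨
      (1 < 2 * r ^ 2 ∧ 0 ≤ slideStart r ∧ slideStart r < r ∧ slideStart r ^ 2 = 1 - r ^ 2) := by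
  have h0 := hr.1
  have h1 : 0 ≤ 1 - r ^ 2 := by nlinarith [hr.1, hr.2]
  rcases le_or_gt (2 * r ^ 2) 1 with h | h
  · exact Or.inl ⟨min_eq_left (Real.le_sqrt_of_sq_le (by linarith)), h⟩
  · have h2 : √(1 - r ^ 2) < r := (Real.sqrt_lt' h0).2 (by linarith)
    rw [slideStart, min_eq_right h2.le]
    exact Or.inr ⟨h, Real.sqrt_nonneg _, h2, Real.sq_sqrt h1⟩

lemma slideStart_mem {r : ℝ} (hr : r ∈ Ioc (0 : ℝ) 1) :
    0 ≤ slideStart r ∧ slideStart r ≤ r ∧ 2 * slideStart r ^ 2 ≤ 1 := by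
  rcases slideStart_cases hr with ⟨h1, h2⟩ | ⟨h1, h2, h3, h4⟩
  · rw [h1]
    exact ⟨hr.1.le, le_rfl, h2⟩
  · exact ⟨h2, h3.le, by linarith⟩

lemma beanQ_slideStart {r : ℝ} (hr : r ∈ Ioc (0 : ℝ) 1) : beanQ (slideStart r) - beanQ r = 0 := by
  rcases slideStart_cases hr with ⟨h1, h2⟩ | ⟨h1, h2, h3, h4⟩
  · rw [h1, sub_self]
  · rw [beanQ_sub, h4]
    ring

lemma slideTime_le {x : ℝ} (hx : 0 ≤ x) : slideTime x ≤ 2 * x := by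
  have h2 : √2 ^ 2 = 2 := Real.sq_sqrt (by norm_num)
  have h0 : 0 < √2 := by positivity
  have h1 : Real.arctan (√2 * x) ≤ √2 * x := by
    have := Real.le_tan (Real.arctan_nonneg.2 (by positivity : 0 ≤ √2 * x))
      (Real.arctan_lt_pi_div_two _)
    rwa [Real.tan_arctan] at this
  have h3 : 3 / √2 * Real.arctan (√2 * x) ≤ 3 / √2 * (√2 * x) := by gcongr
  have h4 : 3 / √2 * (√2 * x) = 3 * x := by field_simp
  unfold slideTime
  linarith

lemma slideTime_pos {x : ℝ} (hx : x ∈ Ioc (0 : ℝ) 1) : 0 < slideTime x := by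
  have := strictMonoOn_slideTime (by norm_num) ⟨by linarith [hx.1], hx.2⟩ hx.1
  rwa [slideTime_zero] at this

lemma slideTime_slideStart_nonneg {r : ℝ} (hr : r ∈ Ioc (0 : ℝ) 1) :
    0 ≤ slideTime (slideStart r) := by
  obtain ⟨h0, h1, -⟩ := slideStart_mem hr
  rcases h0.eq_or_lt with h | h
  · rw [← h, slideTime_zero]
  · exact (slideTime_pos ⟨h, h1.trans hr.2⟩).le

lemma le_flightTime {r : ℝ} (hr : r ∈ Ioc (0 : ℝ) 1) : r ≤ flightTime r := by
  have := (slideStart_mem hr).2.1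
  unfold flightTime
  linarith

lemma flightTime_le_descentTime {r : ℝ} (hr : r ∈ Ioc (0 : ℝ) 1) :
    flightTime r ≤ descentTime r := by
  have := slideTime_slideStart_nonneg hr
  unfold descentTime
  linarith

lemma lt_descentTime {r : ℝ} (hr : r ∈ Ioc (0 : ℝ) 1) : r < descentTime r := by
  unfold descentTime flightTime
  rcases slideStart_cases hr with ⟨h1, h2⟩ | ⟨h1, h2, h3, h4⟩
  · rw [h1]
    linarith [slideTime_pos hr]
  · linarith [slideTime_slideStart_nonneg hr]

lemma descentTime_pos {r : ℝ} (hr : r ∈ Ioc (0 : ℝ) 1) : 0 < descentTime r :=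
  hr.1.trans (lt_descentTime hr)

lemma descentTime_le {r : ℝ} (hr : r ∈ Ioc (0 : ℝ) 1) : descentTime r ≤ 3 * r := by
  obtain ⟨h0, h1, -⟩ := slideStart_mem hr
  unfold descentTime flightTime
  linarith [slideTime_le h0]

lemma descent_eq_of_le {r u : ℝ} (hu : u ≤ r) : descent r u = !₂[u, r ^ 2 - u ^ 2] := if_pos hu

lemma descent_eq_of_mem {r u : ℝ} (h1 : r ≤ u) (h2 : u ≤ flightTime r) :
    descent r u = !₂[3 * r - 2 * u, beanQ (3 * r - 2 * u) - beanQ r] := by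
  rcases h1.eq_or_lt with rfl | h
  · rw [descent, if_pos le_rfl]
    refine plane_ext ?_ ?_
    · simp only [Matrix.cons_val_zero]
      ring
    · simp only [Matrix.cons_val_one, Matrix.cons_val_fin_one]
      ring_nf
  · rw [descent, if_neg (not_le.2 h), if_pos h2]

lemma descent_eq_of_flightTime_le {r u : ℝ} (hr : r ∈ Ioc (0 : ℝ) 1) (h : flightTime r ≤ u) :
    descent r u = !₂[slidePos (descentTime r - u), 0] := by
  rcases h.eq_or_lt with rfl | h
  · rw [descent_eq_of_mem (le_flightTime hr) le_rfl, show 3 * r - 2 * flightTime r = slideStart r by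
      unfold flightTime; ring, beanQ_slideStart hr, descentTime, add_sub_cancel_left,
      slidePos_slideTime]
    obtain ⟨h0, h1, -⟩ := slideStart_mem hr
    exact ⟨by linarith, h1.trans hr.2⟩
  · rw [descent, if_neg (not_le.2 ((le_flightTime hr).trans_lt h)), if_neg (not_le.2 h)]

lemma descent_zero {r : ℝ} (hr : r ∈ Ioc (0 : ℝ) 1) : descent r 0 = !₂[0, r ^ 2] := by
  rw [descent_eq_of_le hr.1.le]
  simp

lemma descent_descentTime {r : ℝ} (hr : r ∈ Ioc (0 : ℝ) 1) : descent r (descentTime r) = 0 := by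
  rw [descent_eq_of_flightTime_le hr (flightTime_le_descentTime hr)]
  exact plane_ext (by simp) (by simp)

/-- While sliding, the position lies in `[0, m]`, and `slideTime` of it is the remaining time. -/
lemma slidePos_descentTime_sub {r u : ℝ} (hr : r ∈ Ioc (0 : ℝ) 1) (h1 : flightTime r ≤ u)
    (h2 : u ≤ descentTime r) :
    0 ≤ slidePos (descentTime r - u) ∧ slidePos (descentTime r - u) ≤ slideStart r ∧
      slideTime (slidePos (descentTime r - u)) = descentTime r - u ∧
      (u < descentTime r → 0 < slidePos (descentTime r - u)) := by
  obtain ⟨h0, h3, -⟩ := slideStart_mem hr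
  have hm : slideStart r ∈ Icc (-1 : ℝ) 1 := ⟨by linarith, h3.trans hr.2⟩
  have hmem := slideTime_mem hm
  have h4 : descentTime r - u ≤ slideTime (slideStart r) := by
    unfold descentTime
    linarith
  have h5 : descentTime r - u ∈ Icc (-slideTime 1) (slideTime 1) :=
    ⟨by linarith [hmem.1, slideTime_pos (x := 1) (by norm_num)], by linarith [hmem.2]⟩
  have h6 : (0 : ℝ) ∈ Icc (-slideTime 1) (slideTime 1) := by
    have := slideTime_pos (x := 1) (by norm_num)
    constructor <;> linarith
  refine ⟨?_, ?_, slideTime_slidePos h5, fun h => ?_⟩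
  · rw [← slidePos_zero]
    exact strictMonoOn_slidePos.monotoneOn h6 h5 (by linarith)
  · rw [← slidePos_slideTime hm]
    exact strictMonoOn_slidePos.monotoneOn h5 hmem h4
  · rw [← slidePos_zero]
    exact strictMonoOn_slidePos h6 h5 (by linarith)

/-- In flight below the switching line, the abscissa decreases from `r` to `m`. -/
lemma flight_mem {r u : ℝ} (h1 : r ≤ u) (h2 : u ≤ flightTime r) :
    3 * r - 2 * u ∈ Icc (slideStart r) r := by
  unfold flightTime at h2
  constructor <;> linarith

lemma beanQ_sub_nonpos {r x : ℝ} (hr : r ∈ Ioc (0 : ℝ) 1) (hx : x ∈ Icc (slideStart r) r) :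
    beanQ x - beanQ r ≤ 0 := by
  obtain ⟨h0, -⟩ := slideStart_mem hr
  have h1 := hx.1
  have h2 := hx.2
  rw [beanQ_sub]
  have h3 : 0 ≤ r ^ 2 - x ^ 2 := by nlinarith
  rcases slideStart_cases hr with ⟨h4, h5⟩ | ⟨h4, h5, h6, h7⟩
  · have : x = r := le_antisymm h2 (h4 ▸ h1)
    rw [this, sub_self]
    simp
  · have : 1 - r ^ 2 - x ^ 2 ≤ 0 := by nlinarith
    nlinarith

lemma descent_pos {r u : ℝ} (hr : r ∈ Ioc (0 : ℝ) 1) (hu : u ∈ Ioo 0 (descentTime r)) :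
    0 < descent r u 0 := by
  rcases le_or_gt u r with h | h
  · rw [descent_eq_of_le h]
    simpa using hu.1
  · rcases le_or_gt (flightTime r) u with h' | h'
    · rw [descent_eq_of_flightTime_le hr h']
      simpa using (slidePos_descentTime_sub hr h' hu.2.le).2.2.2 hu.2
    · rw [descent_eq_of_mem h.le h'.le]
      have := (slideStart_mem hr).1
      unfold flightTime at h'
      simp only [Matrix.cons_val_zero]
      linarith

/-- A point of the descent is either above `Σ`, at time `x` and level `y + x² = r²`; or below `Σ`,
at level `y - beanQ(x) = -beanQ(r)`, which requires `2r² > 1`; or the point `(r, 0)`; or it slides. -/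
lemma descent_invariant {r u : ℝ} (hr : r ∈ Ioc (0 : ℝ) 1) (hu : u ∈ Icc 0 (descentTime r)) :
    (0 < descent r u 1 ∧ u = descent r u 0 ∧ descent r u 1 + descent r u 0 ^ 2 = r ^ 2) ∨
    (descent r u 1 < 0 ∧ 1 < 2 * r ^ 2 ∧ r < u ∧
      descent r u 1 - beanQ (descent r u 0) = -beanQ r) ∨
    (descent r u 1 = 0 ∧ u = r) ∨
    (descent r u 1 = 0 ∧ flightTime r ≤ u) := by
  rcases lt_trichotomy u r with h | rfl | h
  · rw [descent_eq_of_le h.le]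
    refine Or.inl ⟨?_, by simp, by simp⟩
    simp only [Matrix.cons_val_one, Matrix.cons_val_fin_one]
    nlinarith [hu.1]
  · rw [descent_eq_of_le le_rfl]
    exact Or.inr (Or.inr (Or.inl ⟨by simp, rfl⟩))
  · rcases le_or_gt (flightTime r) u with h' | h'
    · rw [descent_eq_of_flightTime_le hr h']
      exact Or.inr (Or.inr (Or.inr ⟨by simp, h'⟩))
    · rw [descent_eq_of_mem h.le h'.le]
      refine Or.inr (Or.inl ⟨?_, ?_, h, by simp⟩)
      · unfold flightTime at h'
        rcases slideStart_cases hr with ⟨h4, h5⟩ | ⟨h4, h5, h6, h7⟩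
        · linarith
        · simp only [Matrix.cons_val_one, Matrix.cons_val_fin_one]
          rw [beanQ_sub]
          have h8 : 3 * r - 2 * u < r := by linarith
          have h9 : slideStart r < 3 * r - 2 * u := by linarith
          have h10 : 0 < r ^ 2 - (3 * r - 2 * u) ^ 2 := by nlinarith
          have h11 : 1 - r ^ 2 - (3 * r - 2 * u) ^ 2 < 0 := by nlinarith
          nlinarith
      · unfold flightTime at h'
        rcases slideStart_cases hr with ⟨h4, h5⟩ | ⟨h4, h5, h6, h7⟩
        · linarith
        · exact h4

/-- Off the switching line, the point determines the amplitude of the descent. -/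
lemma eq_of_descent_eq {r r' u u' : ℝ} (hr : r ∈ Ioc (0 : ℝ) 1) (hr' : r' ∈ Ioc (0 : ℝ) 1)
    (hu : u ∈ Icc 0 (descentTime r)) (hu' : u' ∈ Icc 0 (descentTime r'))
    (h : descent r u = descent r' u') (h1 : descent r u 1 ≠ 0) : r = r' := by
  have h0 := descent_invariant hr hu
  have h0' := descent_invariant hr' hu'
  rw [← h] at h0'
  rcases h0 with ⟨h2, -, h3⟩ | ⟨h2, h3, -, h4⟩ | ⟨h2, -⟩ | ⟨h2, -⟩
  · rcases h0' with ⟨h2', -, h3'⟩ | ⟨h2', h3', -, h4'⟩ | ⟨h2', -⟩ | ⟨h2', -⟩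
    · exact (sq_eq_sq₀ hr.1.le hr'.1.le).1 (by linarith)
    all_goals linarith
  · rcases h0' with ⟨h2', -, h3'⟩ | ⟨h2', h3', -, h4'⟩ | ⟨h2', -⟩ | ⟨h2', -⟩
    · linarith
    · refine (sq_eq_sq₀ hr.1.le hr'.1.le).1 ?_
      have h5 : beanQ r - beanQ r' = 0 := by linarith
      rw [beanQ_sub, div_eq_zero_iff, mul_eq_zero] at h5
      rcases h5 with (h5 | h5) | h5
      · linarith
      · linarith
      · norm_num at h5
    all_goals linarith
  · exact absurd h2 h1
  · exact absurd h2 h1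

lemma isBeanArc_descent_above {r : ℝ} : IsBeanArc (descent r) 0 r := by
  refine Or.inl ⟨0, r ^ 2, fun u hu => ?_⟩
  rw [descent_eq_of_le hu.2, zero_add]
  refine ⟨?_, rfl⟩
  simp only [Matrix.cons_val_one, Matrix.cons_val_fin_one]
  nlinarith [hu.1, hu.2]

lemma isBeanArc_descent_below {r : ℝ} (hr : r ∈ Ioc (0 : ℝ) 1) :
    IsBeanArc (descent r) r (flightTime r) := by
  refine Or.inr (Or.inl ⟨3 * r, -beanQ r, fun u hu => ?_⟩)
  rw [descent_eq_of_mem hu.1 hu.2]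
  exact ⟨by simpa using beanQ_sub_nonpos hr (flight_mem hu.1 hu.2), by rw [← sub_eq_add_neg]⟩

lemma isBeanArc_descent_slide {r : ℝ} (hr : r ∈ Ioc (0 : ℝ) 1) :
    IsBeanArc (descent r) (flightTime r) (descentTime r) := by
  refine Or.inr (Or.inr ⟨descentTime r, fun u hu => ?_⟩)
  rw [descent_eq_of_flightTime_le hr hu.1]
  obtain ⟨h1, h2, h3, -⟩ := slidePos_descentTime_sub hr hu.1 hu.2
  refine ⟨by simp, ?_, by simpa using h3⟩
  have := (slideStart_mem hr).2.2
  simp only [Matrix.cons_val_zero]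
  nlinarith

lemma IsBeanArc.mono {γ : ℝ → Plane} {a b a' b' : ℝ} (h : IsBeanArc γ a b) (ha : a ≤ a')
    (hb : b' ≤ b) : IsBeanArc γ a' b' :=
  isArc_bean_iff.1 ((isArc_bean_iff.2 h).mono ha hb)

lemma IsBeanArc.congr {γ δ : ℝ → Plane} {a b : ℝ} (h : IsBeanArc γ a b)
    (he : ∀ t ∈ Icc a b, δ t = γ t) : IsBeanArc δ a b :=
  isArc_bean_iff.1 ((isArc_bean_iff.2 h).congr he)

lemma IsBeanArc.continuousOn {γ : ℝ → Plane} {a b : ℝ} (h : IsBeanArc γ a b) :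
    ContinuousOn γ (Icc a b) := (isArc_bean_iff.2 h).continuousOn

lemma continuousOn_descent {r : ℝ} (hr : r ∈ Ioc (0 : ℝ) 1) :
    ContinuousOn (descent r) (Icc 0 (descentTime r)) := by
  have h1 := (isBeanArc_descent_below hr).continuousOn.union_of_isClosed
    (isBeanArc_descent_slide hr).continuousOn isClosed_Icc isClosed_Icc
  rw [Icc_union_Icc_eq_Icc (le_flightTime hr) (flightTime_le_descentTime hr)] at h1
  have h2 := isBeanArc_descent_above.continuousOn.union_of_isClosed h1 isClosed_Icc isClosed_Icc
  rwa [Icc_union_Icc_eq_Icc hr.1.le (lt_descentTime hr).le] at h2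

lemma descent_arc_right {r u : ℝ} (hr : r ∈ Ioc (0 : ℝ) 1) (hu : u ∈ Ico 0 (descentTime r)) :
    ∃ v ∈ Ioc u (descentTime r), IsBeanArc (descent r) u v := by
  rcases lt_or_ge u r with h | h
  · exact ⟨r, ⟨h, (lt_descentTime hr).le⟩, isBeanArc_descent_above.mono hu.1 le_rfl⟩
  · rcases lt_or_ge u (flightTime r) with h' | h'
    · exact ⟨_, ⟨h', flightTime_le_descentTime hr⟩, (isBeanArc_descent_below hr).mono h le_rfl⟩
    · exact ⟨_, ⟨hu.2, le_rfl⟩, (isBeanArc_descent_slide hr).mono h' le_rfl⟩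

lemma descent_arc_left {r u : ℝ} (hr : r ∈ Ioc (0 : ℝ) 1) (hu : u ∈ Ioc 0 (descentTime r)) :
    ∃ v ∈ Ico 0 u, IsBeanArc (descent r) v u := by
  rcases le_or_gt u r with h | h
  · exact ⟨0, ⟨le_rfl, hu.1⟩, isBeanArc_descent_above.mono le_rfl h⟩
  · rcases le_or_gt u (flightTime r) with h' | h'
    · exact ⟨r, ⟨hr.1.le, h⟩, (isBeanArc_descent_below hr).mono le_rfl h'⟩
    · exact ⟨_, ⟨hr.1.le.trans (le_flightTime hr), h'⟩,
        (isBeanArc_descent_slide hr).mono le_rfl hu.2⟩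

/-! ### Forward determinism on the right half of the bean -/

/-- Wherever a trajectory meets a descent, it follows the descent for a short time. -/
lemma IsBeanArc.eq_descent {γ : ℝ → Plane} {t ε r u : ℝ} (hε : 0 < ε)
    (h : IsBeanArc γ t (t + ε)) (hr : r ∈ Ioc (0 : ℝ) 1) (hu : u ∈ Ico 0 (descentTime r))
    (hγ : γ t = descent r u) :
    ∃ δ > 0, ∀ s ∈ Ioc t (t + δ), γ s = descent r (u + (s - t)) := by
  have htm : t ∈ Icc t (t + ε) := ⟨le_rfl, by linarith⟩
  have hpt : ∀ {x y : ℝ}, γ t = !₂[x, y] → γ t 0 = x ∧ γ t 1 = y := fun h => by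
    rw [h]
    exact ⟨by simp, by simp⟩
  rcases lt_or_ge u r with h1 | h1
  · -- above `Σ`, only `beanX` is available
    rw [descent_eq_of_le h1.le] at hγ
    obtain ⟨hx, hy⟩ := hpt hγ
    have hy0 : 0 < γ t 1 := by nlinarith [hu.1]
    rcases h with ⟨x₀, e, h⟩ | ⟨x₀, e, h⟩ | ⟨c, h⟩
    · obtain ⟨hx', hy'⟩ := hpt (h t htm).2
      refine ⟨min ε (r - u), lt_min hε (by linarith), fun s hs => ?_⟩
      have h2 : s ≤ t + ε := hs.2.trans (by linarith [min_le_left ε (r - u)])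
      have h3 : s ≤ t + (r - u) := hs.2.trans (by linarith [min_le_right ε (r - u)])
      rw [(h s ⟨hs.1.le, h2⟩).2, descent_eq_of_le (by linarith)]
      have h4 : x₀ + s = u + (s - t) := by linarith
      have h5 : e = r ^ 2 := by
        have : x₀ + t = u := by linarith
        rw [this] at hy'
        linarith
      rw [h4, h5]
    · linarith [(h t htm).1]
    · linarith [(h t htm).1]
  · rcases lt_or_ge u (flightTime r) with h2 | h2
    · -- below `Σ`, or at a point where `beanX` and `beanY` point down
      have hm := flight_mem h1 h2.le
      rw [descent_eq_of_mem h1 h2.le] at hγ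
      obtain ⟨hx, hy⟩ := hpt hγ
      have hr2 : 1 < 2 * r ^ 2 := by
        unfold flightTime at h2
        rcases slideStart_cases hr with ⟨h4, h5⟩ | ⟨h4, -⟩
        · linarith
        · exact h4
      have hneg : γ t 1 = 0 → u = r := fun h0 => by
        have hu' : u ∈ Icc 0 (descentTime r) := ⟨hu.1, hu.2.le⟩
        have := descent_invariant hr hu'
        rw [descent_eq_of_mem h1 h2.le, ← hγ, h0] at this
        rcases this with h3 | h3 | h3 | h3
        · linarith [h3.1]
        · linarith [h3.1]
        · exact h3.2
        · linarith [h3.2]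
      have hle := beanQ_sub_nonpos hr hm
      rcases h with ⟨x₀, e, h⟩ | ⟨x₀, e, h⟩ | ⟨c, h⟩
      · exfalso
        have h0 : γ t 1 = 0 := le_antisymm (by linarith) (h t htm).1
        have hur := hneg h0
        obtain ⟨hx', hy'⟩ := hpt (h t htm).2
        have h3 := h (t + ε) ⟨by linarith, le_rfl⟩
        have h4 : γ (t + ε) 1 = e - (x₀ + (t + ε)) ^ 2 := by rw [h3.2]; simp
        have h5 : x₀ + t = r := by linarith
        have h6 : x₀ + (t + ε) = r + ε := by linarith
        rw [h5, h0] at hy'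
        rw [h6] at h4
        nlinarith [h3.1, hr.1]
      · obtain ⟨hx', hy'⟩ := hpt (h t htm).2
        refine ⟨min ε (flightTime r - u), lt_min hε (by linarith), fun s hs => ?_⟩
        have h3 : s ≤ t + ε := hs.2.trans (by linarith [min_le_left ε (flightTime r - u)])
        have h4 : s ≤ t + (flightTime r - u) :=
          hs.2.trans (by linarith [min_le_right ε (flightTime r - u)])
        rw [(h s ⟨hs.1.le, h3⟩).2, descent_eq_of_mem (by linarith [hs.1]) (by linarith)]
        have h5 : x₀ - 2 * s = 3 * r - 2 * (u + (s - t)) := by linarith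
        have h6 : e = -beanQ r := by
          have : x₀ - 2 * t = 3 * r - 2 * u := by linarith
          rw [this] at hy'
          linarith
        rw [h5, h6, ← sub_eq_add_neg]
      · exfalso
        have h3 := h t htm
        have := hneg h3.1
        rw [hx, this] at h3
        nlinarith [h3.2.1]
    · -- at a sliding point, `beanX` points down and `beanY` points up
      rw [descent_eq_of_flightTime_le hr h2] at hγ
      obtain ⟨hx, hy⟩ := hpt hγ
      obtain ⟨hs1, hs2, hs3, hs4⟩ := slidePos_descentTime_sub hr h2 hu.2.le
      have hs5 := hs4 hu.2
      have hs6 := (slideStart_mem hr).2.2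
      rw [← hx] at hs1 hs2 hs3 hs5
      have hs7 : 2 * γ t 0 ^ 2 ≤ 1 := by nlinarith
      rcases h with ⟨x₀, e, h⟩ | ⟨x₀, e, h⟩ | ⟨c, h⟩
      · exfalso
        obtain ⟨hx', hy'⟩ := hpt (h t htm).2
        have h3 := h (t + ε) ⟨by linarith, le_rfl⟩
        have h4 : γ (t + ε) 1 = e - (x₀ + (t + ε)) ^ 2 := by rw [h3.2]; simp
        have h6 : x₀ + (t + ε) = γ t 0 + ε := by linarith
        rw [← hx', hy] at hy'
        rw [h6] at h4
        nlinarith [h3.1]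
      · exfalso
        obtain ⟨hx', hy'⟩ := hpt (h t htm).2
        set d := min ε (γ t 0 / 2) with hd
        have hd0 : 0 < d := lt_min hε (by linarith)
        have hd1 : d ≤ ε := min_le_left _ _
        have hd2 : d ≤ γ t 0 / 2 := min_le_right _ _
        have h3 := h (t + d) ⟨by linarith, by linarith⟩
        have h4 : γ (t + d) 1 = beanQ (x₀ - 2 * (t + d)) + e := by rw [h3.2]; simp
        have h6 : x₀ - 2 * (t + d) = γ t 0 - 2 * d := by linarith
        rw [← hx', hy] at hy'
        rw [h6] at h4
        have h7 := beanQ_sub (γ t 0 - 2 * d) (γ t 0)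
        have h8 : 0 < γ t 0 ^ 2 - (γ t 0 - 2 * d) ^ 2 := by nlinarith
        have h9 : 0 < 1 - γ t 0 ^ 2 - (γ t 0 - 2 * d) ^ 2 := by linarith
        have h10 := mul_pos h8 h9
        linarith [h3.1]
      · refine ⟨ε, hε, fun s hs => ?_⟩
        have h3 := h s ⟨hs.1.le, hs.2⟩
        have h4 := mem_Icc_of_two_mul_sq_le h3.2.1
        rw [descent_eq_of_flightTime_le hr (by linarith [hs.1]),
          show descentTime r - (u + (s - t)) = slideTime (γ s 0) by
            have := (h t htm).2.2
            linarith [h3.2.2], slidePos_slideTime ⟨h4.1.le, h4.2.le⟩]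
        exact plane_ext (by simp) (by simp [h3.1])

/-! ### Time reversal and the bumps of a trajectory of the bean field -/

/-- The reflection in the `y`-axis. -/
def mirror (p : Plane) : Plane := !₂[-p 0, p 1]

@[simp] lemma mirror_apply_zero (p : Plane) : mirror p 0 = -p 0 := by simp [mirror]

@[simp] lemma mirror_apply_one (p : Plane) : mirror p 1 = p 1 := by simp [mirror]

@[simp] lemma mirror_mirror (p : Plane) : mirror (mirror p) = p := plane_ext (by simp) (by simp)

@[simp] lemma mirror_zero : mirror 0 = 0 := plane_ext (by simp) (by simp)

lemma mirror_injective : Function.Injective mirror := fun p q h => by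
  rw [← mirror_mirror p, h, mirror_mirror]

lemma mirror_eq_zero_iff {p : Plane} : mirror p = 0 ↔ p = 0 :=
  ⟨fun h => mirror_injective (h.trans mirror_zero.symm), fun h => by rw [h, mirror_zero]⟩

/-- The reflected curve run backwards. The bean field is reversible: this operation preserves its
trajectories. -/
def timeReverse (γ : ℝ → Plane) (t : ℝ) : Plane := mirror (γ (-t))

lemma IsBeanArc.reverse {γ : ℝ → Plane} {a b : ℝ} (h : IsBeanArc γ a b) :
    IsBeanArc (timeReverse γ) (-b) (-a) := by
  have hm : ∀ {t}, t ∈ Icc (-b) (-a) → -t ∈ Icc a b := fun ht =>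
    ⟨by linarith [ht.2], by linarith [ht.1]⟩
  rcases h with ⟨x₀, e, h⟩ | ⟨x₀, e, h⟩ | ⟨c, h⟩
  · refine Or.inl ⟨-x₀, e, fun t ht => ⟨by simpa [timeReverse] using (h _ (hm ht)).1, ?_⟩⟩
    rw [timeReverse, (h _ (hm ht)).2]
    refine plane_ext (by simp; ring) ?_
    simp only [mirror_apply_one, Matrix.cons_val_one, Matrix.cons_val_fin_one]
    ring
  · refine Or.inr (Or.inl ⟨-x₀, e, fun t ht => ⟨by simpa [timeReverse] using (h _ (hm ht)).1, ?_⟩⟩)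
    rw [timeReverse, (h _ (hm ht)).2]
    refine plane_ext (by simp; ring) ?_
    simp only [mirror_apply_one, Matrix.cons_val_one, Matrix.cons_val_fin_one, beanQ]
    ring
  · refine Or.inr (Or.inr ⟨-c, fun t ht => ?_⟩)
    obtain ⟨h1, h2, h3⟩ := h _ (hm ht)
    refine ⟨by simpa [timeReverse] using h1, by simpa [timeReverse] using h2, ?_⟩
    rw [timeReverse, mirror_apply_zero, slideTime_neg, h3]
    ring

lemma isLocalTrajectoryOn_bean_iff {J : Set ℝ} {γ : ℝ → Plane} :
    IsLocalTrajectoryOn beanX beanY J γ ↔ ∀ t ∈ J, ∃ ε > 0, Icc (t - ε) (t + ε) ⊆ J ∧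
      IsBeanArc γ (t - ε) t ∧ IsBeanArc γ t (t + ε) := by
  simp only [IsLocalTrajectoryOn, isArc_bean_iff]

lemma IsLocalTrajectoryOn.reverse {J : Set ℝ} {γ : ℝ → Plane}
    (h : IsLocalTrajectoryOn beanX beanY J γ) :
    IsLocalTrajectoryOn beanX beanY {t | -t ∈ J} (timeReverse γ) := by
  rw [isLocalTrajectoryOn_bean_iff] at h ⊢
  intro t ht
  obtain ⟨ε, hε, hsub, hl, hr⟩ := h (-t) ht
  refine ⟨ε, hε, fun s hs => hsub ⟨by linarith [hs.2], by linarith [hs.1]⟩, ?_, ?_⟩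
  · have := hr.reverse
    rwa [neg_add, neg_neg, ← sub_eq_add_neg] at this
  · have := hl.reverse
    rwa [neg_sub, neg_neg, sub_neg_eq_add, add_comm ε] at this

lemma ordConnected_neg {J : Set ℝ} (hJ : J.OrdConnected) : {t | -t ∈ J}.OrdConnected :=
  ⟨fun _ hx _ hy _ hz => hJ.out hy hx ⟨neg_le_neg hz.2, neg_le_neg hz.1⟩⟩

lemma IsTrajectoryOn.reverse {J : Set ℝ} {γ : ℝ → Plane} (h : IsTrajectoryOn beanX beanY J γ) :
    IsTrajectoryOn beanX beanY {t | -t ∈ J} (timeReverse γ) := by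
  rw [isTrajectoryOn_iff] at h ⊢
  obtain ⟨⟨s, hs⟩, hJ, h⟩ := h
  exact ⟨⟨-s, by simpa using hs⟩, ordConnected_neg hJ, h.reverse⟩

lemma IsMaximalTrajectory.reverse {J : Set ℝ} {γ : ℝ → Plane}
    (h : IsMaximalTrajectory beanX beanY J γ) :
    IsMaximalTrajectory beanX beanY {t | -t ∈ J} (timeReverse γ) := by
  refine ⟨h.1.reverse, fun J' γ' h' hsub heq => ?_⟩
  have := h.2 _ _ h'.reverse (fun t ht => hsub (by simpa using ht)) fun t ht => by
    rw [timeReverse, heq (by simpa using ht), timeReverse, mirror_mirror, neg_neg]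
  rw [← this]
  ext t
  simp

/-- Arcs are injective, because the abscissa is strictly monotone along them. -/
lemma IsBeanArc.injOn {γ : ℝ → Plane} {a b : ℝ} (h : IsBeanArc γ a b) : InjOn γ (Icc a b) := by
  intro s hs t ht hst
  have h0 : γ s 0 = γ t 0 := by rw [hst]
  rcases h with ⟨x₀, e, h⟩ | ⟨x₀, e, h⟩ | ⟨c, h⟩
  · rw [(h s hs).2, (h t ht).2] at h0
    simpa using h0
  · rw [(h s hs).2, (h t ht).2] at h0
    simpa using h0
  · have h1 := (h s hs).2.2
    rw [h0, (h t ht).2.2] at h1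
    linarith

/-- An arc that meets the bean stays in it. -/
lemma IsBeanArc.mem_LambdaBean {γ : ℝ → Plane} {a b s t : ℝ} (h : IsBeanArc γ a b)
    (hs : s ∈ Icc a b) (ht : t ∈ Icc a b) (hγ : γ s ∈ LambdaBean) : γ t ∈ LambdaBean := by
  have key : ∀ {x y : ℝ}, x ^ 2 ≤ 1 → beanQ x ≤ y → y ≤ 1 - x ^ 2 →
      (!₂[x, y] : Plane) ∈ LambdaBean := fun {x y} h1 h2 h3 => by
    refine ⟨?_, ?_⟩
    · simp only [Matrix.cons_val_zero]
      constructor <;> nlinarith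
    · simp only [Matrix.cons_val_zero, Matrix.cons_val_one, Matrix.cons_val_fin_one]
      exact ⟨h2, h3⟩
  obtain ⟨-, h2, h3⟩ := hγ
  rcases h with ⟨x₀, e, h⟩ | ⟨x₀, e, h⟩ | ⟨c, h⟩
  · rw [(h s hs).2] at h3
    obtain ⟨h4, h5⟩ := h t ht
    rw [h5] at h4 ⊢
    simp only [Matrix.cons_val_zero, Matrix.cons_val_one, Matrix.cons_val_fin_one] at h3 h4
    have h6 : (x₀ + t) ^ 2 ≤ 1 := by linarith
    refine key h6 ?_ (by linarith)
    unfold beanQ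
    nlinarith [sq_nonneg (x₀ + t)]
  · rw [(h s hs).2] at h2
    obtain ⟨h4, h5⟩ := h t ht
    rw [h5] at h4 ⊢
    simp only [Matrix.cons_val_zero, Matrix.cons_val_one, Matrix.cons_val_fin_one] at h2 h4
    have he : 0 ≤ e := by
      unfold beanQ at h2
      linarith
    have h6 : (x₀ - 2 * t) ^ 2 ≤ 1 := by
      by_contra hlt
      unfold beanQ at h4
      nlinarith
    exact key h6 (by linarith) (by linarith)
  · obtain ⟨h4, h5, -⟩ := h t ht
    have h6 : γ t = !₂[γ t 0, 0] := plane_ext (by simp) (by simp [h4])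
    rw [h6]
    refine key (by linarith) ?_ (by linarith)
    unfold beanQ
    nlinarith [sq_nonneg (γ t 0)]

lemma mirror_mem_LambdaBean {p : Plane} (hp : p ∈ LambdaBean) : mirror p ∈ LambdaBean := by
  obtain ⟨h1, h2⟩ := hp
  refine ⟨?_, ?_⟩
  · rw [mirror_apply_zero]
    exact ⟨by linarith [h1.2], by linarith [h1.1]⟩
  · simpa [mirror_apply_zero, mirror_apply_one, even_two.neg_pow,
      (by decide : Even 4).neg_pow] using h2

/-- A trajectory that meets a descent follows it up to the origin. -/
lemma IsLocalTrajectoryOn.eq_descent {J : Set ℝ} {γ : ℝ → Plane} {t r u : ℝ}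
    (hγ : IsLocalTrajectoryOn beanX beanY J γ) (hJ : J.OrdConnected) (ht : t ∈ J)
    (hr : r ∈ Ioc (0 : ℝ) 1) (hu : 0 ≤ u) (h : γ t = descent r u) :
    ∀ s ∈ J, t ≤ s → s ≤ t + (descentTime r - u) → γ s = descent r (u + (s - t)) := by
  intro s hs hts hsu
  have hsub : Icc t s ⊆ J := hJ.out ht hs
  refine eqOn_Icc_of_local (δ := fun s => descent r (u + (s - t))) (a := t) (b := s)
    (fun w hw => (hγ.continuousAt (hsub hw)).continuousWithinAt) ?_ (by simpa using h) ?_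
    s ⟨hts, le_rfl⟩
  · refine (continuousOn_descent hr).comp (by fun_prop) fun w hw => ?_
    exact ⟨by linarith [hw.1], by linarith [hw.2]⟩
  · intro w hw hγw
    obtain ⟨ε, hε, -, -, harc⟩ := isLocalTrajectoryOn_bean_iff.1 hγ w (hsub ⟨hw.1, hw.2.le⟩)
    obtain ⟨δ, hδ, H⟩ := harc.eq_descent hε hr ⟨by linarith [hw.1], by linarith [hw.2]⟩ hγw
    exact ⟨δ, hδ, fun v hv _ => by rw [H v hv]; congr 1; ring⟩

/-- A trajectory that meets a reversed descent has followed it from the origin. -/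
lemma IsLocalTrajectoryOn.eq_mirror_descent {J : Set ℝ} {γ : ℝ → Plane} {t r u : ℝ}
    (hγ : IsLocalTrajectoryOn beanX beanY J γ) (hJ : J.OrdConnected) (ht : t ∈ J)
    (hr : r ∈ Ioc (0 : ℝ) 1) (hu : 0 ≤ u) (h : γ t = mirror (descent r u)) :
    ∀ s ∈ J, s ≤ t → t - (descentTime r - u) ≤ s → γ s = mirror (descent r (u + (t - s))) := by
  intro s hs hst hsu
  have := hγ.reverse.eq_descent (ordConnected_neg hJ) (t := -t) (by simpa using ht) hr hu
    (by rw [timeReverse, neg_neg, h, mirror_mirror]) (-s) (by simpa using hs) (by linarith)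
    (by linarith)
  rw [timeReverse, neg_neg] at this
  rw [← mirror_mirror (γ s), this]
  congr 2
  ring

/-- The descents sweep the right half of the bean. -/
lemma exists_eq_descent {p : Plane} (hp : p ∈ LambdaBean) (h : 0 < p 0 ∨ p 0 = 0 ∧ 0 < p 1) :
    ∃ r ∈ Ioc (0 : ℝ) 1, ∃ u ∈ Ico 0 (descentTime r), p = descent r u := by
  obtain ⟨h1, h2, h3⟩ := hp
  have hx : 0 ≤ p 0 := by
    rcases h with h | h
    · exact h.le
    · exact h.1.ge
  rcases lt_trichotomy (p 1) 0 with hy | hy | hy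
  · -- `p` lies on the level `y - beanQ(x) = c`, and `r` is the root of `beanQ(r) = -c`
    -- with `2r² > 1`
    have hx0 : 0 < p 0 := by
      rcases h with h | h
      · exact h
      · linarith [h.2]
    set c := p 1 - beanQ (p 0) with hc
    have hc0 : 0 ≤ c := by
      rw [hc]
      unfold beanQ
      linarith
    have hc1 : 8 * c < 1 := by
      have : beanQ (p 0) = ((2 * p 0 ^ 2 - 1) ^ 2 - 1) / 8 := by
        unfold beanQ
        ring
      rw [hc, this]
      nlinarith [sq_nonneg (2 * p 0 ^ 2 - 1)]
    set d := √(1 - 8 * c) with hd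
    have hd0 : 0 < d := Real.sqrt_pos.2 (by linarith)
    have hd2 : d ^ 2 = 1 - 8 * c := Real.sq_sqrt (by linarith)
    set r := √((1 + d) / 2) with hrdef
    have hr2 : r ^ 2 = (1 + d) / 2 := Real.sq_sqrt (by linarith)
    have hr0 : 0 < r := Real.sqrt_pos.2 (by linarith)
    have hr1 : r ≤ 1 := Real.sqrt_le_one.2 (by
      linarith [Real.sqrt_le_one.2 (show 1 - 8 * c ≤ 1 by linarith)])
    have hr : r ∈ Ioc (0 : ℝ) 1 := ⟨hr0, hr1⟩
    have hQ : beanQ r = -c := by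
      have : beanQ r = ((2 * r ^ 2 - 1) ^ 2 - 1) / 8 := by
        unfold beanQ
        ring
      rw [this, hr2, show 2 * ((1 + d) / 2) - 1 = d by ring, hd2]
      ring
    have hfac := beanQ_sub (p 0) r
    have hneg : (r ^ 2 - p 0 ^ 2) * (1 - r ^ 2 - p 0 ^ 2) < 0 := by linarith
    rcases slideStart_cases hr with ⟨h4, h5⟩ | ⟨h4, h5, h6, h7⟩
    · linarith
    · have h8 : p 0 < r := by
        by_contra hcon
        have h9 : r ^ 2 ≤ p 0 ^ 2 := pow_le_pow_left₀ hr0.le (not_lt.1 hcon) 2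
        have h10 : 0 ≤ (r ^ 2 - p 0 ^ 2) * (1 - r ^ 2 - p 0 ^ 2) :=
          mul_nonneg_of_nonpos_of_nonpos (by linarith) (by linarith)
        linarith
      have h9 : slideStart r < p 0 := by
        by_contra hcon
        have h9 : p 0 ^ 2 ≤ slideStart r ^ 2 := pow_le_pow_left₀ hx (not_lt.1 hcon) 2
        have h10 : p 0 ^ 2 < r ^ 2 := pow_lt_pow_left₀ h8 hx two_ne_zero
        have h11 : 0 ≤ (r ^ 2 - p 0 ^ 2) * (1 - r ^ 2 - p 0 ^ 2) :=
          mul_nonneg (by linarith) (by linarith)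
        linarith
      have h10 : r ≤ (3 * r - p 0) / 2 := by linarith
      have h11 : (3 * r - p 0) / 2 < flightTime r := by
        unfold flightTime
        linarith
      refine ⟨r, hr, (3 * r - p 0) / 2,
        ⟨by linarith, h11.trans_le (flightTime_le_descentTime hr)⟩, ?_⟩
      rw [descent_eq_of_mem h10 h11.le, show 3 * r - 2 * ((3 * r - p 0) / 2) = p 0 by ring]
      exact plane_ext (by simp) (by simp [hQ, hc])
  · have hx0 : 0 < p 0 := by
      rcases h with h | h
      · exact h
      · linarith [h.2]
    have hr : p 0 ∈ Ioc (0 : ℝ) 1 := ⟨hx0, h1.2⟩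
    refine ⟨p 0, hr, p 0, ⟨hx, lt_descentTime hr⟩, ?_⟩
    rw [descent_eq_of_le le_rfl]
    exact plane_ext (by simp) (by simp [hy])
  · have hpos : 0 < p 1 + p 0 ^ 2 := by positivity
    have hr2 : √(p 1 + p 0 ^ 2) ^ 2 = p 1 + p 0 ^ 2 := Real.sq_sqrt hpos.le
    have hr : √(p 1 + p 0 ^ 2) ∈ Ioc (0 : ℝ) 1 :=
      ⟨Real.sqrt_pos.2 hpos, Real.sqrt_le_one.2 (by linarith)⟩
    have hle : p 0 ≤ √(p 1 + p 0 ^ 2) := Real.le_sqrt_of_sq_le (by linarith)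
    refine ⟨_, hr, p 0, ⟨hx, hle.trans_lt (lt_descentTime hr)⟩, ?_⟩
    rw [descent_eq_of_le hle, hr2]
    exact plane_ext (by simp) (by simp)

/-- Trajectories leave the origin to the left. -/
lemma IsBeanArc.neg_of_eq_zero {γ : ℝ → Plane} {a b s : ℝ} (h : IsBeanArc γ a b) (h0 : γ a = 0)
    (hs : s ∈ Ioc a b) : γ s 0 < 0 := by
  have ha : a ∈ Icc a b := ⟨le_rfl, hs.1.le.trans hs.2⟩
  have hs' : s ∈ Icc a b := ⟨hs.1.le, hs.2⟩
  have hx : γ a 0 = 0 := by simp [h0]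
  have hy : γ a 1 = 0 := by simp [h0]
  rcases h with ⟨x₀, e, h⟩ | ⟨x₀, e, h⟩ | ⟨c, h⟩
  · exfalso
    rw [(h a ha).2] at hx hy
    obtain ⟨h3, h4⟩ := h s hs'
    rw [h4] at h3
    simp only [Matrix.cons_val_zero, Matrix.cons_val_one, Matrix.cons_val_fin_one] at h3 hx hy
    have : x₀ + s = s - a := by linarith
    rw [hx] at hy
    rw [this] at h3
    nlinarith [hs.1]
  · rw [(h a ha).2] at hx
    rw [(h s hs').2]
    simp only [Matrix.cons_val_zero] at hx ⊢
    linarith [hs.1]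
  · obtain ⟨-, h4, h5⟩ := h s hs'
    have h6 := (h a ha).2.2
    rw [hx, slideTime_zero] at h6
    by_contra hcon
    have h7 := mem_Icc_of_two_mul_sq_le h4
    have h8 := strictMonoOn_slideTime.monotoneOn (by norm_num) ⟨h7.1.le, h7.2.le⟩ (not_lt.1 hcon)
    rw [slideTime_zero] at h8
    linarith [hs.1]

lemma IsLocalTrajectoryOn.neg_right_of_eq_zero {J : Set ℝ} {γ : ℝ → Plane} {t : ℝ}
    (hγ : IsLocalTrajectoryOn beanX beanY J γ) (ht : t ∈ J) (h : γ t = 0) :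
    ∃ δ > 0, Icc t (t + δ) ⊆ J ∧ ∀ s ∈ Ioc t (t + δ), γ s 0 < 0 := by
  obtain ⟨ε, hε, hsub, -, harc⟩ := isLocalTrajectoryOn_bean_iff.1 hγ t ht
  exact ⟨ε, hε, (Icc_subset_Icc_left (by linarith)).trans hsub,
    fun s hs => harc.neg_of_eq_zero h hs⟩

lemma IsLocalTrajectoryOn.pos_left_of_eq_zero {J : Set ℝ} {γ : ℝ → Plane} {t : ℝ}
    (hγ : IsLocalTrajectoryOn beanX beanY J γ) (ht : t ∈ J) (h : γ t = 0) :
    ∃ δ > 0, ∀ s ∈ Ico (t - δ) t, 0 < γ s 0 := by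
  obtain ⟨δ, hδ, -, H⟩ := hγ.reverse.neg_right_of_eq_zero (t := -t) (by simpa using ht)
    (by rw [timeReverse, neg_neg, h, mirror_zero])
  refine ⟨δ, hδ, fun s hs => ?_⟩
  have := H (-s) ⟨by linarith [hs.2], by linarith [hs.1]⟩
  rw [timeReverse, neg_neg, mirror_apply_zero] at this
  linarith

/-- The square root of `1/2` is the largest abscissa of a sliding point. -/
lemma slideStart_le_sqrt_half {r : ℝ} (hr : r ∈ Ioc (0 : ℝ) 1) : slideStart r ≤ √(1 / 2) :=
  Real.le_sqrt_of_sq_le (by linarith [(slideStart_mem hr).2.2])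

lemma sqrt_half_mem : √(1 / 2) ∈ Ioc (0 : ℝ) 1 :=
  ⟨by positivity, Real.sqrt_le_one.2 (by norm_num)⟩

lemma slideStart_sqrt_half : slideStart √(1 / 2) = √(1 / 2) := by
  have h : √(1 / 2 : ℝ) ^ 2 = 1 / 2 := Real.sq_sqrt (by norm_num)
  rcases slideStart_cases sqrt_half_mem with h1 | h1
  · exact h1.1
  · linarith [h1.1]

/-- From the origin, a trajectory in the bean follows a reversed descent. -/
lemma IsLocalTrajectoryOn.exists_eq_mirror_descent {J : Set ℝ} {γ : ℝ → Plane} {c : ℝ}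
    (hγ : IsLocalTrajectoryOn beanX beanY J γ) (hJ : J.OrdConnected)
    (hL : ∀ t ∈ J, γ t ∈ LambdaBean) (hc : c ∈ J) (h0 : γ c = 0) :
    ∃ r ∈ Ioc (0 : ℝ) 1, ∀ s ∈ J, c ≤ s → s ≤ c + descentTime r →
      γ s = mirror (descent r (descentTime r - (s - c))) := by
  have hcx : γ c 0 = 0 := by simp [h0]
  obtain ⟨δ, hδ, hδJ, hneg⟩ := hγ.neg_right_of_eq_zero hc h0
  by_cases hret : ∃ s ∈ J, c < s ∧ 0 ≤ γ s 0
  · -- if the trajectory comes back to the `y`-axis, follow it backwards from there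
    obtain ⟨s, hs, hcs, hsx⟩ := hret
    have hδs : c + δ ≤ s := by
      by_contra hcon
      linarith [hneg s ⟨hcs, (not_le.1 hcon).le⟩]
    have hsub : Icc (c + δ) s ⊆ J := (Icc_subset_Icc_left (by linarith)).trans (hJ.out hc hs)
    have hcont : ContinuousOn (fun t => γ t 0) (Icc (c + δ) s) := fun w hw => by
      have h1 : Continuous fun p : Plane => p 0 := by fun_prop
      exact (h1.continuousAt.comp (hγ.continuousAt (hsub hw))).continuousWithinAt
    have hne : (Icc (c + δ) s ∩ {t | 0 ≤ γ t 0}).Nonempty := ⟨s, ⟨hδs, le_rfl⟩, hsx⟩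
    have hcpt : IsCompact (Icc (c + δ) s ∩ {t | 0 ≤ γ t 0}) :=
      isCompact_Icc.of_isClosed_subset
        (hcont.preimage_isClosed_of_isClosed isClosed_Icc isClosed_Ici) inter_subset_left
    obtain ⟨t, ⟨ht, htx⟩, hleast⟩ := hcpt.exists_isLeast hne
    have hbefore : ∀ w ∈ Ioo c t, γ w 0 < 0 := fun w hw => by
      by_contra hcon
      rcases le_or_gt w (c + δ) with h | h
      · exact hcon (hneg w ⟨hw.1, h⟩)
      · exact absurd (hleast ⟨⟨h.le, hw.2.le.trans ht.2⟩, not_lt.1 hcon⟩) (not_le.2 hw.2)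
    have hct : c < t := by linarith [ht.1]
    have htJ : t ∈ J := hsub ht
    have hx0 : γ t 0 = 0 := by
      by_contra hcon
      obtain ⟨w, hw, hwx⟩ := intermediate_value_Icc ht.1
        (hcont.mono (Icc_subset_Icc_right ht.2)) (show (0 : ℝ) ∈ Icc _ _ from
          ⟨(hneg (c + δ) ⟨by linarith, le_rfl⟩).le, htx⟩)
      simp only at hwx
      rcases hw.2.eq_or_lt with h | h
      · exact hcon (h ▸ hwx)
      · linarith [hbefore w ⟨by linarith [hw.1], h⟩]
    have hy0 : 0 ≤ γ t 1 := by
      have := (hL t htJ).2.1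
      rw [hx0] at this
      norm_num at this
      exact this
    rcases hy0.eq_or_lt with hy | hy
    · exfalso
      obtain ⟨δ', hδ', hpos⟩ := hγ.pos_left_of_eq_zero htJ
        (plane_ext (by simp [hx0]) (by simp [← hy]))
      have h1 : max ((c + t) / 2) (t - δ') < t := max_lt (by linarith) (by linarith)
      have h2 := hpos _ ⟨le_max_right ((c + t) / 2) (t - δ'), h1⟩
      have h3 := hbefore _ ⟨(show c < (c + t) / 2 by linarith).trans_le
        (le_max_left ((c + t) / 2) (t - δ')), h1⟩
      linarith
    · have hr2 : √(γ t 1) ^ 2 = γ t 1 := Real.sq_sqrt hy.le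
      have hr : √(γ t 1) ∈ Ioc (0 : ℝ) 1 := by
        refine ⟨Real.sqrt_pos.2 hy, Real.sqrt_le_one.2 ?_⟩
        have := (hL t htJ).2.2
        rw [hx0] at this
        norm_num at this
        exact this
      set r := √(γ t 1)
      have hγt : γ t = mirror (descent r 0) := by
        rw [descent_zero hr]
        exact plane_ext (by simp [hx0]) (by simp [hr2])
      have hback := hγ.eq_mirror_descent hJ htJ hr le_rfl hγt
      simp only [sub_zero, zero_add] at hback
      have hct' : c = t - descentTime r := by
        rcases lt_trichotomy c (t - descentTime r) with h | h | h
        · exfalso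
          have hτ := descentTime_pos hr
          have h1 : t - descentTime r ∈ J := hJ.out hc htJ ⟨h.le, by linarith⟩
          have h2 := hback _ h1 (by linarith) le_rfl
          rw [sub_sub_cancel, descent_descentTime hr, mirror_zero] at h2
          have h3 := hbefore _ ⟨h, by linarith⟩
          rw [h2] at h3
          simp at h3
        · exact h
        · exfalso
          have h2 := hback c hc hct.le h.le
          have h3 := descent_pos hr (u := t - c) ⟨by linarith, by linarith⟩
          rw [h2, mirror_apply_zero] at hcx
          linarith
      refine ⟨r, hr, fun w hw h1 h2 => ?_⟩
      rw [hback w hw (by linarith) (by linarith)]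
      congr 2
      linarith
  · push Not at hret
    have key : ∀ s ∈ J, c < s → ∃ r ∈ Ioc (0 : ℝ) 1, s < c + descentTime r ∧
        ∀ w ∈ Icc c s, γ w = mirror (descent r (descentTime r - (w - c))) := fun s hs hcs => by
      obtain ⟨r, hr, u, hu, hp⟩ := exists_eq_descent (mirror_mem_LambdaBean (hL s hs))
        (Or.inl (by rw [mirror_apply_zero]; linarith [hret s hs hcs]))
      have hγs : γ s = mirror (descent r u) := by rw [← hp, mirror_mirror]
      have hu0 : 0 < u := by
        rcases hu.1.eq_or_lt with h | h
        · exfalso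
          have := hret s hs hcs
          rw [hγs, ← h, descent_zero hr] at this
          simp at this
        · exact h
      have hback := hγ.eq_mirror_descent hJ hs hr hu.1 hγs
      have hcs' : c = s - (descentTime r - u) := by
        rcases lt_trichotomy c (s - (descentTime r - u)) with h | h | h
        · exfalso
          have h1 : s - (descentTime r - u) ∈ J := hJ.out hc hs ⟨h.le, by linarith [hu.2]⟩
          have h2 := hback _ h1 (by linarith [hu.2]) le_rfl
          rw [sub_sub_cancel, add_sub_cancel, descent_descentTime hr, mirror_zero] at h2
          have h3 := hret _ h1 h
          rw [h2] at h3
          simp at h3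
        · exact h
        · exfalso
          have h2 := hback c hc hcs.le h.le
          have h3 := descent_pos hr (u := u + (s - c)) ⟨by linarith, by linarith⟩
          rw [h2, mirror_apply_zero] at hcx
          linarith
      refine ⟨r, hr, by linarith, fun w hw => ?_⟩
      rw [hback w (hJ.out hc hs hw) hw.2 (by linarith [hw.1])]
      congr 2
      linarith
    by_cases hy : ∃ s ∈ J, c < s ∧ γ s 1 ≠ 0
    · -- a point off the switching line determines the amplitude
      obtain ⟨s, hs, hcs, hy⟩ := hy
      obtain ⟨r, hr, hsr, H⟩ := key s hs hcs
      refine ⟨r, hr, fun w hw hcw _ => ?_⟩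
      have hm : max w s ∈ J := by
        rcases max_choice w s with h | h <;> rw [h] <;> assumption
      obtain ⟨r', hr', hsr', H'⟩ := key _ hm (hcs.trans_le (le_max_right _ _))
      have hsw := le_max_right w s
      have h1 := H s ⟨hcs.le, le_rfl⟩
      have h2 := H' s ⟨hcs.le, hsw⟩
      have h3 : r = r' := by
        refine eq_of_descent_eq hr hr' (u := descentTime r - (s - c))
          (u' := descentTime r' - (s - c)) ⟨by linarith, by linarith⟩
          ⟨by linarith, by linarith⟩ (mirror_injective (h1.symm.trans h2)) ?_
        rw [← mirror_apply_one, ← h1]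
        exact hy
      rw [h3]
      exact H' w ⟨hcw, le_max_left _ _⟩
    · -- a trajectory that only slides follows every reversed descent that slides long enough
      push Not at hy
      have hfl : flightTime √(1 / 2) = √(1 / 2) := by
        rw [flightTime, slideStart_sqrt_half]
        ring
      refine ⟨√(1 / 2), sqrt_half_mem, fun s hs hcs hsr => ?_⟩
      rcases hcs.eq_or_lt with rfl | hcs
      · rw [h0, sub_self, sub_zero, descent_descentTime sqrt_half_mem, mirror_zero]
      obtain ⟨r, hr, hsr, H⟩ := key s hs hcs
      have hslide : ∀ w ∈ Ioc c s, descentTime r - (w - c) = r ∨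
          flightTime r ≤ descentTime r - (w - c) := fun w hw => by
        have h1 := hy w (hJ.out hc hs ⟨hw.1.le, hw.2⟩) hw.1
        rw [H w ⟨hw.1.le, hw.2⟩, mirror_apply_one] at h1
        rcases descent_invariant hr (u := descentTime r - (w - c))
          ⟨by linarith [hw.2], by linarith [hw.1]⟩ with h | h | h | h
        · linarith [h.1]
        · linarith [h.1]
        · exact Or.inl h.2
        · exact Or.inr h.2
      have hle : flightTime r ≤ descentTime r - (s - c) := by
        rcases hslide s ⟨hcs, le_rfl⟩ with h | h
        · by_contra hcon
          have h1 := flightTime_le_descentTime hr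
          rcases hslide (c + (descentTime r - (r + flightTime r) / 2))
            ⟨by linarith, by linarith⟩ with h' | h' <;> linarith
        · exact h
      have h1 : slideTime (slideStart r) ≤ slideTime √(1 / 2) := by
        have h2 := slideStart_mem hr
        have h3 := slideStart_le_sqrt_half hr
        have h4 := sqrt_half_mem
        exact strictMonoOn_slideTime.monotoneOn ⟨by linarith, by linarith [hr.2]⟩
          ⟨by linarith [h4.1], h4.2⟩ h3
      have h2 : flightTime √(1 / 2) ≤ descentTime √(1 / 2) - (s - c) := by
        rw [descentTime, slideStart_sqrt_half]
        rw [descentTime] at hle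
        linarith
      rw [H s ⟨hcs.le, le_rfl⟩, descent_eq_of_flightTime_le hr hle,
        descent_eq_of_flightTime_le sqrt_half_mem h2, sub_sub_cancel, sub_sub_cancel]

/-- The passage of a trajectory from the origin through `(0, r²)` back to the origin, parametrized
by `[-descentTime r, descentTime r]`. -/
def bump (r u : ℝ) : Plane := if 0 ≤ u then descent r u else mirror (descent r (-u))

lemma bump_of_nonneg {r u : ℝ} (hu : 0 ≤ u) : bump r u = descent r u := if_pos hu

lemma bump_zero {r : ℝ} (hr : r ∈ Ioc (0 : ℝ) 1) : bump r 0 = !₂[0, r ^ 2] := by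
  rw [bump_of_nonneg le_rfl, descent_zero hr]

lemma bump_of_nonpos {r u : ℝ} (hr : r ∈ Ioc (0 : ℝ) 1) (hu : u ≤ 0) :
    bump r u = mirror (descent r (-u)) := by
  rcases hu.eq_or_lt with rfl | h
  · rw [bump_zero hr, neg_zero, descent_zero hr]
    exact plane_ext (by simp) (by simp)
  · exact if_neg (not_le.2 h)

lemma mirror_bump {r : ℝ} (hr : r ∈ Ioc (0 : ℝ) 1) (u : ℝ) : mirror (bump r u) = bump r (-u) := by
  rcases le_total 0 u with h | h
  · rw [bump_of_nonneg h, bump_of_nonpos hr (by linarith), neg_neg]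
  · rw [bump_of_nonpos hr h, bump_of_nonneg (by linarith), mirror_mirror]

lemma timeReverse_bump {r : ℝ} (hr : r ∈ Ioc (0 : ℝ) 1) : timeReverse (bump r) = bump r := by
  funext u
  rw [timeReverse, mirror_bump hr, neg_neg]

lemma bump_descentTime {r : ℝ} (hr : r ∈ Ioc (0 : ℝ) 1) : bump r (descentTime r) = 0 := by
  rw [bump_of_nonneg (descentTime_pos hr).le, descent_descentTime hr]

lemma bump_neg_descentTime {r : ℝ} (hr : r ∈ Ioc (0 : ℝ) 1) : bump r (-descentTime r) = 0 := by
  rw [← mirror_bump hr, bump_descentTime hr, mirror_zero]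

lemma bump_arc_right {r u : ℝ} (hr : r ∈ Ioc (0 : ℝ) 1)
    (hu : u ∈ Ico (-descentTime r) (descentTime r)) :
    ∃ v ∈ Ioc u (descentTime r), IsBeanArc (bump r) u v := by
  rcases le_or_gt 0 u with h | h
  · obtain ⟨v, hv, harc⟩ := descent_arc_right hr ⟨h, hu.2⟩
    exact ⟨v, hv, harc.congr fun w hw => bump_of_nonneg (h.trans hw.1)⟩
  · obtain ⟨v, hv, harc⟩ := descent_arc_left hr (u := -u) ⟨by linarith, by linarith [hu.1]⟩
    have := harc.reverse
    rw [neg_neg] at this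
    refine ⟨-v, ⟨by linarith [hv.2], by linarith [hv.1, descentTime_pos hr]⟩,
      this.congr fun w hw => bump_of_nonpos hr (by linarith [hw.2, hv.1])⟩

lemma bump_arc_left {r u : ℝ} (hr : r ∈ Ioc (0 : ℝ) 1)
    (hu : u ∈ Ioc (-descentTime r) (descentTime r)) :
    ∃ v ∈ Ico (-descentTime r) u, IsBeanArc (bump r) v u := by
  obtain ⟨v, hv, harc⟩ := bump_arc_right hr (u := -u) ⟨by linarith [hu.2], by linarith [hu.1]⟩
  have := harc.reverse
  rw [neg_neg, timeReverse_bump hr] at this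
  exact ⟨-v, ⟨by linarith [hv.2], by linarith [hv.1]⟩, this⟩

/-- The time at which the `j`-th bump of the curve with hitting times `t` and amplitudes `r` ends,
at the origin. -/
def landing (t r : ℤ → ℝ) (j : ℤ) : ℝ := t j + descentTime (r j)

/-- The time interval covered by the bumps with hitting times `t` and amplitudes `r`. -/
def bumpDomain (t r : ℤ → ℝ) : Set ℝ := ⋃ j, Icc (landing t r j) (landing t r (j + 1))

/-- The times `t` are those at which consecutive bumps of amplitudes `r` meet the section. -/
structure IsBumpTimes (t r : ℤ → ℝ) : Prop where
  mem : ∀ j, r j ∈ Ioc (0 : ℝ) 1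
  step : ∀ j, t (j + 1) = t j + descentTime (r j) + descentTime (r (j + 1))

/-- Around the time `t j`, the curve `γ` is the bump of amplitude `r j`. -/
def FollowsBumps (γ : ℝ → Plane) (t r : ℤ → ℝ) : Prop :=
  ∀ j, ∀ u ∈ Icc (-descentTime (r j)) (descentTime (r j)), γ (t j + u) = bump (r j) u

namespace IsBumpTimes

variable {t r : ℤ → ℝ} (h : IsBumpTimes t r)
include h

lemma landing_lt (j : ℤ) : landing t r j < t (j + 1) := by
  have := h.step j
  have := descentTime_pos (h.mem (j + 1))
  unfold landing
  linarith

lemma lt_landing (j : ℤ) : t j < landing t r j := by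
  have := descentTime_pos (h.mem j)
  unfold landing
  linarith

lemma strictMono : StrictMono t :=
  strictMono_int_of_lt_succ fun j => (h.lt_landing j).trans (h.landing_lt j)

lemma strictMono_landing : StrictMono (landing t r) :=
  strictMono_int_of_lt_succ fun j => (h.landing_lt j).trans (h.lt_landing (j + 1))

lemma landing_eq (j : ℤ) : landing t r j = t (j + 1) - descentTime (r (j + 1)) := by
  have := h.step j
  unfold landing
  linarith

lemma mem_bumpDomain {j : ℤ} {u : ℝ} (hu : u ∈ Icc (-descentTime (r j)) (descentTime (r j))) :
    t j + u ∈ bumpDomain t r := by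
  refine mem_iUnion.2 ⟨j - 1, ?_, ?_⟩
  · rw [h.landing_eq, sub_add_cancel]
    linarith [hu.1]
  · rw [sub_add_cancel]
    exact add_le_add_right hu.2 _

lemma exists_of_mem_bumpDomain {x : ℝ} (hx : x ∈ bumpDomain t r) :
    ∃ j, x - t j ∈ Icc (-descentTime (r j)) (descentTime (r j)) := by
  obtain ⟨j, hj⟩ := mem_iUnion.1 hx
  rw [h.landing_eq] at hj
  have e : landing t r (j + 1) = t (j + 1) + descentTime (r (j + 1)) := rfl
  exact ⟨j + 1, by linarith [hj.1], by linarith [hj.2]⟩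

lemma ordConnected : (bumpDomain t r).OrdConnected := h.strictMono_landing.iUnion_Icc_ordConnected

lemma landing_mem (j : ℤ) : landing t r j ∈ bumpDomain t r :=
  h.mem_bumpDomain ⟨by linarith [descentTime_pos (h.mem j)], le_rfl⟩

lemma hit_mem (j : ℤ) : t j ∈ bumpDomain t r := by
  have := descentTime_pos (h.mem j)
  have := h.mem_bumpDomain (j := j) (u := 0) ⟨by linarith, by linarith⟩
  rwa [add_zero] at this

lemma exists_followsBumps :
    ∃ γ : ℝ → Plane, FollowsBumps γ t r ∧ ∀ x, x ∉ bumpDomain t r → γ x = 0 := by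
  have key : ∀ x, ∃ y : Plane,
      (∀ j, x ∈ Icc (landing t r (j - 1)) (landing t r j) → y = bump (r j) (x - t j)) ∧
      (x ∉ bumpDomain t r → y = 0) := fun x => by
    by_cases hx : ∃ j, x ∈ Icc (landing t r (j - 1)) (landing t r j)
    · obtain ⟨j, hj⟩ := hx
      have hmem : x ∈ bumpDomain t r := mem_iUnion.2 ⟨j - 1, by rwa [sub_add_cancel]⟩
      refine ⟨bump (r j) (x - t j), fun i hi => ?_, fun h' => absurd hmem h'⟩
      have hadj : ∀ {i j : ℤ}, i < j → x ∈ Icc (landing t r (i - 1)) (landing t r i) →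
          x ∈ Icc (landing t r (j - 1)) (landing t r j) →
          bump (r i) (x - t i) = bump (r j) (x - t j) := fun {i j} hij hi hj => by
        have h1 : landing t r i ≤ landing t r (j - 1) := h.strictMono_landing.monotone (by omega)
        have h2 : x = landing t r i := le_antisymm hi.2 (h1.trans hj.1)
        have h3 : x = landing t r (j - 1) := le_antisymm (hi.2.trans h1) hj.1
        have h4 : x - t i = descentTime (r i) := by
          rw [h2, landing]
          ring
        have h5 : x - t j = -descentTime (r j) := by
          rw [h3, h.landing_eq, sub_add_cancel]
          ring
        rw [h4, h5, bump_descentTime (h.mem i), bump_neg_descentTime (h.mem j)]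
      rcases lt_trichotomy i j with h' | rfl | h'
      · exact (hadj h' hi hj).symm
      · rfl
      · exact hadj h' hj hi
    · exact ⟨0, fun j hj => absurd ⟨j, hj⟩ hx, fun _ => rfl⟩
  choose γ hγ hγ' using key
  refine ⟨γ, fun j u hu => ?_, hγ'⟩
  rw [hγ (t j + u) j ⟨?_, add_le_add_right hu.2 _⟩, add_sub_cancel_left]
  rw [h.landing_eq, sub_add_cancel]
  linarith [hu.1]

lemma isTrajectoryOn {γ : ℝ → Plane} (hγ : FollowsBumps γ t r) :
    IsTrajectoryOn beanX beanY (bumpDomain t r) γ := by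
  have harc : ∀ j {u v}, -descentTime (r j) ≤ u → v ≤ descentTime (r j) →
      IsBeanArc (bump (r j)) u v → IsBeanArc γ (t j + u) (t j + v) := fun j {u v} hu hv harc => by
    have h1 : IsArc beanX beanY (bump (r j)) (t j + u + -t j) (t j + v + -t j) := by
      rw [add_neg_cancel_comm, add_neg_cancel_comm]
      exact isArc_bean_iff.2 harc
    refine isArc_bean_iff.1 ((h1.comp_add (-t j)).congr fun w hw => ?_)
    rw [← hγ j (w + -t j) ⟨by linarith [hw.1], by linarith [hw.2]⟩, add_neg_cancel_comm_assoc]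
  refine isTrajectoryOn_iff.2 ⟨⟨_, h.hit_mem 0⟩, h.ordConnected,
    isLocalTrajectoryOn_bean_iff.2 fun x hx => ?_⟩
  obtain ⟨i, j, hi, hi', hj, hj'⟩ := h.strictMono_landing.iUnion_Icc_nhds hx
  have ei := h.landing_eq i
  have ej := h.landing_eq j
  have ei' : landing t r (i + 1) = t (i + 1) + descentTime (r (i + 1)) := rfl
  have ej' : landing t r (j + 1) = t (j + 1) + descentTime (r (j + 1)) := rfl
  obtain ⟨v, hv, hl⟩ := bump_arc_left (h.mem (i + 1)) (u := x - t (i + 1))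
    ⟨by linarith, by linarith⟩
  obtain ⟨w, hw, hr⟩ := bump_arc_right (h.mem (j + 1)) (u := x - t (j + 1))
    ⟨by linarith, by linarith⟩
  have hl' := harc _ hv.1 (by linarith) hl
  have hr' := harc _ (by linarith) hw.2 hr
  rw [add_sub_cancel] at hl' hr'
  have hv2 := hv.2
  have hw1 := hw.1
  set ε := min (x - (t (i + 1) + v)) (t (j + 1) + w - x)
  have hε1 : ε ≤ x - (t (i + 1) + v) := min_le_left _ _
  have hε2 : ε ≤ t (j + 1) + w - x := min_le_right _ _
  refine ⟨ε, lt_min (by linarith) (by linarith), fun y hy => ?_, hl'.mono (by linarith) le_rfl,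
    hr'.mono le_rfl (by linarith)⟩
  exact h.strictMono_landing.mem_iUnion_Icc (i := i) (j := j + 1) (by linarith [hy.1, hv.1])
    (by linarith [hy.2, hw.2])

end IsBumpTimes

/-- The times `c j` of passages through the origin do not accumulate at a time of the trajectory,
since an arc passes through the origin at most once. -/
lemma exists_le_of_mem {J : Set ℝ} {γ : ℝ → Plane} (hγ : IsLocalTrajectoryOn beanX beanY J γ)
    (hJ : J.OrdConnected) {c : ℤ → ℝ} (hc : StrictMono c) (hcJ : ∀ j, c j ∈ J)
    (h0 : ∀ j, γ (c j) = 0) {x : ℝ} (hx : x ∈ J) : ∃ j, x ≤ c j := by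
  by_contra! hcon
  have hbdd : BddAbove (range c) := ⟨x, by rintro _ ⟨j, rfl⟩; exact (hcon j).le⟩
  have hle : ∀ j, c j ≤ ⨆ j, c j := fun j => le_ciSup hbdd j
  have hL : (⨆ j, c j) ∈ J := hJ.out (hcJ 0) hx ⟨hle 0, ciSup_le fun j => (hcon j).le⟩
  obtain ⟨ε, hε, -, harc, -⟩ := isLocalTrajectoryOn_bean_iff.1 hγ _ hL
  obtain ⟨j, hj⟩ := exists_lt_of_lt_ciSup (show (⨆ j, c j) - ε < ⨆ j, c j by linarith)
  have hlt : c j < c (j + 1) := hc (by omega)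
  exact hlt.ne (harc.injOn ⟨hj.le, hle j⟩ ⟨(hj.trans hlt).le, hle (j + 1)⟩
    ((h0 j).trans (h0 (j + 1)).symm))

lemma subset_iUnion_of_eq_zero {J : Set ℝ} {γ : ℝ → Plane}
    (hγ : IsLocalTrajectoryOn beanX beanY J γ) (hJ : J.OrdConnected) {c : ℤ → ℝ}
    (hc : StrictMono c) (hcJ : ∀ j, c j ∈ J) (h0 : ∀ j, γ (c j) = 0) :
    J ⊆ ⋃ j, Icc (c j) (c (j + 1)) := by
  intro x hx
  obtain ⟨j, hj⟩ := exists_le_of_mem hγ hJ hc hcJ h0 hx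
  obtain ⟨i, hi⟩ := exists_le_of_mem hγ.reverse (ordConnected_neg hJ) (c := fun j => -c (-j))
    (fun i j hij => neg_lt_neg (hc (neg_lt_neg hij))) (fun j => by simpa using hcJ (-j))
    (fun j => by rw [timeReverse, neg_neg, h0, mirror_zero]) (x := -x) (by simpa using hx)
  exact hc.mem_iUnion_Icc (neg_le_neg_iff.1 hi) hj

lemma FollowsBumps.landing_eq_zero {γ : ℝ → Plane} {t r : ℤ → ℝ} (hγ : FollowsBumps γ t r)
    (h : IsBumpTimes t r) (j : ℤ) : γ (landing t r j) = 0 := by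
  rw [landing, hγ j _ ⟨by linarith [descentTime_pos (h.mem j)], le_rfl⟩, bump_descentTime (h.mem j)]

/-- A sequence of bumps that is infinite in both directions is a maximal trajectory. -/
lemma IsBumpTimes.isMaximalTrajectory {γ : ℝ → Plane} {t r : ℤ → ℝ} (h : IsBumpTimes t r)
    (hγ : FollowsBumps γ t r) : IsMaximalTrajectory beanX beanY (bumpDomain t r) γ := by
  refine ⟨h.isTrajectoryOn hγ, fun J' γ' h' hsub heq => (Subset.antisymm ?_ hsub)⟩
  obtain ⟨-, hJ, hloc⟩ := isTrajectoryOn_iff.1 h'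
  exact subset_iUnion_of_eq_zero hloc hJ h.strictMono_landing (fun j => hsub (h.landing_mem j))
    fun j => by rw [heq (h.landing_mem j), hγ.landing_eq_zero h]

/-- A relation that is total in both directions has bi-infinite chains through each point. -/
lemma exists_int_orbit {S : Type*} {R : S → S → Prop} (hR : ∀ x, ∃ y, R x y)
    (hR' : ∀ x, ∃ y, R y x) (x₀ : S) : ∃ f : ℤ → S, f 0 = x₀ ∧ ∀ j, R (f j) (f (j + 1)) := by
  choose next hnext using hR
  choose prev hprev using hR'
  refine ⟨fun j => match j with
    | Int.ofNat n => next^[n] x₀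
    | Int.negSucc n => prev^[n + 1] x₀, rfl, fun j => ?_⟩
  match j with
  | Int.ofNat n =>
    change R (next^[n] x₀) (next^[n + 1] x₀)
    rw [Function.iterate_succ_apply']
    exact hnext _
  | Int.negSucc 0 => exact hprev x₀
  | Int.negSucc (n + 1) =>
    change R (prev^[n + 1 + 1] x₀) (prev^[n + 1] x₀)
    rw [Function.iterate_succ_apply' prev (n + 1)]
    exact hprev _

/-- Every sequence of amplitudes is realized. -/
lemma exists_isBumpTimes {r : ℤ → ℝ} (hr : ∀ j, r j ∈ Ioc (0 : ℝ) 1) :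
    ∃ t : ℤ → ℝ, t 0 = 0 ∧ IsBumpTimes t r := by
  obtain ⟨f, hf0, hf⟩ := exists_int_orbit (S := ℤ × ℝ)
    (R := fun x y => y.1 = x.1 + 1 ∧ y.2 = x.2 + descentTime (r x.1) + descentTime (r y.1))
    (fun x => ⟨(x.1 + 1, x.2 + descentTime (r x.1) + descentTime (r (x.1 + 1))), rfl, rfl⟩)
    (fun x => ⟨(x.1 - 1, x.2 - descentTime (r x.1) - descentTime (r (x.1 - 1))), by simp, by
      ring⟩) (0, 0)
  have hfst : ∀ j, (f j).1 = j := fun j => by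
    induction j using Int.induction_on with
    | zero => rw [hf0]
    | succ j ih => rw [(hf _).1, ih]
    | pred j ih =>
      have := (hf (-j - 1)).1
      rw [sub_add_cancel, ih] at this
      omega
  refine ⟨fun j => (f j).2, by simp only [hf0], hr, fun j => ?_⟩
  rw [(hf j).2, hfst, hfst]

/-- A trajectory that extends a given bump. -/
lemma exists_isTrajectoryOn_bump {r : ℝ} (hr : r ∈ Ioc (0 : ℝ) 1) (s : ℝ) :
    ∃ K δ, IsTrajectoryOn beanX beanY K δ ∧
      ∀ u ∈ Icc (-descentTime r) (descentTime r), s + u ∈ K ∧ δ (s + u) = bump r u := by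
  obtain ⟨t, ht0, ht⟩ := exists_isBumpTimes (r := fun _ => r) fun _ => hr
  obtain ⟨γ, hγ, -⟩ := ht.exists_followsBumps
  refine ⟨_, _, (ht.isTrajectoryOn hγ).comp_add (-s), fun u hu => ?_⟩
  have h1 := ht.mem_bumpDomain (j := 0) hu
  have h2 := hγ 0 u hu
  rw [ht0, zero_add] at h1 h2
  rw [mem_ofPred_eq, add_neg_cancel_comm]
  exact ⟨h1, h2⟩

/-- A maximal trajectory does not stop on the way along another trajectory. -/
lemma IsMaximalTrajectory.mem_of_eqOn {J K : Set ℝ} {γ δ : ℝ → Plane} {X Y : Plane → Plane}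
    (hγ : IsMaximalTrajectory X Y J γ) (hδ : IsTrajectoryOn X Y K δ) {t c : ℝ} (ht : t ∈ J)
    (htK : t ∈ K) (hcK : c ∈ K) (htc : t ≤ c) (heq : ∀ s ∈ J, t ≤ s → s ≤ c → γ s = δ s) :
    c ∈ J := by
  by_contra hcJ
  obtain ⟨-, hJ, hγl⟩ := isTrajectoryOn_iff.1 hγ.1
  obtain ⟨-, hK, hδl⟩ := isTrajectoryOn_iff.1 hδ
  have hlt : ∀ s ∈ J, s < c := fun s hs => by
    by_contra hcon
    exact hcJ (hJ.out ht hs ⟨htc, not_lt.1 hcon⟩)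
  have hsub : J ⊆ (J ∩ Iic t) ∪ (K ∩ Ici t) := fun s hs => by
    rcases le_total s t with h | h
    · exact Or.inl ⟨hs, h⟩
    · exact Or.inr ⟨hK.out htK hcK ⟨h, (hlt s hs).le⟩, h⟩
  have hord : ((J ∩ Iic t) ∪ (K ∩ Ici t)).OrdConnected := ⟨fun x hx y hy z hz => by
    rcases le_total z t with h | h
    · refine Or.inl ⟨?_, h⟩
      rcases hx with hx | hx
      · exact hJ.out hx.1 ht ⟨hz.1, h⟩
      · have : z = t := le_antisymm h (hx.2.trans hz.1)
        rwa [this]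
    · refine Or.inr ⟨?_, h⟩
      rcases hy with hy | hy
      · have : z = t := le_antisymm (hz.2.trans hy.2) h
        rwa [this]
      · exact hK.out htK hy.1 ⟨h, hz.2⟩⟩
  have hglue := hγl.glue hδl ht htK (heq t ht le_rfl htc)
  have := hγ.2 _ _ (isTrajectoryOn_iff.2 ⟨⟨t, Or.inl ⟨ht, self_mem_Iic⟩⟩, hord, hglue⟩) hsub
    fun s hs => by
      by_cases h : s ≤ t
      · simp [h]
      · simpa [h] using (heq s hs (not_le.1 h).le (hlt s hs).le).symm
  exact hcJ (this ▸ Or.inr ⟨hcK, htc⟩)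

/-- A maximal trajectory on a descent reaches the origin. -/
lemma IsMaximalTrajectory.mem_of_eq_descent {J : Set ℝ} {γ : ℝ → Plane} {t r u : ℝ}
    (hγ : IsMaximalTrajectory beanX beanY J γ) (ht : t ∈ J) (hr : r ∈ Ioc (0 : ℝ) 1)
    (hu : u ∈ Icc 0 (descentTime r)) (h : γ t = descent r u) :
    t + (descentTime r - u) ∈ J ∧ γ (t + (descentTime r - u)) = 0 := by
  obtain ⟨-, hJ, hγl⟩ := isTrajectoryOn_iff.1 hγ.1
  have hfol := hγl.eq_descent hJ ht hr hu.1 h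
  obtain ⟨K, δ, hδ, H⟩ := exists_isTrajectoryOn_bump hr (t - u)
  have hτ := descentTime_pos hr
  have h1 := H u ⟨by linarith [hu.1], hu.2⟩
  have h2 := H (descentTime r) ⟨by linarith, le_rfl⟩
  rw [sub_add_cancel] at h1
  rw [sub_add_eq_add_sub, add_sub_assoc] at h2
  have hmem := hγ.mem_of_eqOn hδ ht h1.1 h2.1 (by linarith [hu.2]) fun s hs hts hsc => by
    have h3 := (H (u + (s - t)) ⟨by linarith [hu.1], by linarith⟩).2
    rw [show t - u + (u + (s - t)) = s by ring] at h3
    rw [hfol s hs hts hsc, h3, bump_of_nonneg (by linarith [hu.1])]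
  refine ⟨hmem, ?_⟩
  rw [hfol _ hmem (by linarith [hu.2]) le_rfl, add_sub_cancel_left, add_sub_cancel,
    descent_descentTime hr]

/-- A maximal trajectory in the bean goes from the origin to the section. -/
lemma IsMaximalTrajectory.exists_hit {J : Set ℝ} {γ : ℝ → Plane} {c : ℝ}
    (hγ : IsMaximalTrajectory beanX beanY J γ) (hL : ∀ t ∈ J, γ t ∈ LambdaBean) (hc : c ∈ J)
    (h : γ c = 0) :
    ∃ r ∈ Ioc (0 : ℝ) 1, c + descentTime r ∈ J ∧ γ (c + descentTime r) = bump r 0 := by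
  obtain ⟨-, hJ, hγl⟩ := isTrajectoryOn_iff.1 hγ.1
  obtain ⟨r, hr, hfol⟩ := hγl.exists_eq_mirror_descent hJ hL hc h
  have hfol' : ∀ s ∈ J, c ≤ s → s ≤ c + descentTime r → γ s = bump r (s - c - descentTime r) :=
    fun s hs h1 h2 => by
      rw [hfol s hs h1 h2, bump_of_nonpos hr (by linarith), neg_sub]
  obtain ⟨K, δ, hδ, H⟩ := exists_isTrajectoryOn_bump hr (c + descentTime r)
  have hτ := descentTime_pos hr
  have h1 := H (-descentTime r) ⟨le_rfl, by linarith⟩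
  have h2 := H 0 ⟨by linarith, hτ.le⟩
  rw [add_neg_cancel_right] at h1
  rw [add_zero] at h2
  have hmem := hγ.mem_of_eqOn hδ hc h1.1 h2.1 (by linarith) fun s hs hts hsc => by
    have h3 := (H (s - c - descentTime r) ⟨by linarith, by linarith⟩).2
    rw [show c + descentTime r + (s - c - descentTime r) = s by ring] at h3
    rw [hfol' s hs hts hsc, h3]
  refine ⟨r, hr, hmem, ?_⟩
  rw [hfol' _ hmem (by linarith) le_rfl]
  congr 1
  ring

lemma IsMaximalTrajectory.exists_next_hit {J : Set ℝ} {γ : ℝ → Plane} {t r : ℝ}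
    (hγ : IsMaximalTrajectory beanX beanY J γ) (hL : ∀ t ∈ J, γ t ∈ LambdaBean) (ht : t ∈ J)
    (hr : r ∈ Ioc (0 : ℝ) 1) (h : γ t = bump r 0) :
    ∃ r' ∈ Ioc (0 : ℝ) 1, t + descentTime r + descentTime r' ∈ J ∧
      γ (t + descentTime r + descentTime r') = bump r' 0 := by
  rw [bump_of_nonneg le_rfl] at h
  obtain ⟨h1, h2⟩ := hγ.mem_of_eq_descent ht hr ⟨le_rfl, (descentTime_pos hr).le⟩ h
  rw [sub_zero] at h1 h2
  exact hγ.exists_hit hL h1 h2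

lemma IsMaximalTrajectory.exists_prev_hit {J : Set ℝ} {γ : ℝ → Plane} {t r : ℝ}
    (hγ : IsMaximalTrajectory beanX beanY J γ) (hL : ∀ t ∈ J, γ t ∈ LambdaBean) (ht : t ∈ J)
    (hr : r ∈ Ioc (0 : ℝ) 1) (h : γ t = bump r 0) :
    ∃ r' ∈ Ioc (0 : ℝ) 1, t - descentTime r - descentTime r' ∈ J ∧
      γ (t - descentTime r - descentTime r') = bump r' 0 := by
  obtain ⟨r', hr', h1, h2⟩ := hγ.reverse.exists_next_hit
    (fun t ht => mirror_mem_LambdaBean (hL _ ht)) (t := -t) (by simpa using ht) hr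
    (by rw [timeReverse, neg_neg, h, mirror_bump hr, neg_zero])
  have he : -(-t + descentTime r + descentTime r') = t - descentTime r - descentTime r' := by ring
  rw [mem_ofPred_eq, he] at h1
  rw [timeReverse, he] at h2
  refine ⟨r', hr', h1, ?_⟩
  rw [← mirror_mirror (γ _), h2, mirror_bump hr', neg_zero]

/-- A maximal trajectory in the bean meets the section. -/
lemma IsMaximalTrajectory.exists_mem_eq_bump {J : Set ℝ} {γ : ℝ → Plane}
    (hγ : IsMaximalTrajectory beanX beanY J γ) (hL : ∀ t ∈ J, γ t ∈ LambdaBean) :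
    ∃ t ∈ J, ∃ r ∈ Ioc (0 : ℝ) 1, γ t = bump r 0 := by
  obtain ⟨⟨s, hs⟩, -, -⟩ := isTrajectoryOn_iff.1 hγ.1
  obtain ⟨c, hc, h0⟩ : ∃ c ∈ J, γ c = 0 := by
    by_cases hright : 0 < γ s 0 ∨ γ s 0 = 0 ∧ 0 < γ s 1
    · obtain ⟨r, hr, u, hu, h⟩ := exists_eq_descent (hL s hs) hright
      exact ⟨_, hγ.mem_of_eq_descent hs hr ⟨hu.1, hu.2.le⟩ h⟩
    · rcases lt_trichotomy (γ s 0) 0 with h | h | h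
      · obtain ⟨r, hr, u, hu, h⟩ := exists_eq_descent (mirror_mem_LambdaBean (hL s hs))
          (Or.inl (by rw [mirror_apply_zero]; linarith))
        obtain ⟨h1, h2⟩ := hγ.reverse.mem_of_eq_descent (t := -s) (by simpa using hs) hr
          ⟨hu.1, hu.2.le⟩ (by rw [timeReverse, neg_neg, h])
        exact ⟨_, h1, mirror_eq_zero_iff.1 h2⟩
      · have h1 : 0 ≤ γ s 1 := by
          have := (hL s hs).2.1
          rw [h] at this
          norm_num at this
          exact this
        have h2 : γ s 1 = 0 := le_antisymm (not_lt.1 fun h' => hright (Or.inr ⟨h, h'⟩)) h1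
        exact ⟨s, hs, plane_ext (by simp [h]) (by simp [h2])⟩
      · exact absurd (Or.inl h) hright
  obtain ⟨r, hr, h1, h2⟩ := hγ.exists_hit hL hc h0
  exact ⟨_, h1, r, hr, h2⟩

/-- The maximal trajectories in the bean are the bi-infinite sequences of bumps. -/
lemma IsMaximalTrajectory.exists_followsBumps {J : Set ℝ} {γ : ℝ → Plane}
    (hγ : IsMaximalTrajectory beanX beanY J γ) (hL : ∀ t ∈ J, γ t ∈ LambdaBean) :
    ∃ t r, IsBumpTimes t r ∧ FollowsBumps γ t r ∧ J = bumpDomain t r := by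
  obtain ⟨-, hJ, hγl⟩ := isTrajectoryOn_iff.1 hγ.1
  obtain ⟨s, hs, r₀, hr₀, h⟩ := hγ.exists_mem_eq_bump hL
  let S := {x : ℝ × ℝ // x.1 ∈ J ∧ x.2 ∈ Ioc (0 : ℝ) 1 ∧ γ x.1 = bump x.2 0}
  obtain ⟨f, -, hf⟩ := exists_int_orbit (S := S)
    (R := fun x y => y.1.1 = x.1.1 + descentTime x.1.2 + descentTime y.1.2)
    (fun x => by
      obtain ⟨r', hr', h1, h2⟩ := hγ.exists_next_hit hL x.2.1 x.2.2.1 x.2.2.2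
      exact ⟨⟨(_, r'), h1, hr', h2⟩, rfl⟩)
    (fun x => by
      obtain ⟨r', hr', h1, h2⟩ := hγ.exists_prev_hit hL x.2.1 x.2.2.1 x.2.2.2
      exact ⟨⟨(_, r'), h1, hr', h2⟩, by ring⟩) ⟨(s, r₀), hs, hr₀, h⟩
  set t : ℤ → ℝ := fun j => (f j).1.1
  set r : ℤ → ℝ := fun j => (f j).1.2
  have ht : IsBumpTimes t r := ⟨fun j => (f j).2.2.1, hf⟩
  have hsubd : bumpDomain t r ⊆ J := fun x hx => by
    obtain ⟨j, hj⟩ := mem_iUnion.1 hx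
    exact hJ.out (f j).2.1 (f (j + 1 + 1)).2.1
      ⟨(ht.lt_landing j).le.trans hj.1, hj.2.trans (ht.landing_lt (j + 1)).le⟩
  have hfol : FollowsBumps γ t r := fun j u hu => by
    have hmem := hsubd (ht.mem_bumpDomain hu)
    have hj := (f j).2.2.2
    rcases le_total 0 u with h0 | h0
    · rw [bump_of_nonneg le_rfl] at hj
      rw [bump_of_nonneg h0, hγl.eq_descent hJ (f j).2.1 (ht.mem j) le_rfl hj _ hmem
        (by linarith) (by linarith [hu.2]), add_sub_cancel_left, zero_add]
    · rw [bump_of_nonpos (ht.mem j) le_rfl, neg_zero] at hj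
      rw [bump_of_nonpos (ht.mem j) h0, hγl.eq_mirror_descent hJ (f j).2.1 (ht.mem j) le_rfl hj _
        hmem (by linarith) (by linarith [hu.1]), sub_add_cancel_left, zero_add]
  exact ⟨t, r, ht, hfol, (subset_iUnion_of_eq_zero hγl hJ ht.strictMono_landing
    (fun j => hsubd (ht.landing_mem j)) (hfol.landing_eq_zero ht)).antisymm hsubd⟩

/-! ### Maximal trajectories of the bean field and their hits -/

lemma IsMaximalTrajectory.comp_add {X Y : Plane → Plane} {J : Set ℝ} {γ : ℝ → Plane}
    (h : IsMaximalTrajectory X Y J γ) (c : ℝ) :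
    IsMaximalTrajectory X Y {t | t + c ∈ J} fun t => γ (t + c) := by
  refine ⟨h.1.comp_add c, fun J' γ' h' hsub heq => ?_⟩
  have := h.2 _ _ (h'.comp_add (-c)) (fun t ht => hsub (by simpa using ht)) fun t ht => by
    simpa using heq (show t + -c ∈ {t | t + c ∈ J} by simpa using ht)
  rw [← this]
  ext t
  simp

/-- The trajectory `γ(· + c)`. -/
def MaxTraj.translate {X Y : Plane → Plane} {L : Set Plane} (γ : MaxTraj X Y L) {c : ℝ}
    (hc : c ∈ γ.dom) : MaxTraj X Y L where
  dom := {t | t + c ∈ γ.dom}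
  toFun t := γ.toFun (t + c)
  maximal := γ.maximal.comp_add c
  zero_mem := by simpa using hc
  mem_set t ht := γ.mem_set _ ht
  eq_zero t ht := γ.eq_zero _ ht

lemma MaxTraj.ext' {X Y : Plane → Plane} {L : Set Plane} {γ δ : MaxTraj X Y L}
    (hd : γ.dom = δ.dom) (h : ∀ t ∈ γ.dom, γ.toFun t = δ.toFun t) : γ = δ := by
  have hf : γ.toFun = δ.toFun := funext fun t => by
    by_cases ht : t ∈ γ.dom
    · exact h t ht
    · rw [γ.eq_zero t ht, δ.eq_zero t (hd ▸ ht)]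
  cases γ
  cases δ
  simp only at hd hf
  subst hd hf
  rfl

/-- A strictly increasing bi-infinite sequence is determined by its range and the position of `0`
in it. -/
lemma eq_of_strictMono_of_range_eq {t t' : ℤ → ℝ} (ht : StrictMono t) (ht' : StrictMono t')
    (hr : range t = range t') (h0 : t 0 ≤ 0) (h1 : 0 < t 1) (h0' : t' 0 ≤ 0) (h1' : 0 < t' 1) :
    t = t' := by
  have base : ∀ {t t' : ℤ → ℝ}, StrictMono t' → range t = range t' → t 0 ≤ 0 → 0 < t' 1 →
      t 0 ≤ t' 0 := fun {t t'} ht' hr h0 h1' => by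
    obtain ⟨k, hk⟩ : t 0 ∈ range t' := hr ▸ mem_range_self 0
    rw [← hk] at h0 ⊢
    have := ht'.lt_iff_lt.1 (h0.trans_lt h1')
    exact ht'.monotone (by omega)
  have up : ∀ {t t' : ℤ → ℝ}, StrictMono t → StrictMono t' → range t = range t' → ∀ {j},
      t j = t' j → t' (j + 1) ≤ t (j + 1) := fun {t t'} ht ht' hr {j} hj => by
    obtain ⟨k, hk⟩ : t (j + 1) ∈ range t' := hr ▸ mem_range_self (j + 1)
    have h : t j < t (j + 1) := ht (by omega)
    rw [← hk, hj] at h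
    have := ht'.lt_iff_lt.1 h
    rw [← hk]
    exact ht'.monotone (by omega)
  have down : ∀ {t t' : ℤ → ℝ}, StrictMono t → StrictMono t' → range t = range t' → ∀ {j},
      t j = t' j → t (j - 1) ≤ t' (j - 1) := fun {t t'} ht ht' hr {j} hj => by
    obtain ⟨k, hk⟩ : t (j - 1) ∈ range t' := hr ▸ mem_range_self (j - 1)
    have h : t (j - 1) < t j := ht (by omega)
    rw [← hk, hj] at h
    have := ht'.lt_iff_lt.1 h
    rw [← hk]
    exact ht'.monotone (by omega)
  funext j
  induction j using Int.induction_on with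
  | zero => exact le_antisymm (base ht' hr h0 h1') (base ht hr.symm h0' h1)
  | succ j ih => exact le_antisymm (up ht' ht hr.symm ih.symm) (up ht ht' hr ih)
  | pred j ih => exact le_antisymm (down ht ht' hr ih) (down ht' ht hr.symm ih.symm)

/-- The maximal trajectories in the bean. -/
abbrev BeanTraj := MaxTraj beanX beanY LambdaBean

/-- The itinerary of a maximal trajectory in the bean. -/
abbrev beanItinerary (γ : BeanTraj) : ℤ → ℝ := hitItinerary beanX beanY LambdaBean sectionK γ

/-- The trajectory `γ` is the sequence of bumps with hitting times `t` and amplitudes `r`. -/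
structure HasBumps (γ : BeanTraj) (t r : ℤ → ℝ) : Prop where
  times : IsBumpTimes t r
  follows : FollowsBumps γ.toFun t r
  dom : γ.dom = bumpDomain t r

lemma bump_mem_sectionK_iff {r u : ℝ} (hr : r ∈ Ioc (0 : ℝ) 1)
    (hu : u ∈ Icc (-descentTime r) (descentTime r)) : bump r u ∈ sectionK ↔ u = 0 := by
  constructor
  · rintro ⟨h0, h1, -⟩
    by_contra hne
    rcases lt_or_gt_of_ne hne with h | h
    · rcases hu.1.eq_or_lt with rfl | h'
      · rw [bump_neg_descentTime hr] at h1
        simp at h1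
      · have := descent_pos hr (u := -u) ⟨by linarith, by linarith⟩
        rw [bump_of_nonpos hr h.le, mirror_apply_zero] at h0
        linarith
    · rcases hu.2.eq_or_lt with rfl | h'
      · rw [bump_descentTime hr] at h1
        simp at h1
      · have := descent_pos hr (u := u) ⟨h, h'⟩
        rw [bump_of_nonneg h.le] at h0
        linarith
  · rintro rfl
    rw [bump_zero hr]
    have h1 := hr.1
    have h2 := hr.2
    exact ⟨by simp, by simpa using ⟨by positivity, abs_le.2 ⟨by linarith, h2⟩⟩⟩

namespace HasBumps

variable {γ : BeanTraj} {t r : ℤ → ℝ} (h : HasBumps γ t r)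
include h

lemma mem_dom (j : ℤ) : t j ∈ γ.dom := h.dom ▸ h.times.hit_mem j

lemma apply_hit (j : ℤ) : γ.toFun (t j) = !₂[0, r j ^ 2] := by
  have hτ := descentTime_pos (h.times.mem j)
  have := h.follows j 0 ⟨by linarith, hτ.le⟩
  rwa [add_zero, bump_zero (h.times.mem j)] at this

lemma mem_range_iff {u : ℝ} : u ∈ range t ↔ u ∈ γ.dom ∧ γ.toFun u ∈ sectionK := by
  constructor
  · rintro ⟨j, rfl⟩
    refine ⟨h.mem_dom j, ?_⟩
    have hτ := descentTime_pos (h.times.mem j)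
    rw [h.apply_hit, ← bump_zero (h.times.mem j),
      bump_mem_sectionK_iff (h.times.mem j) ⟨by linarith, hτ.le⟩]
  · rintro ⟨h1, h2⟩
    rw [h.dom] at h1
    obtain ⟨j, hj⟩ := h.times.exists_of_mem_bumpDomain h1
    have h3 := h.follows j _ hj
    rw [add_sub_cancel] at h3
    rw [h3, bump_mem_sectionK_iff (h.times.mem j) hj] at h2
    exact ⟨j, by linarith⟩

lemma isBeats (h0 : t 0 ≤ 0) (h1 : 0 < t 1) : IsBeats sectionK γ t :=
  ⟨h.times.strictMono, ext fun _ => h.mem_range_iff, h0, h1⟩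

lemma eq_of_isBeats (h0 : t 0 ≤ 0) (h1 : 0 < t 1) {t' : ℤ → ℝ} (h' : IsBeats sectionK γ t') :
    t' = t :=
  eq_of_strictMono_of_range_eq h'.1 h.times.strictMono
    (h'.2.1.trans (h.isBeats h0 h1).2.1.symm) h'.2.2.1 h'.2.2.2 h0 h1

lemma beats_eq (h0 : t 0 ≤ 0) (h1 : 0 < t 1) : beats sectionK γ = t :=
  h.eq_of_isBeats h0 h1 (Classical.epsilon_spec (p := IsBeats sectionK γ) ⟨t, h.isBeats h0 h1⟩)

lemma itinerary_eq (h0 : t 0 ≤ 0) (h1 : 0 < t 1) (j : ℤ) : beanItinerary γ j = r j ^ 2 := by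
  rw [beanItinerary, hitItinerary, h.beats_eq h0 h1, h.apply_hit]
  simp

lemma translate {c : ℝ} (hc : c ∈ γ.dom) : HasBumps (γ.translate hc) (fun j => t j - c) r where
  times := ⟨h.times.mem, fun j => by rw [h.times.step]; ring⟩
  follows j u hu := by
    rw [← h.follows j u hu]
    exact congrArg γ.toFun (by ring)
  dom := by
    ext s
    have he : ∀ j, landing (fun j => t j - c) r j = landing t r j - c := fun j => by
      simp only [landing]
      ring
    change s + c ∈ γ.dom ↔ _
    simp only [h.dom, bumpDomain, mem_iUnion, mem_Icc, he, sub_le_iff_le_add, le_sub_iff_add_le]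

lemma reindex (k : ℤ) : HasBumps γ (fun j => t (j + k)) (fun j => r (j + k)) where
  times := ⟨fun j => h.times.mem _, fun j => by
    rw [show j + 1 + k = j + k + 1 by ring, h.times.step]⟩
  follows j := h.follows (j + k)
  dom := by
    rw [h.dom]
    refine (iUnion_congr_of_surjective (fun j => j + k) (Equiv.addRight k).surjective
      fun j => ?_).symm
    change Icc (landing t r (j + k)) (landing t r (j + k + 1)) =
      Icc (landing t r (j + k)) (landing t r (j + 1 + k))
    rw [show j + 1 + k = j + k + 1 by ring]

/-- A trajectory is determined by its amplitudes and one hitting time. -/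
lemma unique {γ' : BeanTraj} {t' : ℤ → ℝ} (h' : HasBumps γ' t' r) (h0 : t 0 = t' 0) : γ = γ' := by
  have ht : t = t' := funext fun j => by
    induction j using Int.induction_on with
    | zero => exact h0
    | succ j ih => rw [h.times.step, h'.times.step, ih]
    | pred j ih =>
      have h1 := h.times.step (-j - 1)
      have h2 := h'.times.step (-j - 1)
      rw [sub_add_cancel] at h1 h2
      linarith
  subst ht
  refine MaxTraj.ext' (h.dom.trans h'.dom.symm) fun u hu => ?_
  rw [h.dom] at hu
  obtain ⟨j, hj⟩ := h.times.exists_of_mem_bumpDomain hu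
  have h1 := h.follows j _ hj
  have h2 := h'.follows j _ hj
  rw [add_sub_cancel] at h1 h2
  rw [h1, h2]

end HasBumps

/-- Every maximal trajectory is a sequence of bumps, which can be numbered so that
`t_0 ≤ 0 < t_1`. -/
lemma exists_hasBumps (γ : BeanTraj) : ∃ t r, HasBumps γ t r ∧ t 0 ≤ 0 ∧ 0 < t 1 := by
  obtain ⟨t, r, h1, h2, h3⟩ := γ.maximal.exists_followsBumps γ.mem_set
  have h : HasBumps γ t r := ⟨h1, h2, h3⟩
  obtain ⟨j, hj⟩ := mem_iUnion.1 (h3 ▸ γ.zero_mem : (0 : ℝ) ∈ bumpDomain t r)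
  obtain ⟨k, -, hk, hk'⟩ := h1.strictMono.exists_mem_Ico_of_mem
    ((h1.lt_landing j).le.trans hj.1) (hj.2.trans (h1.landing_lt (j + 1)).le)
  exact ⟨_, _, h.reindex k, by simpa using hk, by rwa [add_comm]⟩

/-- Every sequence of amplitudes is that of a trajectory that starts on the section. -/
lemma exists_beanTraj {r : ℤ → ℝ} (hr : ∀ j, r j ∈ Ioc (0 : ℝ) 1) :
    ∃ (γ : BeanTraj) (t : ℤ → ℝ), HasBumps γ t r ∧ t 0 = 0 := by
  obtain ⟨t, ht0, ht⟩ := exists_isBumpTimes hr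
  obtain ⟨γ, hγ, hγ0⟩ := ht.exists_followsBumps
  have hmem : ∀ x ∈ bumpDomain t r, γ x ∈ LambdaBean := by
    refine (ht.isTrajectoryOn hγ).forall_mem_of_exists_mem (fun a b harc s hs u hu hL =>
      (isArc_bean_iff.1 harc).mem_LambdaBean hs hu hL) ⟨_, ht.landing_mem 0, ?_⟩
    rw [hγ.landing_eq_zero ht]
    constructor <;> norm_num
  exact ⟨⟨bumpDomain t r, γ, ht.isMaximalTrajectory hγ, ht0 ▸ ht.hit_mem 0, hmem, hγ0⟩, t,
    ⟨ht, hγ, rfl⟩, ht0⟩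

lemma beanItinerary_mem (γ : BeanTraj) (j : ℤ) : beanItinerary γ j ∈ Ioc (0 : ℝ) 1 := by
  obtain ⟨t, r, h, h0, h1⟩ := exists_hasBumps γ
  rw [h.itinerary_eq h0 h1]
  obtain ⟨h2, h3⟩ := h.times.mem j
  exact ⟨by positivity, by nlinarith⟩

lemma HasBumps.amplitude_eq {γ : BeanTraj} {t r : ℤ → ℝ} (h : HasBumps γ t r) (h0 : t 0 ≤ 0)
    (h1 : 0 < t 1) : r = fun j => √(beanItinerary γ j) := by
  funext j
  rw [h.itinerary_eq h0 h1, Real.sqrt_sq (h.times.mem j).1.le]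

/-- In every class, exactly one trajectory starts on the section. -/
lemma exists_unique_hitRep (q : MaxBar beanX beanY LambdaBean sectionK) :
    ∃! γ, IsHitRep beanX beanY LambdaBean sectionK q γ := by
  induction q using Quotient.inductionOn with
  | h γ =>
    obtain ⟨t, r, h, h0, h1⟩ := exists_hasBumps γ
    have h' := h.translate (h.mem_dom 0)
    have h01 : t 0 < t 1 := h.times.strictMono (by norm_num)
    refine ⟨γ.translate (h.mem_dom 0), ⟨Quotient.sound (funext fun j => ?_), ?_⟩,
      fun δ hδ => ?_⟩
    · have h2 := h.itinerary_eq h0 h1 j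
      have h3 := h'.itinerary_eq (sub_self _).le (sub_pos.2 h01) j
      exact h3.trans h2.symm
    · exact (h'.mem_range_iff.1 ⟨0, sub_self _⟩).2
    · obtain ⟨t', r', hb, h0', h1'⟩ := exists_hasBumps δ
      have he : r = r' := by
        rw [h.amplitude_eq h0 h1, hb.amplitude_eq h0' h1', beanItinerary, beanItinerary,
          ← show hitItinerary beanX beanY LambdaBean sectionK δ =
            hitItinerary beanX beanY LambdaBean sectionK γ from Quotient.exact hδ.1]
      subst he
      obtain ⟨k, hk⟩ := hb.mem_range_iff.2 ⟨δ.zero_mem, hδ.2⟩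
      have h2 : k < 1 := hb.times.strictMono.lt_iff_lt.1 (hk ▸ h1')
      have h3 : 0 ≤ k := hb.times.strictMono.le_iff_le.1 (hk ▸ h0')
      have h4 : k = 0 := by omega
      rw [h4] at hk
      exact hb.unique h' (by rw [hk, sub_self])

/-- The amplitudes of the distinguished representative are the square roots of the itinerary. -/
lemma hasBumps_hitRep (γ : BeanTraj) :
    ∃ t, HasBumps (hitRep beanX beanY LambdaBean sectionK (Quotient.mk _ γ)) t
      (fun j => √(beanItinerary γ j)) ∧
      beats sectionK (hitRep beanX beanY LambdaBean sectionK (Quotient.mk _ γ)) = t := by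
  have hrep : IsHitRep beanX beanY LambdaBean sectionK (Quotient.mk _ γ)
      (hitRep beanX beanY LambdaBean sectionK (Quotient.mk _ γ)) :=
    Classical.epsilon_spec (exists_unique_hitRep _).exists
  set δ := hitRep beanX beanY LambdaBean sectionK (Quotient.mk _ γ)
  obtain ⟨t, r, h, h0, h1⟩ := exists_hasBumps δ
  have he : hitItinerary beanX beanY LambdaBean sectionK δ =
    hitItinerary beanX beanY LambdaBean sectionK γ := Quotient.exact hrep.1
  refine ⟨t, ?_, h.beats_eq h0 h1⟩
  rw [h.amplitude_eq h0 h1, beanItinerary, he] at h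
  exact h

/-- The return map. -/
lemma exists_returnMap : ∃ T : BeanTraj → BeanTraj, (∀ γ, IsReturn sectionK γ (T γ)) ∧
    ∀ γ, beanItinerary (T γ) = shift (beanItinerary γ) := by
  have key : ∀ γ : BeanTraj, ∃ δ, IsReturn sectionK γ δ ∧
      beanItinerary δ = shift (beanItinerary γ) := fun γ => by
    obtain ⟨t, r, h, h0, h1⟩ := exists_hasBumps γ
    refine ⟨γ.translate (h.mem_dom 1), ⟨t 1, ⟨⟨h1, h.mem_range_iff.1 ⟨1, rfl⟩⟩, ?_⟩, rfl,
      fun _ => rfl⟩, funext fun j => ?_⟩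
    · rintro u ⟨hu, hu'⟩
      obtain ⟨k, rfl⟩ := h.mem_range_iff.2 hu'
      have := h.times.strictMono.lt_iff_lt.1 (h0.trans_lt hu)
      exact h.times.strictMono.monotone (by omega)
    · have h2 := (h.translate (h.mem_dom 1)).reindex 1
      have h3 : t 1 < t (1 + 1) := h.times.strictMono (by norm_num)
      rw [h2.itinerary_eq (by simp) (sub_pos.2 h3), shift_apply, h.itinerary_eq h0 h1]
  choose T hT hT' using key
  exact ⟨T, hT, hT'⟩

/-! ### Global trajectories -/

/-- The hitting times are bounded above exactly when the amplitudes are summable. -/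
lemma IsBumpTimes.unbounded_iff {t r : ℤ → ℝ} (h : IsBumpTimes t r) :
    (∀ x, ∃ j, x ≤ landing t r j) ↔ ¬ Summable fun n : ℕ => r n := by
  have hr0 : ∀ n : ℕ, 0 ≤ r n := fun n => (h.mem n).1.le
  have hlow : ∀ n : ℕ, t 0 + ∑ i ∈ Finset.range n, r i ≤ t n := fun n => by
    induction n with
    | zero => simp
    | succ n ih =>
      rw [Finset.sum_range_succ, Nat.cast_succ, h.step]
      linarith [lt_descentTime (h.mem n), descentTime_pos (h.mem (n + 1))]
  constructor
  · intro hub hs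
    have hupp : ∀ n : ℕ, landing t r n ≤ landing t r 0 + 6 * ∑ i ∈ Finset.range (n + 1), r i :=
      fun n => by
        induction n with
        | zero => simpa using (h.mem 0).1.le
        | succ n ih =>
          have h1 : landing t r ((n + 1 : ℕ) : ℤ) =
              landing t r n + 2 * descentTime (r ((n + 1 : ℕ) : ℤ)) := by
            rw [Nat.cast_succ]
            unfold landing
            rw [h.step]
            ring
          rw [Finset.sum_range_succ, h1]
          linarith [descentTime_le (h.mem ((n + 1 : ℕ) : ℤ))]
    obtain ⟨j, hj⟩ := hub (landing t r 0 + 6 * ∑' i : ℕ, r i + 1)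
    have h1 : landing t r j ≤ landing t r j.toNat :=
      h.strictMono_landing.monotone (Int.self_le_toNat j)
    have h2 := hupp j.toNat
    have h3 := hs.sum_le_tsum (Finset.range (j.toNat + 1)) fun i _ => hr0 i
    linarith
  · intro hs x
    have htop := (not_summable_iff_tendsto_nat_atTop_of_nonneg hr0).1 hs
    obtain ⟨n, hn⟩ := (htop.eventually_ge_atTop (x - t 0)).exists
    exact ⟨n, by linarith [hlow n, h.lt_landing n]⟩

/-- The reversed sequence of bumps. -/
lemma IsBumpTimes.reverse {t r : ℤ → ℝ} (h : IsBumpTimes t r) :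
    IsBumpTimes (fun j => -t (-j)) fun j => r (-j) := by
  refine ⟨fun j => h.mem _, fun j => ?_⟩
  have := h.step (-(j + 1))
  rw [show -(j + 1) + 1 = -j by ring] at this
  linarith

lemma IsBumpTimes.bumpDomain_eq_univ_iff {t r : ℤ → ℝ} (h : IsBumpTimes t r) :
    bumpDomain t r = univ ↔
      (¬ Summable fun n : ℕ => r n) ∧ ¬ Summable fun n : ℕ => r (-(n : ℤ)) := by
  rw [← h.unbounded_iff, ← h.reverse.unbounded_iff]
  have he : ∀ j, landing (fun j => -t (-j)) (fun j => r (-j)) j = -landing t r (-j - 1) :=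
    fun j => by
      rw [h.landing_eq, sub_add_cancel, landing]
      ring
  simp only [he]
  constructor
  · intro hu
    refine ⟨fun x => ?_, fun x => ?_⟩
    · obtain ⟨j, hj⟩ := mem_iUnion.1 (hu ▸ mem_univ x : x ∈ bumpDomain t r)
      exact ⟨_, hj.2⟩
    · obtain ⟨j, hj⟩ := mem_iUnion.1 (hu ▸ mem_univ (-x) : -x ∈ bumpDomain t r)
      refine ⟨-j - 1, ?_⟩
      rw [show -(-j - 1) - 1 = j by ring]
      linarith [hj.1]
  · rintro ⟨h1, h2⟩
    refine eq_univ_of_forall fun x => ?_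
    obtain ⟨j, hj⟩ := h1 x
    obtain ⟨i, hi⟩ := h2 (-x)
    exact h.strictMono_landing.mem_iUnion_Icc (neg_le_neg_iff.1 hi) hj

lemma MaxTraj.isGlobalTrajectory_iff {X Y : Plane → Plane} {L : Set Plane} (γ : MaxTraj X Y L) :
    IsGlobalTrajectory X Y γ.toFun ↔ γ.dom = univ := by
  rw [_root_.isGlobalTrajectory_iff]
  exact ⟨fun h => (γ.maximal.2 _ _ h (subset_univ _) fun _ _ => rfl).symm,
    fun h => h ▸ γ.maximal.1⟩

lemma isGlobalTrajectory_bean_iff (γ : BeanTraj) :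
    IsGlobalTrajectory beanX beanY γ.toFun ↔
      (¬ Summable fun n : ℕ => √(beanItinerary γ n)) ∧
        ¬ Summable fun n : ℕ => √(beanItinerary γ (-(n : ℤ))) := by
  obtain ⟨t, r, h, h0, h1⟩ := exists_hasBumps γ
  rw [γ.isGlobalTrajectory_iff, h.dom, h.times.bumpDomain_eq_univ_iff, h.amplitude_eq h0 h1]

/-! ### The loops of a trajectory of the bean field -/

/-- The trace of the descent from `(0, r²)` to the origin. -/
def descentSet (r : ℝ) : Set Plane := descent r '' Icc 0 (descentTime r)

/-- The loop from `(0, r²)` through the origin to `(0, r'²)`. -/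
def bumpLoop (r r' : ℝ) : Set Plane := descentSet r ∪ mirror '' descentSet r'

lemma dist_mirror (p q : Plane) : dist (mirror p) (mirror q) = dist p q := by
  rw [EuclideanSpace.dist_eq, EuclideanSpace.dist_eq, Fin.sum_univ_two, Fin.sum_univ_two]
  simp only [mirror_apply_zero, mirror_apply_one, dist_neg_neg]

lemma continuous_mirror : Continuous mirror :=
  (Isometry.of_dist_eq dist_mirror).continuous

lemma isCompact_descentSet {r : ℝ} (hr : r ∈ Ioc (0 : ℝ) 1) : IsCompact (descentSet r) :=
  isCompact_Icc.image_of_continuousOn (continuousOn_descent hr)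

lemma isCompact_bumpLoop {r r' : ℝ} (hr : r ∈ Ioc (0 : ℝ) 1) (hr' : r' ∈ Ioc (0 : ℝ) 1) :
    IsCompact (bumpLoop r r') :=
  (isCompact_descentSet hr).union ((isCompact_descentSet hr').image continuous_mirror)

lemma nonempty_bumpLoop {r r' : ℝ} (hr : r ∈ Ioc (0 : ℝ) 1) : (bumpLoop r r').Nonempty :=
  ⟨_, Or.inl ⟨0, ⟨le_rfl, (descentTime_pos hr).le⟩, rfl⟩⟩

lemma HasBumps.image_Icc {γ : BeanTraj} {t r : ℤ → ℝ} (h : HasBumps γ t r) (i : ℤ) :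
    γ.toFun '' Icc (t i) (t (i + 1)) = bumpLoop (r i) (r (i + 1)) := by
  have hstep := h.times.step i
  have h1 := descentTime_pos (h.times.mem i)
  have h2 := descentTime_pos (h.times.mem (i + 1))
  ext p
  constructor
  · rintro ⟨s, hs, rfl⟩
    rcases le_total s (t i + descentTime (r i)) with hle | hle
    · refine Or.inl ⟨s - t i, ⟨by linarith [hs.1], by linarith⟩, ?_⟩
      rw [← bump_of_nonneg (by linarith [hs.1]),
        ← h.follows i _ ⟨by linarith [hs.1], by linarith⟩, add_sub_cancel]
    · refine Or.inr ⟨_, ⟨t (i + 1) - s, ⟨by linarith [hs.2], by linarith⟩, rfl⟩, ?_⟩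
      rw [← bump_of_nonneg (by linarith [hs.2]), mirror_bump (h.times.mem _), neg_sub,
        ← h.follows (i + 1) _ ⟨by linarith, by linarith [hs.2]⟩, add_sub_cancel]
  · rintro (⟨u, hu, rfl⟩ | ⟨_, ⟨u, hu, rfl⟩, rfl⟩)
    · refine ⟨t i + u, ⟨by linarith [hu.1], by linarith [hu.2]⟩, ?_⟩
      rw [h.follows i _ ⟨by linarith [hu.1], hu.2⟩, bump_of_nonneg hu.1]
    · refine ⟨t (i + 1) + -u, ⟨by linarith [hu.2], by linarith [hu.1]⟩, ?_⟩
      rw [h.follows (i + 1) _ ⟨by linarith [hu.2], by linarith [hu.1]⟩,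
        ← mirror_bump (h.times.mem _), bump_of_nonneg hu.1]

/-- The `i`-th loop of the class of `γ`. -/
lemma loop_eq (γ : BeanTraj) (i : ℤ) :
    loop beanX beanY LambdaBean sectionK (Quotient.mk _ γ) i =
      bumpLoop √(beanItinerary γ i) √(beanItinerary γ (i + 1)) := by
  obtain ⟨t, h, ht⟩ := hasBumps_hitRep γ
  rw [loop, ht, h.image_Icc]

lemma sqrt_itinerary_mem (γ : BeanTraj) (i : ℤ) : √(beanItinerary γ i) ∈ Ioc (0 : ℝ) 1 :=
  ⟨Real.sqrt_pos.2 (beanItinerary_mem γ i).1, Real.sqrt_le_one.2 (beanItinerary_mem γ i).2⟩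

lemma dist_le_of_mem_LambdaBean {p q : Plane} (hp : p ∈ LambdaBean) (hq : q ∈ LambdaBean) :
    dist p q ≤ 4 := by
  have key : ∀ {p : Plane}, p ∈ LambdaBean → |p 0| ≤ 1 ∧ |p 1| ≤ 1 := fun {p} hp => by
    obtain ⟨h1, h2, h3⟩ := hp
    refine ⟨abs_le.2 h1, abs_le.2 ⟨?_, by nlinarith⟩⟩
    nlinarith [sq_nonneg (p 0 ^ 2 - 1)]
  have h0 := abs_sub (p 0) (q 0)
  have h1 := abs_sub (p 1) (q 1)
  linarith [dist_le_abs_add_abs p q, (key hp).1, (key hp).2, (key hq).1, (key hq).2]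

lemma hausdorffDist_bumpLoop_le (γ γ' : BeanTraj) (i : ℤ) :
    Metric.hausdorffDist (bumpLoop √(beanItinerary γ i) √(beanItinerary γ (i + 1)))
      (bumpLoop √(beanItinerary γ' i) √(beanItinerary γ' (i + 1))) ≤ 4 := by
  have hsub : ∀ γ : BeanTraj,
      bumpLoop √(beanItinerary γ i) √(beanItinerary γ (i + 1)) ⊆ LambdaBean := fun γ => by
    obtain ⟨t, h, -⟩ := hasBumps_hitRep γ
    rw [← h.image_Icc i]
    rintro _ ⟨s, hs, rfl⟩
    have hord : (hitRep beanX beanY LambdaBean sectionK (Quotient.mk _ γ)).dom.OrdConnected :=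
      (isTrajectoryOn_iff.1 (MaxTraj.maximal _).1).2.1
    exact MaxTraj.mem_set _ _ (hord.out (h.mem_dom i) (h.mem_dom (i + 1)) hs)
  exact hausdorffDist_le_of_dist_le (nonempty_bumpLoop (sqrt_itinerary_mem γ i))
    (nonempty_bumpLoop (sqrt_itinerary_mem γ' i))
    fun p hp q hq => dist_le_of_mem_LambdaBean (hsub γ hp) (hsub γ' hq)

/-- The amplitude of the descent in a loop can be read off from the first integral `y + x²` of
`beanX` near the point of the loop with abscissa `r / 2`. -/
lemma abs_sq_sub_sq_le {r r' r₁ r₁' η : ℝ} (hr : r ∈ Ioc (0 : ℝ) 1) (hr' : r' ∈ Ioc (0 : ℝ) 1)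
    (hr₁ : r₁ ∈ Ioc (0 : ℝ) 1) (hr₁' : r₁' ∈ Ioc (0 : ℝ) 1) (h1 : η ≤ r / 2)
    (h2 : η ≤ 3 * r ^ 2 / 4)
    (h : Metric.hausdorffDist (bumpLoop r r') (bumpLoop r₁ r₁') < η) :
    |r ^ 2 - r₁ ^ 2| ≤ 3 * η := by
  have h0 := hr.1
  have hp : (!₂[r / 2, 3 * r ^ 2 / 4] : Plane) ∈ bumpLoop r r' := by
    refine Or.inl ⟨r / 2, ⟨by linarith, by linarith [lt_descentTime hr]⟩, ?_⟩
    rw [descent_eq_of_le (by linarith)]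
    congr 2
    ring_nf
  obtain ⟨q, hq, hpq⟩ := Metric.exists_dist_lt_of_hausdorffDist_lt hp h
    (hausdorffEDist_ne_top ⟨_, hp⟩ (isCompact_bumpLoop hr hr') (nonempty_bumpLoop hr₁)
      (isCompact_bumpLoop hr₁ hr₁'))
  have hx := (abs_sub_le_dist _ q 0).trans_lt hpq
  have hy := (abs_sub_le_dist _ q 1).trans_lt hpq
  simp only [Matrix.cons_val_zero, Matrix.cons_val_one, Matrix.cons_val_fin_one] at hx hy
  rw [abs_lt] at hx hy
  have hnn : ∀ {ρ u : ℝ}, ρ ∈ Ioc (0 : ℝ) 1 → u ∈ Icc 0 (descentTime ρ) → 0 ≤ descent ρ u 0 :=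
    fun {ρ u} hρ hu => by
      rcases hu.1.eq_or_lt with rfl | h3
      · simp [descent_zero hρ]
      · rcases hu.2.eq_or_lt with rfl | h4
        · simp [descent_descentTime hρ]
        · exact (descent_pos hρ ⟨h3, h4⟩).le
  rcases hq with ⟨u, hu, rfl⟩ | ⟨_, ⟨u, hu, rfl⟩, rfl⟩
  · rcases descent_invariant hr₁ hu with ⟨h3, -, h4⟩ | h3 | h3 | h3
    · set x := descent r₁ u 0
      set y := descent r₁ u 1
      have hx0 : 0 ≤ x := hnn hr₁ hu
      have hx1 : x ≤ 1 := by nlinarith [hr₁.1, hr₁.2]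
      have hr1 := hr.2
      have e : r ^ 2 - r₁ ^ 2 = (3 * r ^ 2 / 4 - y) + (r / 2 - x) * (r / 2 + x) := by
        rw [← h4]
        ring
      have e1 : |(r / 2 - x) * (r / 2 + x)| ≤ η * 2 := by
        rw [abs_mul]
        refine mul_le_mul (abs_le.2 ⟨hx.1.le, hx.2.le⟩) ?_ (abs_nonneg _) (by linarith)
        rw [abs_of_nonneg (by linarith)]
        linarith
      rw [e]
      refine (abs_add_le _ _).trans ?_
      have e2 : |3 * r ^ 2 / 4 - y| ≤ η := abs_le.2 ⟨hy.1.le, hy.2.le⟩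
      linarith
    · linarith [h3.1]
    · linarith [h3.1]
    · linarith [h3.1]
  · rw [mirror_apply_zero] at hx
    linarith [hnn hr₁' hu]

/-! ### Loops depend continuously on the itinerary -/

lemma exists_convex_comb {a b x : ℝ} (hx : x ∈ Icc a b) :
    ∃ v ∈ Icc (0 : ℝ) 1, x = (1 - v) * b + v * a := by
  rcases (hx.1.trans hx.2).eq_or_lt with h | h
  · subst h
    exact ⟨0, by norm_num, by linarith [hx.1, hx.2]⟩
  · refine ⟨(b - x) / (b - a), ⟨div_nonneg (by linarith [hx.2]) (by linarith),
      (div_le_one (by linarith)).2 (by linarith [hx.1])⟩, ?_⟩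
    have : b - a ≠ 0 := by linarith
    field_simp
    ring

/-- The three pieces of the descent with amplitude `p.1`, parametrized by `p.2 ∈ [0, 1]`. -/
def descentPiece : Fin 3 → ℝ × ℝ → Plane
  | 0, p => !₂[p.1 * p.2, p.1 ^ 2 * (1 - p.2 ^ 2)]
  | 1, p => !₂[(1 - p.2) * p.1 + p.2 * slideStart p.1,
      beanQ ((1 - p.2) * p.1 + p.2 * slideStart p.1) - beanQ p.1]
  | 2, p => !₂[(1 - p.2) * slideStart p.1, 0]

lemma continuous_descentPiece (k : Fin 3) : Continuous (descentPiece k) := by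
  have h1 : Continuous slideStart := by
    unfold slideStart
    fun_prop
  have h2 : Continuous beanQ := by
    unfold beanQ
    fun_prop
  fin_cases k
  · change Continuous fun p => descentPiece 0 p
    simp only [descentPiece]
    fun_prop
  · change Continuous fun p => descentPiece 1 p
    simp only [descentPiece]
    fun_prop
  · change Continuous fun p => descentPiece 2 p
    simp only [descentPiece]
    fun_prop

lemma mem_descentSet_iff {r : ℝ} (hr : r ∈ Ioc (0 : ℝ) 1) {p : Plane} :
    p ∈ descentSet r ↔ ∃ k, ∃ v ∈ Icc (0 : ℝ) 1, p = descentPiece k (r, v) := by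
  obtain ⟨hm0, hm1, -⟩ := slideStart_mem hr
  have h0 := hr.1
  have hfl := le_flightTime hr
  have hfd := flightTime_le_descentTime hr
  constructor
  · rintro ⟨u, hu, rfl⟩
    rcases le_or_gt u r with h | h
    · refine ⟨0, u / r, ⟨div_nonneg hu.1 h0.le, (div_le_one h0).2 h⟩, ?_⟩
      rw [descent_eq_of_le h, descentPiece]
      refine plane_ext ?_ ?_
      · simp only [Matrix.cons_val_zero]
        field_simp
      · simp only [Matrix.cons_val_one, Matrix.cons_val_fin_one]
        field_simp
    · rcases le_or_gt u (flightTime r) with h' | h'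
      · obtain ⟨v, hv, e⟩ := exists_convex_comb (flight_mem h.le h')
        refine ⟨1, v, hv, ?_⟩
        rw [descent_eq_of_mem h.le h', e, descentPiece]
      · obtain ⟨h1, h2, -⟩ := slidePos_descentTime_sub hr h'.le hu.2
        obtain ⟨v, hv, e⟩ := exists_convex_comb ⟨h1, h2⟩
        refine ⟨2, v, hv, ?_⟩
        rw [descent_eq_of_flightTime_le hr h'.le, e, descentPiece, mul_zero, add_zero]
  · rintro ⟨k, v, hv, rfl⟩
    have hv0 := hv.1
    have hv1 := hv.2
    fin_cases k
    · have h1 : r * v ≤ r := mul_le_of_le_one_right h0.le hv1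
      refine ⟨r * v, ⟨by positivity, h1.trans (lt_descentTime hr).le⟩, ?_⟩
      rw [descent_eq_of_le h1]
      simp only [descentPiece]
      congr 3
      ring
    · set x := (1 - v) * r + v * slideStart r with hx
      have h1 : slideStart r ≤ x := by nlinarith
      have h2 : x ≤ r := by nlinarith
      have h3 : r ≤ (3 * r - x) / 2 := by linarith
      have h4 : (3 * r - x) / 2 ≤ flightTime r := by
        unfold flightTime
        linarith
      refine ⟨(3 * r - x) / 2, ⟨by linarith, h4.trans hfd⟩, ?_⟩
      rw [descent_eq_of_mem h3 h4, show 3 * r - 2 * ((3 * r - x) / 2) = x by ring]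
      simp only [descentPiece, ← hx]
    · set x := (1 - v) * slideStart r with hx
      have h1 : 0 ≤ x := mul_nonneg (by linarith) hm0
      have h2 : x ≤ slideStart r := by nlinarith
      have hx1 : x ∈ Icc (-1 : ℝ) 1 := ⟨by linarith, by linarith [hr.2]⟩
      have h3 : slideTime x ≤ slideTime (slideStart r) :=
        strictMonoOn_slideTime.monotoneOn hx1 ⟨by linarith, by linarith [hr.2]⟩ h2
      have h4 : 0 ≤ slideTime x := by
        have := strictMonoOn_slideTime.monotoneOn (by norm_num) hx1 h1
        rwa [slideTime_zero] at this
      have h5 : flightTime r ≤ descentTime r - slideTime x := by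
        unfold descentTime
        linarith
      refine ⟨descentTime r - slideTime x, ⟨by linarith, by linarith⟩, ?_⟩
      rw [descent_eq_of_flightTime_le hr h5, sub_sub_cancel, slidePos_slideTime hx1]
      simp only [descentPiece, ← hx]

/-- Close amplitudes give close descents. -/
lemma exists_dist_descentSet_le {ε : ℝ} (hε : 0 < ε) :
    ∃ δ > 0, ∀ r ∈ Ioc (0 : ℝ) 1, ∀ r' ∈ Ioc (0 : ℝ) 1, |r - r'| < δ →
      ∀ p ∈ descentSet r, ∃ q ∈ descentSet r', dist p q ≤ ε := by
  have key : ∀ k, ∃ δ > 0, ∀ r ∈ Ioc (0 : ℝ) 1, ∀ r' ∈ Ioc (0 : ℝ) 1, |r - r'| < δ →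
      ∀ v ∈ Icc (0 : ℝ) 1, dist (descentPiece k (r, v)) (descentPiece k (r', v)) < ε := fun k => by
    have huc := ((isCompact_Icc (a := (0 : ℝ)) (b := 1)).prod
      (isCompact_Icc (a := (0 : ℝ)) (b := 1))).uniformContinuousOn_of_continuous
      (continuous_descentPiece k).continuousOn
    obtain ⟨δ, hδ, H⟩ := Metric.uniformContinuousOn_iff.1 huc ε hε
    refine ⟨δ, hδ, fun r hr r' hr' hrr v hv => H (r, v) ⟨⟨hr.1.le, hr.2⟩, hv⟩ (r', v)
      ⟨⟨hr'.1.le, hr'.2⟩, hv⟩ ?_⟩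
    rw [Prod.dist_eq, dist_self, Real.dist_eq]
    exact max_lt hrr hδ
  choose δ hδ H using key
  obtain ⟨c, hc, hcle⟩ := exists_pos_forall_le Finset.univ δ fun k _ => hδ k
  refine ⟨c, hc, fun r hr r' hr' hrr p hp => ?_⟩
  obtain ⟨k, v, hv, rfl⟩ := (mem_descentSet_iff hr).1 hp
  exact ⟨_, (mem_descentSet_iff hr').2 ⟨k, v, hv, rfl⟩,
    (H k r hr r' hr' (hrr.trans_le (hcle k (Finset.mem_univ k))) v hv).le⟩

/-- Close amplitudes give close loops. -/
lemma exists_hausdorffDist_bumpLoop_lt {ε : ℝ} (hε : 0 < ε) :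
    ∃ δ > 0, ∀ r ∈ Ioc (0 : ℝ) 1, ∀ r' ∈ Ioc (0 : ℝ) 1, ∀ r₁ ∈ Ioc (0 : ℝ) 1,
      ∀ r₁' ∈ Ioc (0 : ℝ) 1, |r - r₁| < δ → |r' - r₁'| < δ →
      Metric.hausdorffDist (bumpLoop r r') (bumpLoop r₁ r₁') < ε := by
  obtain ⟨δ, hδ, H⟩ := exists_dist_descentSet_le (half_pos hε)
  have key : ∀ r ∈ Ioc (0 : ℝ) 1, ∀ r' ∈ Ioc (0 : ℝ) 1, ∀ r₁ ∈ Ioc (0 : ℝ) 1,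
      ∀ r₁' ∈ Ioc (0 : ℝ) 1, |r - r₁| < δ → |r' - r₁'| < δ → ∀ p ∈ bumpLoop r r',
      ∃ q ∈ bumpLoop r₁ r₁', dist p q ≤ ε / 2 := by
    rintro r hr r' hr' r₁ hr₁ r₁' hr₁' h h' p (hp | ⟨p, hp, rfl⟩)
    · obtain ⟨q, hq, hpq⟩ := H r hr r₁ hr₁ h p hp
      exact ⟨q, Or.inl hq, hpq⟩
    · obtain ⟨q, hq, hpq⟩ := H r' hr' r₁' hr₁' h' p hp
      exact ⟨_, Or.inr ⟨q, hq, rfl⟩, by rwa [dist_mirror]⟩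
  refine ⟨δ, hδ, fun r hr r' hr' r₁ hr₁ r₁' hr₁' h h' => ?_⟩
  refine (Metric.hausdorffDist_le_of_mem_dist (half_pos hε).le
    (key r hr r' hr' r₁ hr₁ r₁' hr₁' h h') ?_).trans_lt (half_lt_self hε)
  rw [abs_sub_comm] at h h'
  exact key r₁ hr₁ r₁' hr₁' r hr r' hr' h h'

/-! ### The return map is conjugate to the shift -/

/-- A series with weights `2^{-|i|}` and bounded terms tends to `0` with `ρ` as soon as each term
does. -/
lemma exists_tsum_lt {α : Type*} {ρ : α → ℝ} {G : α → ℤ → ℝ} {C : ℝ} (hG0 : ∀ a i, 0 ≤ G a i)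
    (hGC : ∀ a i, G a i ≤ C)
    (h : ∀ i, ∀ ε > 0, ∃ δ > 0, ∀ a, ρ a < δ → G a i < ε) {ε : ℝ} (hε : 0 < ε) :
    ∃ δ > 0, ∀ a, ρ a < δ → ∑' i : ℤ, G a i / 2 ^ i.natAbs < ε := by
  by_cases hα : Nonempty α
  · obtain ⟨a₀⟩ := hα
    have hC : 0 ≤ C := (hG0 a₀ 0).trans (hGC a₀ 0)
    have hle : ∀ (i : ℤ), C ≤ C * (1 + (i.natAbs : ℝ)) := fun i =>
      le_mul_of_one_le_right hC (by
        have : (0 : ℝ) ≤ i.natAbs := Nat.cast_nonneg _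
        linarith)
    have hsum : Summable fun i : ℤ => C / 2 ^ i.natAbs :=
      summable_div_two_pow_of_le (f := fun _ => C) C (fun _ => hC) hle
    have hGs : ∀ a, Summable fun i : ℤ => G a i / 2 ^ i.natAbs := fun a =>
      summable_div_two_pow_of_le C (hG0 a) fun i => (hGC a i).trans (hle i)
    obtain ⟨A, hA⟩ := (hsum.hasSum.eventually_const_lt
      (sub_lt_self (∑' i : ℤ, C / 2 ^ i.natAbs) (half_pos hε))).exists
    have hcard : 0 < ε / (2 * (A.card + 1)) := by positivity
    choose δ hδ H using fun i => h i _ hcard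
    obtain ⟨c, hc, hcle⟩ := exists_pos_forall_le A δ fun i _ => hδ i
    refine ⟨c, hc, fun a ha => ?_⟩
    have h1 : ∑ i ∈ A, G a i / 2 ^ i.natAbs ≤ A.card * (ε / (2 * (A.card + 1))) := by
      rw [← nsmul_eq_mul]
      refine Finset.sum_le_card_nsmul _ _ _ fun i hi => ?_
      exact (div_le_self (hG0 a i) (one_le_pow₀ (by norm_num))).trans
        (H i a (ha.trans_le (hcle i hi))).le
    have h2 : A.card * (ε / (2 * (A.card + 1))) < ε / 2 := by
      rw [mul_div_assoc', div_lt_div_iff₀ (by positivity) (by norm_num)]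
      nlinarith
    -- outside `A`, the terms are dominated by the tail of the series of the bounds
    have h3 := (hsum.sub (hGs a)).sum_le_tsum A fun i _ => by
      rw [← sub_div]
      exact div_nonneg (sub_nonneg.2 (hGC a i)) (by positivity)
    rw [Finset.sum_sub_distrib, hsum.tsum_sub (hGs a)] at h3
    linarith
  · exact ⟨1, one_pos, fun a => absurd ⟨a⟩ hα⟩

lemma hitRho_mk (γ γ' : BeanTraj) :
    hitRho beanX beanY LambdaBean sectionK (Quotient.mk _ γ) (Quotient.mk _ γ') =
      ∑' i : ℤ, Metric.hausdorffDist (bumpLoop √(beanItinerary γ i) √(beanItinerary γ (i + 1)))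
        (bumpLoop √(beanItinerary γ' i) √(beanItinerary γ' (i + 1))) / 2 ^ i.natAbs := by
  simp only [hitRho, hitRhoTerm, loop_eq]

lemma summable_hitRhoTerm (q q' : MaxBar beanX beanY LambdaBean sectionK) :
    Summable (hitRhoTerm beanX beanY LambdaBean sectionK q q') := by
  induction q using Quotient.inductionOn with
  | h γ => induction q' using Quotient.inductionOn with
    | h γ' =>
      refine summable_div_two_pow_of_le 4 (fun _ => Metric.hausdorffDist_nonneg) fun i => ?_
      rw [loop_eq, loop_eq]
      have := hausdorffDist_bumpLoop_le γ γ' i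
      have h0 : (0 : ℝ) ≤ i.natAbs := Nat.cast_nonneg _
      linarith

/-- Close loops have close amplitudes. -/
lemma exists_itinerary_lt (γ : BeanTraj) (i : ℤ) {ε : ℝ} (hε : 0 < ε) :
    ∃ η > 0, ∀ γ' : BeanTraj,
      Metric.hausdorffDist (bumpLoop √(beanItinerary γ i) √(beanItinerary γ (i + 1)))
        (bumpLoop √(beanItinerary γ' i) √(beanItinerary γ' (i + 1))) < η →
      dist (beanItinerary γ i) (beanItinerary γ' i) < ε := by
  have hr := sqrt_itinerary_mem γ i
  set r := √(beanItinerary γ i)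
  have hr0 := hr.1
  refine ⟨min (min (r / 2) (3 * r ^ 2 / 4)) (ε / 4), by positivity, fun γ' h => ?_⟩
  have h1 := abs_sq_sub_sq_le hr (sqrt_itinerary_mem γ (i + 1)) (sqrt_itinerary_mem γ' i)
    (sqrt_itinerary_mem γ' (i + 1)) ((min_le_left _ _).trans (min_le_left _ _))
    ((min_le_left _ _).trans (min_le_right _ _)) h
  have h2 := min_le_right (min (r / 2) (3 * r ^ 2 / 4)) (ε / 4)
  have h3 : r ^ 2 = beanItinerary γ i := Real.sq_sqrt (beanItinerary_mem γ i).1.le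
  have h4 := Real.sq_sqrt (beanItinerary_mem γ' i).1.le
  have h5 := h1.trans (mul_le_mul_of_nonneg_left h2 (by norm_num))
  rw [h3, h4, ← Real.dist_eq] at h5
  linarith

lemma isMetricFn_hitRho : IsMetricFn (hitRho beanX beanY LambdaBean sectionK) := by
  refine isMetricFn_tsum_hausdorffDist (loop beanX beanY LambdaBean sectionK) (fun q i => ?_)
    (fun q i => ?_) (fun q q' h => ?_) summable_hitRhoTerm
  · induction q using Quotient.inductionOn with
    | h γ =>
      rw [loop_eq]
      exact nonempty_bumpLoop (sqrt_itinerary_mem γ i)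
  · induction q using Quotient.inductionOn with
    | h γ =>
      rw [loop_eq]
      exact isCompact_bumpLoop (sqrt_itinerary_mem γ i) (sqrt_itinerary_mem γ (i + 1))
  · induction q using Quotient.inductionOn with
    | h γ => induction q' using Quotient.inductionOn with
      | h γ' =>
        refine Quotient.sound (funext fun i => ?_)
        by_contra hne
        obtain ⟨η, hη, H⟩ := exists_itinerary_lt γ i (dist_pos.2 hne)
        refine (H γ' ?_).false
        have := h i
        rw [loop_eq, loop_eq] at this
        rwa [this, Metric.hausdorffDist_self_zero]

lemma summable_seqTerm_unit {a b : ℤ → ℝ} (ha : a ∈ fullShift (Ioc (0 : ℝ) 1))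
    (hb : b ∈ fullShift (Ioc (0 : ℝ) 1)) : Summable (seqTerm a b) :=
  summable_div_two_pow_of_le 1 (fun _ => dist_nonneg) fun j => by
    have h1 := ha j
    have h2 := hb j
    have h0 : (0 : ℝ) ≤ j.natAbs := Nat.cast_nonneg _
    have : dist (a j) (b j) ≤ 1 := by
      rw [Real.dist_eq]
      exact abs_le.2 ⟨by linarith [h1.1, h2.2], by linarith [h1.2, h2.1]⟩
    linarith

lemma returnConjugacy_bean :
    ReturnConjugacy beanX beanY LambdaBean sectionK (fullShift (Ioc (0 : ℝ) 1)) := by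
  obtain ⟨T, hT, hTs⟩ := exists_returnMap
  have hmem : ∀ γ, beanItinerary γ ∈ fullShift (Ioc (0 : ℝ) 1) := beanItinerary_mem
  refine ⟨fun J γ hγ hex => hγ.1.forall_mem_of_exists_mem (fun a b harc s hs t ht hL =>
    (isArc_bean_iff.1 harc).mem_LambdaBean hs ht hL) hex, fun γ => ?_, exists_unique_hitRep,
    summable_hitRhoTerm, T, hT, itineraryConjugacy_of isMetricFn_hitRho
      (fun a ha b hb => summable_seqTerm_unit ha hb)
      (shift_image_eq fun a => ?_) (Subset.antisymm ?_ fun a ha => ?_) hTs (fun γ ε hε => ?_)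
      fun γ ε hε => ?_⟩
  · obtain ⟨t, r, h, h0, h1⟩ := exists_hasBumps γ
    exact ⟨t, h.isBeats h0 h1, fun t' ht' => h.eq_of_isBeats h0 h1 ht'⟩
  · exact ⟨fun h j => by simpa using h (j - 1), fun h j => h (j + 1)⟩
  · rintro _ ⟨γ, rfl⟩
    exact hmem γ
  · obtain ⟨γ, t, h, h0⟩ := exists_beanTraj (r := fun j => √(a j))
      fun j => ⟨Real.sqrt_pos.2 (ha j).1, Real.sqrt_le_one.2 (ha j).2⟩
    have h1 : 0 < t 1 := h0 ▸ h.times.strictMono (by norm_num)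
    exact ⟨γ, funext fun j => by
      rw [← Real.sq_sqrt (ha j).1.le]
      exact h.itinerary_eq h0.le h1 j⟩
  · refine exists_tsum_lt (ρ := fun γ' => hitRho beanX beanY LambdaBean sectionK (Quotient.mk _ γ)
      (Quotient.mk _ γ')) (G := fun γ' i => dist (beanItinerary γ i) (beanItinerary γ' i)) (C := 1)
      (fun _ _ => dist_nonneg) (fun γ' i => ?_) (fun i ε hε => ?_) hε
    · have h1 := hmem γ i
      have h2 := hmem γ' i
      rw [Real.dist_eq]
      exact abs_le.2 ⟨by linarith [h1.1, h2.2], by linarith [h1.2, h2.1]⟩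
    · obtain ⟨η, hη, H⟩ := exists_itinerary_lt γ i hε
      refine ⟨η / 2 ^ i.natAbs, by positivity, fun γ' hγ' => H γ' ?_⟩
      have h1 := (summable_hitRhoTerm (Quotient.mk _ γ) (Quotient.mk _ γ')).le_tsum i
        fun j _ => div_nonneg Metric.hausdorffDist_nonneg (by positivity)
      have h2 := h1.trans_lt hγ'
      rw [hitRhoTerm, loop_eq, loop_eq] at h2
      exact (div_lt_div_iff_of_pos_right (by positivity)).1 h2
  · simp only [hitRho_mk]
    refine exists_tsum_lt (ρ := fun γ' => seqDist (beanItinerary γ) (beanItinerary γ')) (C := 4)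
      (fun _ _ => Metric.hausdorffDist_nonneg) (hausdorffDist_bumpLoop_le γ) (fun i ε hε => ?_) hε
    obtain ⟨δ, hδ, H⟩ := exists_hausdorffDist_bumpLoop_lt hε
    have hroot : ∀ j, ∃ c > 0, ∀ γ', seqDist (beanItinerary γ) (beanItinerary γ') < c →
        |√(beanItinerary γ j) - √(beanItinerary γ' j)| < δ := fun j => by
      obtain ⟨c, hc, Hc⟩ := Metric.continuous_iff.1 Real.continuous_sqrt (beanItinerary γ j) δ hδ
      refine ⟨c / 2 ^ j.natAbs, by positivity, fun γ' hγ' => ?_⟩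
      have h1 := dist_le_seqDist (summable_seqTerm_unit (hmem γ) (hmem γ')) j
      rw [lt_div_iff₀ (by positivity), mul_comm] at hγ'
      rw [abs_sub_comm, ← Real.dist_eq]
      exact Hc _ (by rw [dist_comm]; linarith)
    obtain ⟨c, hc, Hc⟩ := hroot i
    obtain ⟨c', hc', Hc'⟩ := hroot (i + 1)
    exact ⟨min c c', lt_min hc hc', fun γ' hγ' => H _ (sqrt_itinerary_mem γ i) _
      (sqrt_itinerary_mem γ (i + 1)) _ (sqrt_itinerary_mem γ' i) _ (sqrt_itinerary_mem γ' (i + 1))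
      (Hc γ' (hγ'.trans_le (min_le_left _ _))) (Hc' γ' (hγ'.trans_le (min_le_right _ _)))⟩

lemma isCompact_LambdaBean : IsCompact LambdaBean := by
  have hF : Continuous fun p : ℝ × ℝ =>
      (!₂[p.1, (1 - p.2) * (1 - p.1 ^ 2) + p.2 * (p.1 ^ 4 / 2 - p.1 ^ 2 / 2)] : Plane) := by
    fun_prop
  convert ((isCompact_Icc (a := (-1 : ℝ)) (b := 1)).prod
    (isCompact_Icc (a := (0 : ℝ)) (b := 1))).image hF using 1
  ext q
  constructor
  · rintro ⟨h1, h2⟩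
    obtain ⟨v, hv, e⟩ := exists_convex_comb h2
    exact ⟨(q 0, v), ⟨h1, hv⟩, plane_ext (by simp) (by simp [e])⟩
  · rintro ⟨⟨x, v⟩, ⟨hx, hv⟩, rfl⟩
    have hx' : 0 ≤ 1 - x ^ 2 := by nlinarith [hx.1, hx.2]
    have h1 : x ^ 4 / 2 - x ^ 2 / 2 ≤ 1 - x ^ 2 := by nlinarith [sq_nonneg x]
    refine ⟨by simpa using hx, ?_⟩
    simp only [Matrix.cons_val_zero, Matrix.cons_val_one, Matrix.cons_val_fin_one]
    constructor <;> nlinarith [hv.1, hv.2]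

end

theorem theoremA :
    -- (i)
    (IsCompact (LambdaK 2) ∧
      TimeOneConjugacy (planeField 1 fun x => x / 2 - 4 * x ^ 3) (planeField (-1) fun x => x / 2 - 4 * x ^ 3)
        (LambdaK 2) (foldsK 2) (arcK 2) (fullShift {0, 1})) ∧
    -- (ii)
    (∀ k : ℕ, 3 ≤ k →
      IsCompact (LambdaK k) ∧
      ∃ S : Set (ℤ → ℤ),
        IsSubshift (fullShift (Set.Ico 0 (2 * ((k : ℤ) - 1)))) S ∧
        (∀ n ∈ Set.Ico 0 (2 * ((k : ℤ) - 1)), ∃ a ∈ S, ∃ j, a j = n) ∧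
        TimeOneConjugacy (planeField 1 (deriv (polyP k))) (planeField (-1) (deriv (polyP k)))
          (LambdaK k) (foldsK k) (arcK k) S) ∧
    -- (iii)
    (IsSubshift ThetaInf admissibleInf ∧
      TimeOneConjugacy (planeField 1 fun x => 2 * Real.sin (2 * Real.pi * x))
        (planeField (-1) fun x => 2 * Real.sin (2 * Real.pi * x))
        LambdaInf foldsInf arcInf admissibleInf) ∧
    -- (iv)
    (IsCompact LambdaBean ∧
      ReturnConjugacy beanX beanY LambdaBean sectionK (fullShift (Set.Ioc (0 : ℝ) 1)) ∧
      ∀ γ : MaxTraj beanX beanY LambdaBean,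
        IsGlobalTrajectory beanX beanY γ.toFun ↔
          (¬ Summable fun n : ℕ =>
            √(hitItinerary beanX beanY LambdaBean sectionK γ (n : ℤ))) ∧
          ¬ Summable fun n : ℕ =>
            √(hitItinerary beanX beanY LambdaBean sectionK γ (-(n : ℤ)))) := by
  refine ⟨⟨isCompact_LambdaK le_rfl, ?_⟩, fun k hk => ⟨isCompact_LambdaK (by omega), _, isSubshift_K,
    fun n hn => exists_admissible (by omega) hn, timeOneConjugacy_K (by omega)⟩,
    ⟨isSubshift_inf, timeOneConjugacy_inf⟩, ?_⟩
  · rw [← admissible_two, ← deriv_polyP_two]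
    exact timeOneConjugacy_K le_rfl
  · exact ⟨isCompact_LambdaBean, returnConjugacy_bean, isGlobalTrajectory_bean_iff⟩
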